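/- **Setting.** Time is $\mathcal T=\{0,1,2,\dots\}$; $\Theta$ is a finite set of states with full-support prior $\mu_0\in\Delta(\Theta)$; $A$ is a finite non-empty set of actions. The decision maker (DM) has payoff $v:A\times\Theta\times\mathcal T\to\mathbb R$ with $v(a,\theta,t)<v(a,\theta,t')$ whenever $t>t'$. Write $v^*_t(\mu)=\max_a\mathbb E_{\theta\sim\mu}v(a,\theta,t)$ and $a^*_t(\mu)$ for the set of maximizers. A *dynamic information structure* $I$ is a probability distribution over paths $(\mu_t,m_t)_{t\ge 1}$ of beliefs $\mu_t\in\Delta(\Theta)$ and messages $m_t\in\mathbb R$ such that, with $H_t=(\mu_s,m_s)_{s\le t}$, $\mathbb E^I[\mu_{t+1}\mid H_t]=\mu_t$ almost surely for all $t\ge 0$. Let $U^I(H_t)=\operatorname{ess\,sup}\,\mathbb E^I[v(a_\tau,\theta,\tau)\mid H_t]$ over almost surely finite stopping times $\tau\ge t$ and stochastic actions $a_\tau$ adapted to the natural filtration, with finite expected payoff. The DM stops at $H_t$ iff $v^*_t(\mu_t)>\mathbb E^I[U^I(H_{t+1})\mid H_t]$ (indifference is broken in favour of continuing); $\tau(I)$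 is the first time at which she stops, and $\tau_t(I)$ is the first time $s\ge t$ at which she stops. On stopping at time $t$ with belief $\mu$ she plays the mixed action $\gamma_t[\mu]\in\Delta(a^*_t(\mu))$, where $\gamma=(\gamma_t)_t$ is a sequence of measurable tie-breaking rules; $\gamma$ is chosen together with $I$ (ties may be broken in the designer's favour). Let $\mathcal I$ be the set of pairs $(I,\gamma)$ with $\tau(I)<\infty$ almost surely, and $d(I,\gamma)\in\Delta(A\times\mathcal T)$ the joint distribution of $(a_{\tau(I)},\tau(I))$. The designer has preferences $f:A\times\mathcal T\to\mathbb R$ and payoff $\mathbb E^{I,\gamma}[f(a_\tau,\tau)]$. A pair $(I,\gamma)\in\mathcal I$ is *sequentially optimal*, written $(I,\gamma)\in\mathcal I^{SEQ}(f)$, if for every $t$ and $I$-almost every history $H_t$ at which the DM is still paying attention ($\tau(I)\ge t$), $$\sup_{(I',\gamma')}\mathbb E^{I',\gamma'}\big[f(a_{\tau_t(I')},\tau_t(I'))\mid H_t\big]=\mathbb E^{I,\gamma}\big[f(a_{\tau_t(I)},\tau_t(I))\mid H_t\big],$$ the supremum being over all information structures $I'$ (with prior $\mu_0$) and tie-breaking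 rules $\gamma'$ such that $H_t$ has positive probability under $I'$ and $\tau_t(I')<\infty$ almost surely given $H_t$. *Compactness assumption.* Let $X^{EXT}_t$ be the set of extreme points of the sets $\{\mu\in\Delta(\Theta):B\subseteq a^*_t(\mu)\}$, $B\subseteq A$, and $X^{EXT}(\mathcal T)=\{(\mu,t):\mu\in X^{EXT}_t\}$. A structure is *extremal and obedient* if it uses two messages $C,S$ and there is a deterministic belief path $(\mu^C_t)_t$ such that, almost surely, as long as only $C$ has been received (in particular at time $0$) the DM continues, and in the next period $t$ she receives either $S$ with a belief in $X^{EXT}_t$, and stops, or $C$ with belief $\mu^C_t$. Let $\mathcal P\subseteq\Delta(X^{EXT}(\mathcal T))$ be the set of distributions of $(\mu_\tau,\tau)$ induced by such structures, and $h(\mu,t)=\max_{a\in a^*_t(\mu)}f(a,t)$. Assume that there is a metric on $\Delta(X^{EXT}(\mathcal T))$ under which $\mathcal P$ is compact and $p\mapsto\sum_{(\mu,t)}p_{\mu,t}h(\mu,t)$ is a well-defined (absolutely convergent) continuous function on $\mathcal P$. **Proposition 2.** For every $f:A\times\mathcal T\to\mathbb R$ satisfying the compactness assumption there exist $(I^*,\gamma^*)\in\operatorname{argmax}_{(I,\gamma)\in\mathcal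 I}\mathbb E^{I,\gamma}[f(a_\tau,\tau)]$ and a sequentially optimal $(I^{**},\gamma^{**})\in\mathcal I^{SEQ}(f)$ with $d(I^*,\gamma^*)=d(I^{**},\gamma^{**})$. In particular there is no commitment gap: both maxima below are attained, are finite, and $$\max_{(I,\gamma)\in\mathcal I}\mathbb E^{I,\gamma}[f(a_\tau,\tau)]=\max_{(I,\gamma)\in\mathcal I^{SEQ}(f)}\mathbb E^{I,\gamma}[f(a_\tau,\tau)].$$ -/

import Mathlib

open MeasureTheory ProbabilityTheory Set
open scoped ENNReal

noncomputable section

namespace AttentionCapture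

/-- Beliefs `Δ(Θ)` over a finite state space. -/
abbrev Belief (Θ : Type*) [Fintype Θ] : Type _ := stdSimplex ℝ Θ

instance Belief.instStandardBorelSpace (Θ : Type*) [Fintype Θ] :
    StandardBorelSpace (Belief Θ) :=
  (isClosed_stdSimplex ℝ Θ).measurableSet.standardBorel

/-- Paths of belief-message pairs; coordinate `t` is `(μ_t, m_t)`. Messages are real numbers. -/
abbrev Path (Θ : Type*) [Fintype Θ] : Type _ := ℕ → Belief Θ × ℝ

/-- The natural filtration: `hist Θ t` is generated by the coordinates `s ≤ t`, i.e. by the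
time-`t` history `H_t`. -/
abbrev hist (Θ : Type*) [Fintype Θ] :
    Filtration ℕ (inferInstance : MeasurableSpace (Path Θ)) :=
  Filtration.piLE (X := fun _ : ℕ => Belief Θ × ℝ)

/-- A dynamic information structure with prior `μ₀`: a distribution over paths of beliefs and
messages for which beliefs form a martingale. There is no information at time `0`: the time-`0`
coordinate is the constant `(μ₀, 0)`. -/
structure InfoStructure {Θ : Type*} [Fintype Θ] (μ₀ : Belief Θ) where
  law : Measure (Path Θ)
  isProb : IsProbabilityMeasure law
  initial : ∀ᵐ ω ∂law, ω 0 = (μ₀, (0 : ℝ))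
  martingale : ∀ (t : ℕ) (θ : Θ),
    law[fun ω => (ω (t + 1)).1 θ | hist Θ t] =ᵐ[law] fun ω => (ω t).1 θ

instance InfoStructure.instIsProbabilityMeasure {Θ : Type*} [Fintype Θ] {μ₀ : Belief Θ}
    (I : InfoStructure μ₀) : IsProbabilityMeasure I.law := I.isProb

variable {Θ A : Type*} [Fintype Θ] [Fintype A] {μ₀ : Belief Θ}

/-! ### Static decision problem -/

/-- `E_{θ ∼ μ} v(a, θ, t)`. -/
def expUtil (v : A → Θ → ℕ → ℝ) (t : ℕ) (μ : Belief Θ) (a : A) : ℝ := ∑ θ, μ θ * v a θ t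

/-- The indirect utility `v*_t(μ)`. -/
def vStar (v : A → Θ → ℕ → ℝ) (t : ℕ) (μ : Belief Θ) : ℝ := ⨆ a, expUtil v t μ a

/-- The best responses `a*_t(μ)`. -/
def bestResp (v : A → Θ → ℕ → ℝ) (t : ℕ) (μ : Belief Θ) : Set A :=
  {a | ∀ b, expUtil v t μ b ≤ expUtil v t μ a}

/-- `X_{B,t}`: the beliefs at which every action in `B` is optimal at time `t`. -/
def optRegion (v : A → Θ → ℕ → ℝ) (t : ℕ) (B : Set A) : Set (Θ → ℝ) :=
  {x | ∃ μ : Belief Θ, (μ : Θ → ℝ) = x ∧ B ⊆ bestResp v t μ}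

/-- `X^EXT_t`: the time-`t` extremal stopping beliefs. -/
def extBeliefs (v : A → Θ → ℕ → ℝ) (t : ℕ) : Set (Belief Θ) :=
  {μ | ∃ B : Set A, (μ : Θ → ℝ) ∈ extremePoints ℝ (optRegion v t B)}

/-- A sequence of proper tie-breaking rules `γ_t : Δ(Θ) → Δ(A)`: only best responses are played. -/
structure TieBreak (v : A → Θ → ℕ → ℝ) where
  rule : ℕ → Belief Θ → stdSimplex ℝ A
  measurable : ∀ t, Measurable (rule t)
  proper : ∀ t μ a, 0 < rule t μ a → a ∈ bestResp v t μ

/-! ### The decision maker's stopping problem -/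

/-- A plan of the decision maker: a stopping time and a stochastic action, both adapted to the
natural filtration. -/
structure Plan (Θ A : Type*) [Fintype Θ] [Fintype A] where
  time : Path Θ → WithTop ℕ
  isStoppingTime : IsStoppingTime (hist Θ) time
  action : ℕ → Path Θ → stdSimplex ℝ A
  adapted : ∀ t, Measurable[hist Θ t] (action t)

/-- The payoff of a plan along a path; the state has been integrated out with the belief at the
time of action. (Only used for plans whose time is almost surely finite.) -/
def Plan.payoff (v : A → Θ → ℕ → ℝ) (P : Plan Θ A) (ω : Path Θ) : ℝ :=
  ∑ a, P.action ((P.time ω).untopD 0) ω a *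
    expUtil v ((P.time ω).untopD 0) (ω ((P.time ω).untopD 0)).1 a

/-- The plans available from time `t` on: the decision maker acts at some finite time `≥ t`, and
her expected payoff is finite. (Payoffs are bounded above, so the plans left out here have expected
payoff `-∞`.) -/
def Plan.AvailableFrom (v : A → Θ → ℕ → ℝ) (I : InfoStructure μ₀) (t : ℕ) (P : Plan Θ A) : Prop :=
  (∀ᵐ ω ∂I.law, (t : WithTop ℕ) ≤ P.time ω ∧ P.time ω < ⊤) ∧ Integrable (P.payoff v) I.law

/-- `U` is (a version of) `U^I(H_t) = sup_{τ ≥ t, a_τ} E^I[v(a_τ, θ, τ) | H_t]`, the essential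
supremum of the conditional expected payoffs over all plans available from `t` on. -/
structure IsValue (v : A → Θ → ℕ → ℝ) (I : InfoStructure μ₀) (t : ℕ) (U : Path Θ → ℝ) : Prop where
  measurable : Measurable[hist Θ t] U
  upper : ∀ P : Plan Θ A, P.AvailableFrom v I t → I.law[P.payoff v | hist Θ t] ≤ᵐ[I.law] U
  least : ∀ U' : Path Θ → ℝ, Measurable[hist Θ t] U' →
    (∀ P : Plan Θ A, P.AvailableFrom v I t → I.law[P.payoff v | hist Θ t] ≤ᵐ[I.law] U') →
    U ≤ᵐ[I.law] U'

open Classical in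
/-- The value `U^I(H_t)` as a function of the path (unique up to null sets). -/
def value (v : A → Θ → ℕ → ℝ) (I : InfoStructure μ₀) (t : ℕ) : Path Θ → ℝ :=
  if h : ∃ U, IsValue v I t U then h.choose else 0

/-- The continuation value `E^I[U^I(H_{t+1}) | H_t]`. -/
def contValue (v : A → Θ → ℕ → ℝ) (I : InfoStructure μ₀) (t : ℕ) : Path Θ → ℝ :=
  I.law[value v I (t + 1) | hist Θ t]

/-- At `H_t` the decision maker stops iff acting now is strictly better than continuing
(indifference is broken in favour of continuing). -/
def StopsAt (v : A → Θ → ℕ → ℝ) (I : InfoStructure μ₀) (t : ℕ) (ω : Path Θ) : Prop :=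
  contValue v I t ω < vStar v t (ω t).1

/-- The time at which the decision maker stops if she is still paying attention at time `t`;
it is `⊤` if she never stops. -/
def stopFrom (v : A → Θ → ℕ → ℝ) (I : InfoStructure μ₀) (t : ℕ) (ω : Path Θ) : ℕ∞ :=
  ⨅ (s : ℕ) (_ : t ≤ s ∧ StopsAt v I s ω), (s : ℕ∞)

/-- The stopping time `τ(I)`. -/
def stopTime (v : A → Θ → ℕ → ℝ) (I : InfoStructure μ₀) : Path Θ → ℕ∞ := stopFrom v I 0

/-- The joint distribution of the action and of the stopping time of a decision maker who is still
paying attention at time `t`, when paths are drawn from `Q`. -/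
def outcomeDist (v : A → Θ → ℕ → ℝ) (I : InfoStructure μ₀) (γ : TieBreak v) (t : ℕ)
    (Q : Measure (Path Θ)) : A × ℕ → ℝ≥0∞ :=
  fun x => ∫⁻ ω in {ω | stopFrom v I t ω = x.2}, ENNReal.ofReal (γ.rule x.2 (ω x.2).1 x.1) ∂Q

/-- The joint distribution `d(I)` over `A × 𝒯` induced by `I` (and the tie-breaking rule `γ`). -/
def jointDist (v : A → Θ → ℕ → ℝ) (I : InfoStructure μ₀) (γ : TieBreak v) : A × ℕ → ℝ≥0∞ :=
  outcomeDist v I γ 0 I.law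

/-- `I` belongs to the structures over which the designer optimizes: the decision maker stops
almost surely, so that `d(I)` is a probability distribution over `A × 𝒯`. -/
def Admissible (v : A → Θ → ℕ → ℝ) (I : InfoStructure μ₀) : Prop :=
  ∀ᵐ ω ∂I.law, stopTime v I ω < ⊤

/-! ### The designer's problem -/

/-- The expectation of `f` under `d`, as the difference of the expectations of the positive and of
the negative part (`∞ - ∞` is read as `-∞`). -/
def expPayoff (f : A → ℕ → ℝ) (d : A × ℕ → ℝ≥0∞) : EReal :=
  ((∑' x : A × ℕ, d x * ENNReal.ofReal (f x.1 x.2) : ℝ≥0∞) : EReal) -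
    ((∑' x : A × ℕ, d x * ENNReal.ofReal (-f x.1 x.2) : ℝ≥0∞) : EReal)

/-- The designer's payoff `E^I[f(a_τ, τ)]`. -/
def designerPayoff (v : A → Θ → ℕ → ℝ) (f : A → ℕ → ℝ) (I : InfoStructure μ₀) (γ : TieBreak v) :
    EReal :=
  expPayoff f (jointDist v I γ)

/-- `I` (with tie-breaking `γ`) solves the designer's problem under full commitment. -/
def DesignerOptimal (v : A → Θ → ℕ → ℝ) (f : A → ℕ → ℝ) (I : InfoStructure μ₀) (γ : TieBreak v) :
    Prop :=
  Admissible v I ∧ ∀ (I' : InfoStructure μ₀) (γ' : TieBreak v), Admissible v I' →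
    designerPayoff v f I' γ' ≤ designerPayoff v f I γ

/-- The event that the time-`t` history is the one of the path `ω`. -/
def historyEvent (t : ℕ) (ω : Path Θ) : Set (Path Θ) := {ω' | ∀ s ≤ t, ω' s = ω s}

/-- The alternatives available to the designer at the history `H_t` of `ω`: structures for which
`H_t` has positive probability and after which the decision maker stops almost surely. -/
def AlternativeAt (v : A → Θ → ℕ → ℝ) (t : ℕ) (ω : Path Θ) (I' : InfoStructure μ₀) : Prop :=
  0 < I'.law (historyEvent t ω) ∧ ∀ᵐ ω' ∂(I'.law[|historyEvent t ω]), stopFrom v I' t ω' < ⊤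

/-- Sequential optimality: at (almost) every history `H_t` at which the decision maker is still
paying attention, the conditional expected payoff of the designer from the continuation of `I` is
the supremum, over all alternatives `I'`, of the conditional expected payoff from the continuation
of `I'`. -/
def SequentiallyOptimal (v : A → Θ → ℕ → ℝ) (f : A → ℕ → ℝ) (I : InfoStructure μ₀)
    (γ : TieBreak v) : Prop :=
  Admissible v I ∧ ∀ t : ℕ, ∀ᵐ ω ∂I.law, (t : ℕ∞) ≤ stopTime v I ω →
    (⨆ (I' : InfoStructure μ₀) (γ' : TieBreak v) (_ : AlternativeAt v t ω I'),
        expPayoff f (outcomeDist v I' γ' t (I'.law[|historyEvent t ω]))) =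
      expPayoff f (outcomeDist v I γ t (condExpKernel I.law (hist Θ t) ω))

/-! ### The compactness assumption -/

/-- Extremal and obedient structures, with message `0` for "continue" and `1` for "stop". As long as
only "continue" has been received (in particular at time `0`) the decision maker continues, and next
period she either receives "stop" together with an extremal belief, and stops, or receives
"continue" together with the unique continuation belief. -/
def ExtremalObedient (v : A → Θ → ℕ → ℝ) (I : InfoStructure μ₀) : Prop :=
  ∃ μC : ℕ → Belief Θ, ∀ᵐ ω ∂I.law, ∀ t : ℕ, (∀ s ≤ t, (ω s).2 = 0) →
    ¬ StopsAt v I t ω ∧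
      (((ω (t + 1)).2 = 1 ∧ (ω (t + 1)).1 ∈ extBeliefs v (t + 1) ∧ StopsAt v I (t + 1) ω) ∨
        ((ω (t + 1)).2 = 0 ∧ (ω (t + 1)).1 = μC (t + 1)))

/-- `Δ(X^EXT(𝒯))`: probability distributions over pairs of a time and an extremal belief for that
time. -/
structure ExtDist (v : A → Θ → ℕ → ℝ) where
  mass : {x : Belief Θ × ℕ // x.1 ∈ extBeliefs v x.2} → ℝ
  nonneg : ∀ x, 0 ≤ mass x
  hasSum_one : HasSum mass 1

/-- `𝒫`: the distributions of stopping beliefs and stopping times that are induced by extremal and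
obedient structures. -/
def feasibleDists (v : A → Θ → ℕ → ℝ) (μ₀ : Belief Θ) : Set (ExtDist v) :=
  {p | ∃ I : InfoStructure μ₀, ExtremalObedient v I ∧
    ∀ x, p.mass x = I.law.real {ω | stopTime v I ω = x.1.2 ∧ (ω x.1.2).1 = x.1.1}}

/-- The designer's indirect utility `h(μ, t) = max_{a ∈ a*_t(μ)} f(a, t)`. -/
def indirectPayoff (v : A → Θ → ℕ → ℝ) (f : A → ℕ → ℝ) (μ : Belief Θ) (t : ℕ) : ℝ :=
  sSup ((fun a => f a t) '' bestResp v t μ)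

/-- For some metric on `Δ(X^EXT(𝒯))`, the set `𝒫` is compact and the designer's objective is
a (well-defined) continuous function on it. -/
def CompactnessAssumption (v : A → Θ → ℕ → ℝ) (μ₀ : Belief Θ) (f : A → ℕ → ℝ) : Prop :=
  (∀ p ∈ feasibleDists v μ₀, Summable fun x => p.mass x * indirectPayoff v f x.1.1 x.1.2) ∧
  ∃ _ : MetricSpace (ExtDist v), IsCompact (feasibleDists v μ₀) ∧
    ContinuousOn (fun p : ExtDist v => ∑' x, p.mass x * indirectPayoff v f x.1.1 x.1.2)
      (feasibleDists v μ₀)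

end AttentionCapture

end

open MeasureTheory ProbabilityTheory Set
open scoped ENNReal

set_option linter.unusedSectionVars false

noncomputable section

namespace AttentionCapture

variable {Θ A : Type*} [Fintype Θ] [Fintype A] {μ₀ : Belief Θ}

section

/-! ### The static decision problem -/

/-! What a structure does for either party depends only on the law of the stopping belief and the
stopping time. On the event that the decision maker stops at `s` with best responses exactly `S`,
the average belief still makes every action in `S` optimal, so it can be spread over the extreme
points of that region. Along the way `v*` is linear, so the decision maker loses nothing, and the
designer's favourite action in `S` remains available, so the designer loses nothing either. The
resulting law on extremal points satisfies one linear inequality for each time and action: averaged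
over all later stopping points, the stopping payoff is at least that of taking the action now
(`Obedient`; see `exists_law_of_structure`). Conversely, a law that satisfies these inequalities,
has barycenter `μ₀` and puts no mass on time `0` is implemented by a structure that says only
"continue" or "stop". The commitment problem therefore compares stopping at once with a linear
problem over feasible laws, which has a solution by compactness (`exists_optimal_law`).

An optimal law may be implemented in many ways, since information can be released early among those
who are still waiting. The implementation chosen here releases so much that at every history from
time `1` on the decision maker is exactly indifferent between stopping and waiting. This is possible
because every obedient law is a countable sum of obedient laws that are tight at the given time
(`exists_tight_splits`): the parts that are not worth waiting for are each mixed with just enough of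
the whole law. Iterating over time yields a tree of laws with the optimal law at its root, and a
structure that follows it (`Tree.info`).

Indifference makes this structure sequentially optimal. Suppose some alternative continuation is
used at a history at time `t ≥ 1`. It gives the decision maker at least the value of stopping, which
is all that the tree promised her there, so substituting its law for that of the history preserves
every constraint before `t`. The constraints from `t` on survive because the alternative is obedient
and so is the root law without the part removed. The new law is thus feasible
(`Tree.IsTight.isFeasible_replace`), and a gain for the designer would contradict the optimality of
the root. At time `0` sequential optimality is optimality under commitment. If no feasible law beats
stopping at once, giving no information is both optimal and sequentially optimal. -/

/-- A bound for the payoffs at time `t`. -/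
def payoffBound (v : A → Θ → ℕ → ℝ) (t : ℕ) : ℝ := ∑ a, ∑ θ, |v a θ t|

lemma payoffBound_nonneg (v : A → Θ → ℕ → ℝ) (t : ℕ) : 0 ≤ payoffBound v t :=
  Finset.sum_nonneg fun _ _ => Finset.sum_nonneg fun _ _ => abs_nonneg _

lemma abs_expUtil_le (v : A → Θ → ℕ → ℝ) (t : ℕ) (μ : Belief Θ) (a : A) :
    |expUtil v t μ a| ≤ payoffBound v t := by
  calc |expUtil v t μ a| ≤ ∑ θ, |μ θ * v a θ t| := Finset.abs_sum_le_sum_abs _ _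
    _ ≤ ∑ θ, |v a θ t| := by
        refine Finset.sum_le_sum fun θ _ => ?_
        rw [abs_mul, abs_of_nonneg (stdSimplex.zero_le μ θ)]
        exact mul_le_of_le_one_left (abs_nonneg _) (stdSimplex.le_one μ θ)
    _ ≤ payoffBound v t :=
        Finset.single_le_sum (f := fun a => ∑ θ, |v a θ t|)
          (fun _ _ => Finset.sum_nonneg fun _ _ => abs_nonneg _) (Finset.mem_univ a)

lemma expUtil_le_vStar (v : A → Θ → ℕ → ℝ) (t : ℕ) (μ : Belief Θ) (a : A) :
    expUtil v t μ a ≤ vStar v t μ :=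
  le_ciSup (f := expUtil v t μ) (Set.finite_range _).bddAbove a

lemma vStar_le [Nonempty A] {v : A → Θ → ℕ → ℝ} {t : ℕ} {μ : Belief Θ} {c : ℝ}
    (h : ∀ a, expUtil v t μ a ≤ c) : vStar v t μ ≤ c := ciSup_le h

lemma exists_expUtil_eq_vStar [Nonempty A] (v : A → Θ → ℕ → ℝ) (t : ℕ) (μ : Belief Θ) :
    ∃ a, expUtil v t μ a = vStar v t μ := exists_eq_ciSup_of_finite

lemma mem_bestResp_iff [Nonempty A] {v : A → Θ → ℕ → ℝ} {t : ℕ} {μ : Belief Θ} {a : A} :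
    a ∈ bestResp v t μ ↔ expUtil v t μ a = vStar v t μ :=
  ⟨fun h => le_antisymm (expUtil_le_vStar v t μ a) (vStar_le h),
    fun h b => h ▸ expUtil_le_vStar v t μ b⟩

lemma bestResp_nonempty [Nonempty A] (v : A → Θ → ℕ → ℝ) (t : ℕ) (μ : Belief Θ) :
    (bestResp v t μ).Nonempty :=
  let ⟨a, ha⟩ := exists_expUtil_eq_vStar v t μ
  ⟨a, mem_bestResp_iff.2 ha⟩

lemma abs_vStar_le [Nonempty A] (v : A → Θ → ℕ → ℝ) (t : ℕ) (μ : Belief Θ) :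
    |vStar v t μ| ≤ payoffBound v t := by
  obtain ⟨a, ha⟩ := exists_expUtil_eq_vStar v t μ
  exact ha ▸ abs_expUtil_le v t μ a

lemma expUtil_strictAnti {v : A → Θ → ℕ → ℝ}
    (impatience : ∀ a θ t t', t' < t → v a θ t < v a θ t') (μ : Belief Θ) (a : A) :
    StrictAnti fun t => expUtil v t μ a := by
  intro s t hst
  have hne : ∃ θ, 0 < μ θ := by
    by_contra! h
    have := stdSimplex.sum_eq_one μ
    rw [Finset.sum_eq_zero fun θ _ => le_antisymm (h θ) (stdSimplex.zero_le μ θ)] at this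
    exact zero_ne_one this
  obtain ⟨θ, hθ⟩ := hne
  exact Finset.sum_lt_sum
    (fun θ _ => mul_le_mul_of_nonneg_left (impatience a θ t s hst).le (stdSimplex.zero_le μ θ))
    ⟨θ, Finset.mem_univ θ, mul_lt_mul_of_pos_left (impatience a θ t s hst) hθ⟩

lemma vStar_strictAnti [Nonempty A] {v : A → Θ → ℕ → ℝ}
    (impatience : ∀ a θ t t', t' < t → v a θ t < v a θ t') (μ : Belief Θ) :
    StrictAnti fun t => vStar v t μ := by
  intro s t hst
  obtain ⟨a, ha⟩ := exists_expUtil_eq_vStar v t μ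
  calc vStar v t μ = expUtil v t μ a := ha.symm
    _ < expUtil v s μ a := expUtil_strictAnti impatience μ a hst
    _ ≤ vStar v s μ := expUtil_le_vStar v s μ a

lemma vStar_le_payoffBound_zero [Nonempty A] {v : A → Θ → ℕ → ℝ}
    (impatience : ∀ a θ t t', t' < t → v a θ t < v a θ t') (t : ℕ) (μ : Belief Θ) :
    vStar v t μ ≤ payoffBound v 0 :=
  ((vStar_strictAnti impatience μ).antitone (Nat.zero_le t)).trans
    ((le_abs_self _).trans (abs_vStar_le v 0 μ))

@[fun_prop]
lemma measurable_belief_apply (θ : Θ) : Measurable fun μ : Belief Θ => μ θ :=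
  (measurable_pi_apply θ).comp measurable_subtype_coe

@[fun_prop]
lemma measurable_expUtil (v : A → Θ → ℕ → ℝ) (t : ℕ) (a : A) :
    Measurable fun μ : Belief Θ => expUtil v t μ a := by
  unfold expUtil; fun_prop

@[fun_prop]
lemma measurable_vStar (v : A → Θ → ℕ → ℝ) (t : ℕ) :
    Measurable fun μ : Belief Θ => vStar v t μ := by
  unfold vStar; exact Measurable.iSup fun a => measurable_expUtil v t a

lemma measurableSet_bestResp_eq (v : A → Θ → ℕ → ℝ) (t : ℕ) (S : Set A) :
    MeasurableSet {μ : Belief Θ | bestResp v t μ = S} := by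
  have : {μ : Belief Θ | bestResp v t μ = S} = ⋂ a, {μ | a ∈ bestResp v t μ ↔ a ∈ S} := by
    ext μ; simp [Set.ext_iff]
  rw [this]
  refine MeasurableSet.iInter fun a => ?_
  have h : MeasurableSet {μ : Belief Θ | a ∈ bestResp v t μ} := by
    have : {μ : Belief Θ | a ∈ bestResp v t μ} =
        ⋂ b, {μ | expUtil v t μ b ≤ expUtil v t μ a} := by ext μ; simp [bestResp]
    rw [this]
    exact MeasurableSet.iInter fun b => measurableSet_le (by fun_prop) (by fun_prop)
  by_cases ha : a ∈ S
  · simpa [ha] using h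
  · have := h.compl
    simp only [ha, iff_false]
    exact this

/-- There are finitely many sets of actions, so any rule that depends on the belief only through the
set of best responses is measurable. Favourable tie-breaking is such a rule. -/
lemma measurable_bestResp (v : A → Θ → ℕ → ℝ) (t : ℕ) :
    Measurable[_, ⊤] fun μ : Belief Θ => bestResp v t μ := by
  let : MeasurableSpace (Set A) := ⊤
  exact measurable_to_countable' fun S => measurableSet_bestResp_eq v t S

/-! ### Designer-optimal tie-breaking -/

lemma bddAbove_image_bestResp (v : A → Θ → ℕ → ℝ) (f : A → ℕ → ℝ) (μ : Belief Θ) (t : ℕ) :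
    BddAbove ((fun a => f a t) '' bestResp v t μ) := (Set.toFinite _).bddAbove

lemma le_indirectPayoff {v : A → Θ → ℕ → ℝ} (f : A → ℕ → ℝ) {μ : Belief Θ} {t : ℕ} {a : A}
    (ha : a ∈ bestResp v t μ) : f a t ≤ indirectPayoff v f μ t :=
  le_csSup (bddAbove_image_bestResp v f μ t) ⟨a, ha, rfl⟩

lemma exists_best_action [Nonempty A] (f : A → ℕ → ℝ) (t : ℕ) (S : Set A) :
    ∃ a, S.Nonempty → a ∈ S ∧ ∀ b ∈ S, f b t ≤ f a t := by
  by_cases hS : S.Nonempty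
  · obtain ⟨a, ha, h⟩ := S.toFinite.exists_maximalFor (fun a => f a t) S hS
    exact ⟨a, fun _ => ⟨ha, fun b hb => (le_total _ _).elim id (h hb)⟩⟩
  · exact ⟨Classical.arbitrary A, fun h => (hS h).elim⟩

/-- The designer's favourite action in `S`. -/
def bestAction [Nonempty A] (f : A → ℕ → ℝ) (t : ℕ) (S : Set A) : A :=
  (exists_best_action f t S).choose

lemma bestAction_mem [Nonempty A] (f : A → ℕ → ℝ) (t : ℕ) {S : Set A} (hS : S.Nonempty) :
    bestAction f t S ∈ S := ((exists_best_action f t S).choose_spec hS).1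

lemma le_bestAction [Nonempty A] (f : A → ℕ → ℝ) (t : ℕ) {S : Set A} {b : A} (hb : b ∈ S) :
    f b t ≤ f (bestAction f t S) t := ((exists_best_action f t S).choose_spec ⟨b, hb⟩).2 b hb

lemma apply_bestAction_eq [Nonempty A] (v : A → Θ → ℕ → ℝ) (f : A → ℕ → ℝ) (t : ℕ)
    (μ : Belief Θ) : f (bestAction f t (bestResp v t μ)) t = indirectPayoff v f μ t := by
  have hne := bestResp_nonempty v t μ
  refine le_antisymm (le_indirectPayoff f (bestAction_mem f t hne)) (csSup_le (hne.image _) ?_)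
  rintro _ ⟨b, hb, rfl⟩
  exact le_bestAction f t hb

open Classical in
/-- Ties broken in favour of a designer with preferences `f`. -/
def favourableTieBreak [Nonempty A] (v : A → Θ → ℕ → ℝ) (f : A → ℕ → ℝ) : TieBreak v where
  rule t μ := ⟨Pi.single (bestAction f t (bestResp v t μ)) 1, single_mem_stdSimplex ℝ _⟩
  measurable t := by
    let : MeasurableSpace (Set A) := ⊤
    exact (measurable_from_top (f := fun S : Set A =>
      (⟨Pi.single (bestAction f t S) 1, single_mem_stdSimplex ℝ _⟩ : stdSimplex ℝ A))).comp
      (measurable_bestResp v t)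
  proper t μ a h := by
    by_cases ha : a = bestAction f t (bestResp v t μ)
    · exact ha ▸ bestAction_mem f t (bestResp_nonempty v t μ)
    · change 0 < (Pi.single (bestAction f t (bestResp v t μ)) 1 : A → ℝ) a at h
      rw [Pi.single_eq_of_ne ha] at h
      exact (lt_irrefl _ h).elim

open Classical in
lemma favourableTieBreak_apply [Nonempty A] (v : A → Θ → ℕ → ℝ) (f : A → ℕ → ℝ) (t : ℕ)
    (μ : Belief Θ) (a : A) : (favourableTieBreak v f).rule t μ a =
      if a = bestAction f t (bestResp v t μ) then 1 else 0 := by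
  change (Pi.single (bestAction f t (bestResp v t μ)) 1 : A → ℝ) a = _
  rw [Pi.single_apply]

/-! ### Extremal beliefs -/

/-- The time-`t` payoff of `a`, as a linear functional. -/
def utilFunctional (v : A → Θ → ℕ → ℝ) (t : ℕ) (a : A) : (Θ → ℝ) →ₗ[ℝ] ℝ :=
  ∑ θ, (v a θ t) • LinearMap.proj θ

lemma utilFunctional_apply (v : A → Θ → ℕ → ℝ) (t : ℕ) (a : A) (x : Θ → ℝ) :
    utilFunctional v t a x = ∑ θ, x θ * v a θ t := by
  simp [utilFunctional, mul_comm]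

lemma utilFunctional_coe (v : A → Θ → ℕ → ℝ) (t : ℕ) (a : A) (μ : Belief Θ) :
    utilFunctional v t a (μ : Θ → ℝ) = expUtil v t μ a := utilFunctional_apply _ _ _ _

lemma optRegion_eq (v : A → Θ → ℕ → ℝ) (t : ℕ) (B : Set A) :
    optRegion v t B = stdSimplex ℝ Θ ∩
      ⋂ a ∈ B, ⋂ b, {x | utilFunctional v t b x ≤ utilFunctional v t a x} := by
  ext x
  simp only [optRegion, mem_ofPred_eq, mem_inter_iff, mem_iInter]
  constructor
  · rintro ⟨μ, rfl, h⟩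
    exact ⟨μ.2, fun a ha b => by simpa only [utilFunctional_coe] using h ha b⟩
  · rintro ⟨hx, h⟩
    refine ⟨⟨x, hx⟩, rfl, fun a ha b => ?_⟩
    have := h a ha b
    simp only [utilFunctional_apply] at this
    exact this

lemma convex_optRegion (v : A → Θ → ℕ → ℝ) (t : ℕ) (B : Set A) : Convex ℝ (optRegion v t B) := by
  rw [optRegion_eq]
  refine (convex_stdSimplex ℝ Θ).inter (convex_iInter₂ fun a _ => convex_iInter fun b => ?_)
  have : {x | utilFunctional v t b x ≤ utilFunctional v t a x} =
      {x | (utilFunctional v t b - utilFunctional v t a) x ≤ 0} := by ext; simp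
  rw [this]
  exact convex_halfSpace_le (LinearMap.isLinear _) 0

lemma isCompact_optRegion (v : A → Θ → ℕ → ℝ) (t : ℕ) (B : Set A) :
    IsCompact (optRegion v t B) := by
  rw [optRegion_eq]
  refine (isCompact_stdSimplex ℝ Θ).inter_right
    (isClosed_biInter fun a _ => isClosed_iInter fun b => ?_)
  exact isClosed_le (LinearMap.continuous_of_finiteDimensional _)
    (LinearMap.continuous_of_finiteDimensional _)

/-- The linear inequalities that cut out `optRegion v t B` from the beliefs. -/
def regionConstraint (v : A → Θ → ℕ → ℝ) (t : ℕ) : Θ ⊕ A × A → (Θ → ℝ) →ₗ[ℝ] ℝ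
  | .inl θ => LinearMap.proj θ
  | .inr p => utilFunctional v t p.1 - utilFunctional v t p.2

lemma mem_optRegion_iff {v : A → Θ → ℕ → ℝ} {t : ℕ} {B : Set A} {x : Θ → ℝ} :
    x ∈ optRegion v t B ↔ ∑ θ, x θ = 1 ∧
      ∀ c : Θ ⊕ A × A, (∀ p, c = .inr p → p.1 ∈ B) → 0 ≤ regionConstraint v t c x := by
  rw [optRegion_eq]
  simp only [mem_inter_iff, mem_iInter, mem_ofPred_eq, Sum.forall, regionConstraint]
  constructor
  · rintro ⟨⟨h0, h1⟩, h⟩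
    refine ⟨h1, fun θ _ => h0 θ, fun p hp => ?_⟩
    simpa using h p.1 (hp p rfl) p.2
  · rintro ⟨h1, h0, h⟩
    refine ⟨⟨fun θ => h0 θ (by simp), h1⟩, fun a ha b => ?_⟩
    simpa using h (a, b) (by rintro p ⟨⟩; exact ha)

/-- An extreme point of a polyhedron is determined by its active constraints, of which there are
finitely many sets. If `x` and `y` are extreme with the same active constraints, then a small step
from `x` away from `y` stays in the region: active constraints remain equalities, the others have
room. Hence `x` is interior to a segment in the region that ends at `y`, and `x = y`. -/
lemma finite_extremePoints_optRegion (v : A → Θ → ℕ → ℝ) (t : ℕ) (B : Set A) :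
    (extremePoints ℝ (optRegion v t B)).Finite := by
  let active : (Θ → ℝ) → Set (Θ ⊕ A × A) := fun x => {c | regionConstraint v t c x = 0}
  refine Set.Finite.of_finite_image (f := active) (Set.toFinite _) ?_
  intro x hx y hy hxy
  have hxr := mem_optRegion_iff.1 hx.1
  have hyr := mem_optRegion_iff.1 hy.1
  have hev : ∀ᶠ ε : ℝ in nhdsWithin 0 (Ioi 0), ∀ c : Θ ⊕ A × A, (∀ p, c = .inr p → p.1 ∈ B) →
      0 ≤ regionConstraint v t c (x - ε • (y - x)) := by
    refine Filter.eventually_all.2 fun c => ?_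
    by_cases hc : ∀ p, c = .inr p → p.1 ∈ B
    swap
    · exact Filter.Eventually.of_forall fun _ h => (hc h).elim
    rcases (hxr.2 c hc).eq_or_lt with h0 | hpos
    · have h1 : c ∈ active y := hxy ▸ (show c ∈ active x from h0.symm)
      have h1 : regionConstraint v t c y = 0 := h1
      refine Filter.Eventually.of_forall fun ε _ => ?_
      simp [map_sub, map_smul, h1, ← h0]
    · have hcont : Continuous fun ε : ℝ => regionConstraint v t c (x - ε • (y - x)) :=
        (LinearMap.continuous_of_finiteDimensional _).comp (by fun_prop)
      have := hcont.continuousAt (x := 0) |>.eventually (lt_mem_nhds (a := 0) (by simpa using hpos))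
      exact (this.filter_mono nhdsWithin_le_nhds).mono fun ε h _ => h.le
  obtain ⟨ε, hε, hpos⟩ := (hev.and self_mem_nhdsWithin).exists
  have hpos : 0 < ε := hpos
  have hmem : x - ε • (y - x) ∈ optRegion v t B := by
    refine mem_optRegion_iff.2 ⟨?_, hε⟩
    simp [Finset.sum_sub_distrib, ← Finset.mul_sum, hxr.1, hyr.1]
  have hseg : x ∈ openSegment ℝ y (x - ε • (y - x)) := by
    refine ⟨ε / (1 + ε), 1 / (1 + ε), by positivity, by positivity, by field_simp; ring, ?_⟩
    ext θ
    simp only [Pi.add_apply, Pi.smul_apply, Pi.sub_apply, smul_eq_mul]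
    field_simp
    ring
  exact (hx.2 hy.1 hmem hseg).symm

lemma finite_extBeliefs (v : A → Θ → ℕ → ℝ) (t : ℕ) :
    (extBeliefs v t : Set (Belief Θ)).Finite := by
  have : (extBeliefs v t : Set (Belief Θ)) =
      ⋃ B : Set A, (fun μ : Belief Θ => (μ : Θ → ℝ)) ⁻¹' extremePoints ℝ (optRegion v t B) := by
    ext μ
    simp only [extBeliefs, mem_ofPred_eq, mem_iUnion, mem_preimage]
  rw [this]
  exact Set.finite_iUnion fun B => (finite_extremePoints_optRegion v t B).preimage
    DFunLike.coe_injective.injOn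

/-- Extremal stopping beliefs, together with the time of stopping. -/
abbrev ExtPoint (v : A → Θ → ℕ → ℝ) : Type _ :=
  {x : Belief Θ × ℕ // x.1 ∈ extBeliefs v x.2}

/-- The stopping belief. -/
def ExtPoint.belief {v : A → Θ → ℕ → ℝ} (z : ExtPoint v) : Belief Θ := z.1.1

/-- The stopping time. -/
def ExtPoint.level {v : A → Θ → ℕ → ℝ} (z : ExtPoint v) : ℕ := z.1.2

lemma ExtPoint.ext' {v : A → Θ → ℕ → ℝ} {y z : ExtPoint v} (hb : y.belief = z.belief)
    (hl : y.level = z.level) : y = z := Subtype.ext (Prod.ext hb hl)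

lemma finite_level (v : A → Θ → ℕ → ℝ) (s : ℕ) : {z : ExtPoint v | z.level = s}.Finite := by
  refine Set.Finite.of_finite_image (f := fun z : ExtPoint v => z.belief) ?_ ?_
  · refine (finite_extBeliefs v s).subset ?_
    rintro _ ⟨z, hz, rfl⟩
    have hz : z.level = s := hz
    exact hz ▸ z.2
  · intro y hy z hz h
    exact ExtPoint.ext' h (Eq.trans hy (Eq.symm hz))

instance (v : A → Θ → ℕ → ℝ) : Countable (ExtPoint v) := by
  have : (univ : Set (ExtPoint v)) = ⋃ s, {z | z.level = s} := by ext; simp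
  rw [← Set.countable_univ_iff, this]
  exact Set.countable_iUnion fun s => (finite_level v s).countable

/-- A belief at which all actions in `B` are optimal is a mixture of extremal beliefs at which they
are optimal. -/
lemma exists_extremal_split (v : A → Θ → ℕ → ℝ) (t : ℕ) (B : Set A) {x : Θ → ℝ}
    (hx : x ∈ optRegion v t B) : ∃ w : ExtPoint v → ℝ, (∀ z, 0 ≤ w z) ∧
      (∀ z, w z ≠ 0 → z.level = t ∧ B ⊆ bestResp v t z.belief) ∧
      (∑ z ∈ (finite_level v t).toFinset, w z = 1) ∧
      ∀ θ, ∑ z ∈ (finite_level v t).toFinset, w z * z.belief θ = x θ := by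
  classical
  have hfin := finite_extremePoints_optRegion v t B
  -- Krein–Milman; no closure is needed because the hull of finitely many points is closed.
  have hx' : x ∈ convexHull ℝ (extremePoints ℝ (optRegion v t B)) := by
    have := closure_convexHull_extremePoints (isCompact_optRegion v t B) (convex_optRegion v t B)
    rw [(hfin.isClosed_convexHull ℝ).closure_eq] at this
    rwa [this]
  rw [hfin.convexHull_eq] at hx'
  obtain ⟨w, hw0, hw1, hwx⟩ := hx'
  let e : ExtPoint v → Prop := fun z =>
    z.level = t ∧ (z.belief : Θ → ℝ) ∈ extremePoints ℝ (optRegion v t B)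
  have key : ∀ g : (Θ → ℝ) → ℝ, ∑ z ∈ (finite_level v t).toFinset,
      (if e z then w z.belief else 0) * g z.belief = ∑ y ∈ hfin.toFinset, w y * g y := by
    intro g
    simp only [ite_mul, zero_mul]
    rw [← Finset.sum_filter]
    refine Finset.sum_bij (fun z _ => (z.belief : Θ → ℝ)) ?_ ?_ ?_ ?_
    · intro z hz
      simpa using (Finset.mem_filter.1 hz).2.2
    · intro y hy z hz h
      refine ExtPoint.ext' (DFunLike.coe_injective h) ?_
      rw [(Finset.mem_filter.1 hy).2.1, (Finset.mem_filter.1 hz).2.1]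
    · intro y hy
      have hy := hfin.mem_toFinset.1 hy
      obtain ⟨μ, rfl, -⟩ := hy.1
      refine ⟨⟨(μ, t), B, hy⟩, ?_, rfl⟩
      simp only [Finset.mem_filter, Set.Finite.mem_toFinset]
      exact ⟨rfl, rfl, hy⟩
    · intro z _
      rfl
  refine ⟨fun z => if e z then w z.belief else 0, ?_, ?_, ?_, ?_⟩
  · intro z
    by_cases h : e z
    · simpa [h] using hw0 _ h.2
    · simp [h]
  · intro z hz
    have h : e z := by
      by_contra h
      simp [h] at hz
    refine ⟨h.1, ?_⟩
    obtain ⟨μ, hμ, hB⟩ := h.2.1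
    rwa [← DFunLike.coe_injective hμ]
  · simpa [hw1] using key fun _ => 1
  · intro θ
    have := key fun y => y θ
    refine this.trans ?_
    rw [← hwx, Finset.centerMass_eq_of_sum_1 _ _ hw1]
    simp

end

/-! ### The decision maker's stopping problem under a given structure. -/

section

/-! ### Histories -/

lemma measurable_coord {s t : ℕ} (h : s ≤ t) :
    Measurable[hist Θ t] fun ω : Path Θ => ω s := by
  have : (fun ω : Path Θ => ω s) = (fun x : (i : Iic t) → Belief Θ × ℝ => x ⟨s, h⟩) ∘
      Preorder.restrictLe t := rfl
  rw [this]
  exact (measurable_pi_apply _).comp (comap_measurable _)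

lemma mem_iff_of_history {t : ℕ} {S : Set (Path Θ)} (hS : MeasurableSet[hist Θ t] S)
    {ω ω' : Path Θ} (h : ∀ s ≤ t, ω s = ω' s) : ω ∈ S ↔ ω' ∈ S := by
  obtain ⟨S', -, rfl⟩ := hS
  have : Preorder.restrictLe t ω = Preorder.restrictLe (π := fun _ => Belief Θ × ℝ) t ω' := by
    ext1 i
    exact h i.1 i.2
  simp only [mem_preimage, this]

lemma eq_of_history {t : ℕ} {g : Path Θ → ℝ} (hg : Measurable[hist Θ t] g)
    {ω ω' : Path Θ} (h : ∀ s ≤ t, ω s = ω' s) : g ω = g ω' :=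
  ((mem_iff_of_history (hg (measurableSet_singleton (g ω'))) h).2 rfl)

lemma measurableSet_historyEvent (t : ℕ) (ω : Path Θ) :
    MeasurableSet[hist Θ t] (historyEvent t ω) := by
  have : historyEvent t ω = ⋂ s, ⋂ (_ : s ≤ t), (fun ω' : Path Θ => ω' s) ⁻¹' {ω s} := by
    ext ω'
    simp [historyEvent]
  rw [this]
  exact MeasurableSet.iInter fun s => MeasurableSet.iInter fun h =>
    measurable_coord h (measurableSet_singleton _)

/-! ### Conditional expectations -/

/-- Multiplication by the indicator of an `m`-measurable event commutes with conditioning, so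
monotonicity localizes to such events. -/
lemma condExp_mono_on {Ω : Type*} {m m0 : MeasurableSpace Ω} {P : Measure Ω} [IsFiniteMeasure P]
    (hm : m ≤ m0) {E : Set Ω} (hE : MeasurableSet[m] E) {f g : Ω → ℝ} (hf : Integrable f P)
    (hg : Integrable g P) (h : ∀ᵐ ω ∂P, ω ∈ E → f ω ≤ g ω) :
    ∀ᵐ ω ∂P, ω ∈ E → P[f|m] ω ≤ P[g|m] ω := by
  have h1 : P[E.indicator f|m] ≤ᵐ[P] P[E.indicator g|m] := by
    refine condExp_mono (hf.indicator (hm _ hE)) (hg.indicator (hm _ hE)) ?_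
    filter_upwards [h] with ω hω
    by_cases hωE : ω ∈ E
    · simpa [hωE] using hω hωE
    · simp [hωE]
  filter_upwards [h1, condExp_indicator hf hE, condExp_indicator hg hE] with ω h1 h2 h3 hωE
  rw [h2, h3] at h1
  simpa [hωE] using h1

/-- A countable subfamily suffices. Among the pointwise suprema of countable subfamilies, one
maximizes the integral of its arctangent: a maximizing sequence of subfamilies is merged into a
single one. Adding a further member cannot raise this integral, and since the arctangent is strictly
increasing and bounded, it cannot raise the supremum on a set of positive measure. Truncation at `M`
makes the pointwise suprema exist everywhere. -/
lemma exists_ae_lub {Ω : Type*} {m m0 : MeasurableSpace Ω} {P : Measure Ω} [IsFiniteMeasure P]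
    (hm : m ≤ m0) {F : Set (Ω → ℝ)} (hF : ∀ f ∈ F, Measurable[m] f) (hne : F.Nonempty) {M : ℝ}
    (hM : ∀ f ∈ F, ∀ᵐ ω ∂P, f ω ≤ M) :
    ∃ U : Ω → ℝ, Measurable[m] U ∧ (∀ f ∈ F, f ≤ᵐ[P] U) ∧
      ∀ U' : Ω → ℝ, (∀ f ∈ F, f ≤ᵐ[P] U') → U ≤ᵐ[P] U' := by
  have : Nonempty F := hne.to_subtype
  let sup : (ℕ → F) → Ω → ℝ := fun g ω => ⨆ n, min ((g n : Ω → ℝ) ω) M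
  have hbdd : ∀ (g : ℕ → F) ω, BddAbove (range fun n => min ((g n : Ω → ℝ) ω) M) :=
    fun g ω => ⟨M, by rintro _ ⟨n, rfl⟩; exact min_le_right _ _⟩
  have hmeas : ∀ g, Measurable[m] (sup g) := fun g =>
    Measurable.iSup (mδ := m) fun n => (hF _ (g n).2).min measurable_const
  have hinteg : ∀ g, Integrable (fun ω => Real.arctan (sup g ω)) P := fun g =>
    Integrable.of_bound (C := Real.pi / 2)
      (Real.measurable_arctan.comp ((hmeas g).mono hm le_rfl)).aestronglyMeasurable
      (Filter.Eventually.of_forall fun ω => by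
        rw [Real.norm_eq_abs, abs_le]
        exact ⟨(Real.neg_pi_div_two_lt_arctan _).le, (Real.arctan_lt_pi_div_two _).le⟩)
  let J : (ℕ → F) → ℝ := fun g => ∫ ω, Real.arctan (sup g ω) ∂P
  have hJmono : ∀ g g' : ℕ → F, range g ⊆ range g' → ∀ ω, sup g ω ≤ sup g' ω := by
    intro g g' h ω
    refine ciSup_le fun n => ?_
    obtain ⟨k, hk⟩ := h ⟨n, rfl⟩
    rw [← hk]
    exact le_ciSup (hbdd g' ω) k
  have hJbdd : BddAbove (range J) := by
    refine ⟨∫ _, Real.pi / 2 ∂P, ?_⟩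
    rintro _ ⟨g, rfl⟩
    exact integral_mono (hinteg g) (integrable_const _) fun ω => (Real.arctan_lt_pi_div_two _).le
  obtain ⟨u, -, hu, hu'⟩ := exists_seq_tendsto_sSup (range_nonempty J) hJbdd
  choose g hg using hu'
  let G : ℕ → F := fun n => g n.unpair.1 n.unpair.2
  have hGsub : ∀ k, range (g k) ⊆ range G := by
    rintro k _ ⟨n, rfl⟩
    exact ⟨Nat.pair k n, by simp [G]⟩
  have hGmax : ∀ g', J g' ≤ J G := by
    intro g'
    refine (le_csSup hJbdd ⟨g', rfl⟩).trans (le_of_tendsto' hu fun k => ?_)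
    rw [← hg k]
    exact integral_mono (hinteg _) (hinteg _) fun ω =>
      Real.arctan_strictMono.monotone (hJmono _ _ (hGsub k) ω)
  refine ⟨sup G, hmeas G, fun f hf => ?_, fun U' hU' => ?_⟩
  · let G' : ℕ → F := fun n => n.casesOn ⟨f, hf⟩ G
    have hle : ∀ ω, sup G ω ≤ sup G' ω := hJmono _ _ (by
      rintro _ ⟨n, rfl⟩
      exact ⟨n + 1, rfl⟩)
    have heq : ∫ ω, (Real.arctan (sup G' ω) - Real.arctan (sup G ω)) ∂P = 0 := by
      rw [integral_sub (hinteg _) (hinteg _)]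
      refine le_antisymm (sub_nonpos.2 (hGmax G')) (sub_nonneg.2 ?_)
      exact integral_mono (hinteg _) (hinteg _) fun ω => Real.arctan_strictMono.monotone (hle ω)
    rw [integral_eq_zero_iff_of_nonneg
      (fun ω => sub_nonneg.2 (Real.arctan_strictMono.monotone (hle ω)))
      ((hinteg _).sub (hinteg _))] at heq
    filter_upwards [heq, hM f hf] with ω h1 h2
    have h3 : sup G' ω = sup G ω := Real.arctan_injective (sub_eq_zero.1 h1)
    rw [← h3]
    have := le_ciSup (hbdd G' ω) 0
    simpa [G', min_eq_left h2] using this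
  · have : ∀ᵐ ω ∂P, ∀ n, (G n : Ω → ℝ) ω ≤ U' ω := ae_all_iff.2 fun n => hU' _ (G n).2
    filter_upwards [this] with ω h
    exact ciSup_le fun n => (min_le_left _ _).trans (h n)

/-! ### The value of the stopping problem -/

lemma TieBreak.sum_mul_expUtil [Nonempty A] {v : A → Θ → ℕ → ℝ} (γ : TieBreak v) (t : ℕ)
    (μ : Belief Θ) : ∑ a, γ.rule t μ a * expUtil v t μ a = vStar v t μ := by
  have : ∀ a, γ.rule t μ a * expUtil v t μ a = γ.rule t μ a * vStar v t μ := by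
    intro a
    rcases (stdSimplex.zero_le (γ.rule t μ) a).eq_or_lt with h | h
    · rw [← h, zero_mul, zero_mul]
    · rw [mem_bestResp_iff.1 (γ.proper t μ a h)]
  rw [Finset.sum_congr rfl fun a _ => this a, ← Finset.sum_mul, stdSimplex.sum_eq_one, one_mul]

lemma Plan.payoff_le_vStar (v : A → Θ → ℕ → ℝ) (P : Plan Θ A) (ω : Path Θ) :
    P.payoff v ω ≤ vStar v ((P.time ω).untopD 0) (ω ((P.time ω).untopD 0)).1 := by
  unfold Plan.payoff
  set t := (P.time ω).untopD 0
  calc ∑ a, P.action t ω a * expUtil v t (ω t).1 a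
      ≤ ∑ a, P.action t ω a * vStar v t (ω t).1 := Finset.sum_le_sum fun a _ =>
        mul_le_mul_of_nonneg_left (expUtil_le_vStar _ _ _ _) (stdSimplex.zero_le _ a)
    _ = vStar v t (ω t).1 := by rw [← Finset.sum_mul, stdSimplex.sum_eq_one, one_mul]

variable [Nonempty A] {v : A → Θ → ℕ → ℝ}

/-- The plan that plays a best response at the stopping time `τ`. -/
def Plan.optimalAt (v : A → Θ → ℕ → ℝ) (τ : Path Θ → WithTop ℕ)
    (hτ : IsStoppingTime (hist Θ) τ) : Plan Θ A where
  time := τ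
  isStoppingTime := hτ
  action t ω := (favourableTieBreak v fun _ _ => 0).rule t (ω t).1
  adapted t := ((favourableTieBreak v fun _ _ => 0).measurable t).comp
    (measurable_fst.comp (measurable_coord le_rfl))

lemma Plan.payoff_optimalAt (τ : Path Θ → WithTop ℕ) (hτ : IsStoppingTime (hist Θ) τ)
    (ω : Path Θ) : (Plan.optimalAt v τ hτ).payoff v ω =
      vStar v ((τ ω).untopD 0) (ω ((τ ω).untopD 0)).1 :=
  TieBreak.sum_mul_expUtil (favourableTieBreak v fun _ _ => 0) _ _

lemma measurable_vStar_coord (v : A → Θ → ℕ → ℝ) (t : ℕ) {s u : ℕ} (h : s ≤ u) :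
    Measurable[hist Θ u] fun ω : Path Θ => vStar v t (ω s).1 :=
  (measurable_vStar v t).comp (measurable_fst.comp (measurable_coord h))

lemma integrable_vStar_coord (v : A → Θ → ℕ → ℝ) (I : InfoStructure μ₀) (t s : ℕ) :
    Integrable (fun ω => vStar v t (ω s).1) I.law :=
  Integrable.of_bound (C := payoffBound v t)
    ((measurable_vStar_coord v t le_rfl).mono ((hist Θ).le s) le_rfl).aestronglyMeasurable
    (Filter.Eventually.of_forall fun _ => abs_vStar_le v t _)

lemma stopNow_availableFrom (v : A → Θ → ℕ → ℝ) (I : InfoStructure μ₀) (t : ℕ) :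
    (Plan.optimalAt v (fun _ => (t : WithTop ℕ))
      (isStoppingTime_const (hist Θ) t)).AvailableFrom v I t := by
  refine ⟨Filter.Eventually.of_forall fun ω => ⟨le_rfl, WithTop.coe_lt_top t⟩, ?_⟩
  have : (Plan.optimalAt v (fun _ => (t : WithTop ℕ)) (isStoppingTime_const (hist Θ) t)).payoff v =
      fun ω => vStar v t (ω t).1 := by
    ext ω
    exact Plan.payoff_optimalAt _ _ ω
  rw [this]
  exact integrable_vStar_coord v I t t

section Value

variable (impatience : ∀ a θ t t', t' < t → v a θ t < v a θ t')
include impatience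

lemma Plan.payoff_le_bound (P : Plan Θ A) (ω : Path Θ) : P.payoff v ω ≤ payoffBound v 0 :=
  (P.payoff_le_vStar v ω).trans (vStar_le_payoffBound_zero impatience _ _)

/-- The value is a genuine essential supremum and not the default `0`: acting at once is an
available plan, and impatience bounds all payoffs by those possible at time `0`. -/
lemma isValue_value (I : InfoStructure μ₀) (t : ℕ) : IsValue v I t (value v I t) := by
  have : ∃ U, IsValue v I t U := by
    obtain ⟨U, h1, h2, h3⟩ := exists_ae_lub (P := I.law) ((hist Θ).le t)
      (F := {g | ∃ P : Plan Θ A, P.AvailableFrom v I t ∧ g = I.law[P.payoff v | hist Θ t]})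
      (by rintro _ ⟨P, -, rfl⟩; exact stronglyMeasurable_condExp.measurable)
      ⟨_, _, stopNow_availableFrom v I t, rfl⟩ (M := payoffBound v 0) (by
        rintro _ ⟨P, hP, rfl⟩
        have := condExp_mono (m := hist Θ t) hP.2 (integrable_const (μ := I.law) (payoffBound v 0))
          (Filter.Eventually.of_forall fun ω => P.payoff_le_bound impatience ω)
        rwa [condExp_const ((hist Θ).le t)] at this)
    exact ⟨U, h1, fun P hP => h2 _ ⟨P, hP, rfl⟩, fun U' _ hU' => h3 U' (by
      rintro _ ⟨P, hP, rfl⟩; exact hU' P hP)⟩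
  unfold value
  rw [dif_pos this]
  exact this.choose_spec

/-- Leastness of the essential supremum is applied to the function that equals `g` on `E` and the
value itself elsewhere. -/
lemma value_le_on (I : InfoStructure μ₀) {t : ℕ} {E : Set (Path Θ)}
    (hE : MeasurableSet[hist Θ t] E) {g : Path Θ → ℝ} (hg : Measurable[hist Θ t] g)
    (h : ∀ P : Plan Θ A, P.AvailableFrom v I t →
      ∀ᵐ ω ∂I.law, ω ∈ E → (I.law[P.payoff v | hist Θ t]) ω ≤ g ω) :
    ∀ᵐ ω ∂I.law, ω ∈ E → value v I t ω ≤ g ω := by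
  classical
  have hU := isValue_value impatience I t
  have := hU.least (E.piecewise g (value v I t)) (hg.piecewise hE hU.measurable) fun P hP => by
    filter_upwards [h P hP, hU.upper P hP] with ω h1 h2
    by_cases hω : ω ∈ E
    · simpa [hω] using h1 hω
    · simpa [hω] using h2
  filter_upwards [this] with ω h1 hω
  simpa [hω] using h1

lemma vStar_le_value (I : InfoStructure μ₀) (t : ℕ) :
    ∀ᵐ ω ∂I.law, vStar v t (ω t).1 ≤ value v I t ω := by
  have h := (isValue_value impatience I t).upper _ (stopNow_availableFrom v I t)
  have : (Plan.optimalAt v (fun _ => (t : WithTop ℕ)) (isStoppingTime_const (hist Θ) t)).payoff v =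
      fun ω => vStar v t (ω t).1 := by
    ext ω
    exact Plan.payoff_optimalAt _ _ ω
  rwa [this, condExp_of_stronglyMeasurable ((hist Θ).le t)
    (measurable_vStar_coord v t le_rfl).stronglyMeasurable (integrable_vStar_coord v I t t)] at h

lemma value_le_bound (I : InfoStructure μ₀) (t : ℕ) :
    ∀ᵐ ω ∂I.law, value v I t ω ≤ payoffBound v 0 := by
  have := value_le_on impatience I (t := t) (E := univ) MeasurableSet.univ
    (g := fun _ => payoffBound v 0) measurable_const fun P hP => by
      have := condExp_mono (m := hist Θ t) hP.2 (integrable_const (μ := I.law) (payoffBound v 0))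
        (Filter.Eventually.of_forall fun ω => P.payoff_le_bound impatience ω)
      rw [condExp_const ((hist Θ).le t)] at this
      filter_upwards [this] with ω h _ using h
  filter_upwards [this] with ω h using h trivial

lemma integrable_value (I : InfoStructure μ₀) (t : ℕ) : Integrable (value v I t) I.law := by
  refine Integrable.of_bound (C := payoffBound v 0 + payoffBound v t)
    ((isValue_value impatience I t).measurable.mono ((hist Θ).le t) le_rfl).aestronglyMeasurable ?_
  filter_upwards [value_le_bound impatience I t, vStar_le_value impatience I t] with ω h1 h2
  have := abs_le.1 (abs_vStar_le v t (ω t).1)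
  rw [Real.norm_eq_abs, abs_le]
  constructor <;> linarith [payoffBound_nonneg v t, payoffBound_nonneg v 0]

lemma measurable_contValue (I : InfoStructure μ₀) (t : ℕ) :
    Measurable[hist Θ t] (contValue v I t) := stronglyMeasurable_condExp.measurable

lemma measurableSet_stopsAt (I : InfoStructure μ₀) {t u : ℕ} (h : t ≤ u) :
    MeasurableSet[hist Θ u] {ω | StopsAt v I t ω} :=
  (hist Θ).mono h _ (measurableSet_lt (measurable_contValue impatience I t)
    (measurable_vStar_coord v t le_rfl))

/-- If there is no further information after time `s`, the decision maker stops. -/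
lemma stopsAt_of_constant (I : InfoStructure μ₀) {s : ℕ} {E : Set (Path Θ)}
    (hE : MeasurableSet[hist Θ s] E)
    (hconst : ∀ᵐ ω ∂I.law, ω ∈ E → ∀ u, s ≤ u → (ω u).1 = (ω s).1) :
    ∀ᵐ ω ∂I.law, ω ∈ E → StopsAt v I s ω := by
  let g : Path Θ → ℝ := fun ω => vStar v (s + 1) (ω s).1
  have hg : Measurable[hist Θ s] g := measurable_vStar_coord v (s + 1) le_rfl
  have hgi : Integrable g I.law := integrable_vStar_coord v I (s + 1) s
  have hg' : Measurable[hist Θ (s + 1)] g := measurable_vStar_coord v (s + 1) (Nat.le_succ s)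
  -- With the belief frozen on `E`, a plan that acts at `u ≥ s + 1` earns at most `v*` at time `u`,
  -- hence at most `v*` at time `s + 1`. Strict impatience then makes acting at `s` strictly better.
  have h1 : ∀ᵐ ω ∂I.law, ω ∈ E → value v I (s + 1) ω ≤ g ω := by
    refine value_le_on impatience I ((hist Θ).mono (Nat.le_succ s) _ hE) hg' fun P hP => ?_
    have := condExp_mono_on ((hist Θ).le (s + 1)) ((hist Θ).mono (Nat.le_succ s) _ hE) hP.2 hgi (by
      filter_upwards [hconst, hP.1] with ω h2 h3 hω
      refine (P.payoff_le_vStar v ω).trans ?_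
      obtain ⟨u, hu⟩ := WithTop.ne_top_iff_exists.1 h3.2.ne
      have hu' : s + 1 ≤ u := by
        have := h3.1
        rw [← hu] at this
        exact WithTop.coe_le_coe.1 this
      rw [← hu, WithTop.untopD_coe, h2 hω u (by omega)]
      exact (vStar_strictAnti impatience _).antitone hu')
    rwa [condExp_of_stronglyMeasurable ((hist Θ).le (s + 1)) hg'.stronglyMeasurable hgi] at this
  have h2 := condExp_mono_on ((hist Θ).le s) hE (integrable_value impatience I (s + 1)) hgi h1
  rw [condExp_of_stronglyMeasurable ((hist Θ).le s) hg.stronglyMeasurable hgi] at h2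
  filter_upwards [h2] with ω h3 hω
  exact (h3 hω).trans_lt (vStar_strictAnti impatience _ (Nat.lt_succ_self s))

/-- This links the plans available from `t` to the value at `t + 1`. Where `P` acts by time `t`, the
new plan plays a best response at `t + 1`; that part of the payoff is bounded, so integrability is
kept. -/
lemma Plan.exists_postponed (I : InfoStructure μ₀) {t : ℕ} (P : Plan Θ A)
    (hP : P.AvailableFrom v I t) : ∃ P' : Plan Θ A, P'.AvailableFrom v I (t + 1) ∧
      ∀ ω, ¬ P.time ω ≤ t → P'.payoff v ω = P.payoff v ω := by
  classical
  let γ := favourableTieBreak v fun _ _ => (0 : ℝ)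
  let P' : Plan Θ A :=
    { time := fun ω => max (P.time ω) ((t + 1 : ℕ) : WithTop ℕ)
      isStoppingTime := P.isStoppingTime.max (isStoppingTime_const _ _)
      -- At the time `s` at which the new plan acts, the test `P.time ω < s` holds exactly on the
      -- paths where acting was postponed, and it is decided by the time-`s` history.
      action := fun s ω => if P.time ω < s then γ.rule s (ω s).1 else P.action s ω
      adapted := fun s => Measurable.ite (P.isStoppingTime.measurableSet_lt s)
        ((γ.measurable s).comp (measurable_fst.comp (measurable_coord le_rfl))) (P.adapted s) }
  have hlate : ∀ ω, ¬ P.time ω ≤ t → P'.payoff v ω = P.payoff v ω := by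
    intro ω hω
    have hle : ((t + 1 : ℕ) : WithTop ℕ) ≤ P.time ω := by
      rcases h : P.time ω with _ | u
      · exact le_top
      · rw [h] at hω
        have : ¬ u ≤ t := fun h' => hω (WithTop.coe_le_coe.2 h')
        exact WithTop.coe_le_coe.2 (show t + 1 ≤ u by omega)
    have htime : P'.time ω = P.time ω := max_eq_left hle
    simp only [Plan.payoff, htime]
    refine Finset.sum_congr rfl fun a _ => ?_
    have : P'.action ((P.time ω).untopD 0) ω = P.action ((P.time ω).untopD 0) ω := by
      refine if_neg fun h => ?_
      rcases h' : P.time ω with _ | u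
      · rw [h'] at h
        exact not_top_lt h
      · rw [h'] at h
        exact lt_irrefl _ h
    rw [this]
  have hearly : ∀ ω, P.time ω ≤ t → P'.payoff v ω = vStar v (t + 1) (ω (t + 1)).1 := by
    intro ω hω
    have hlt : P.time ω < ((t + 1 : ℕ) : WithTop ℕ) :=
      hω.trans_lt (WithTop.coe_lt_coe.2 (Nat.lt_succ_self t))
    have htime : P'.time ω = ((t + 1 : ℕ) : WithTop ℕ) := max_eq_right hlt.le
    simp only [Plan.payoff, htime]
    change ∑ a, P'.action (t + 1) ω a * expUtil v (t + 1) (ω (t + 1)).1 a = _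
    have : P'.action (t + 1) ω = γ.rule (t + 1) (ω (t + 1)).1 := if_pos hlt
    rw [this]
    exact γ.sum_mul_expUtil _ _
  refine ⟨P', ⟨?_, ?_⟩, hlate⟩
  · filter_upwards [hP.1] with ω hω
    exact ⟨le_max_right _ _, max_lt hω.2 (WithTop.coe_lt_top _)⟩
  · have : P'.payoff v = {ω | P.time ω ≤ t}.piecewise
        (fun ω => vStar v (t + 1) (ω (t + 1)).1) (P.payoff v) := by
      ext ω
      by_cases h : P.time ω ≤ t
      · rw [hearly ω h, piecewise_eq_of_mem {ω | P.time ω ≤ t} _ _ h]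
      · rw [hlate ω h, piecewise_eq_of_notMem {ω | P.time ω ≤ t} _ _ h]
    rw [this]
    exact Integrable.piecewise ((hist Θ).le t _ (P.isStoppingTime t))
      (integrable_vStar_coord v I (t + 1) (t + 1)).integrableOn hP.2.integrableOn

/-- The value is at most the larger one of the payoff from stopping and the continuation value. -/
lemma value_le_max (I : InfoStructure μ₀) (t : ℕ) :
    ∀ᵐ ω ∂I.law, value v I t ω ≤ max (vStar v t (ω t).1) (contValue v I t ω) := by
  have hvm := measurable_vStar_coord (Θ := Θ) v t (le_refl t)
  have := value_le_on impatience I (t := t) (E := univ) MeasurableSet.univ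
    (g := fun ω => max (vStar v t (ω t).1) (contValue v I t ω))
    (hvm.max (measurable_contValue impatience I t)) fun P hP => by
      -- Split by whether `P` has acted by `t`. If so, it earns at most `v*` at `t`; if not, it
      -- coincides with its postponed version, whose conditional payoff is bounded by the
      -- continuation value through the tower property.
      have hD : MeasurableSet[hist Θ t] {ω | P.time ω ≤ t} := P.isStoppingTime t
      have h1 := condExp_mono_on ((hist Θ).le t) hD hP.2 (integrable_vStar_coord v I t t) (by
        filter_upwards [hP.1] with ω hω h
        have h' : P.time ω = t := le_antisymm h hω.1
        have := P.payoff_le_vStar v ω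
        rw [h'] at this
        exact this)
      rw [condExp_of_stronglyMeasurable ((hist Θ).le t) hvm.stronglyMeasurable
        (integrable_vStar_coord v I t t)] at h1
      obtain ⟨P', hP', heq⟩ := Plan.exists_postponed impatience I P hP
      have h2 := condExp_mono_on ((hist Θ).le t) hD.compl hP.2 hP'.2
        (Filter.Eventually.of_forall fun ω hω => (heq ω hω).ge)
      have h3 : I.law[P'.payoff v | hist Θ t] ≤ᵐ[I.law] contValue v I t :=
        (condExp_condExp_of_le ((hist Θ).mono (Nat.le_succ t)) ((hist Θ).le (t + 1))).symm.le.trans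
          (condExp_mono integrable_condExp (integrable_value impatience I (t + 1))
            ((isValue_value impatience I (t + 1)).upper P' hP'))
      filter_upwards [h1, h2, h3] with ω h1 h2 h3 _
      by_cases h : P.time ω ≤ t
      · exact (h1 h).trans (le_max_left _ _)
      · exact ((h2 h).trans h3).trans (le_max_right _ _)
  filter_upwards [this] with ω h using h trivial

end Value

end

section

variable {v : A → Θ → ℕ → ℝ}

/-! ### Laws of the stopping belief and the stopping time -/

/-- The weight against which laws are required to be summable. -/
def ExtPoint.weight (z : ExtPoint v) : ℝ := 1 + |vStar v z.level z.belief|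

lemma ExtPoint.one_le_weight (z : ExtPoint v) : 1 ≤ z.weight :=
  le_add_of_nonneg_right (abs_nonneg _)

lemma ExtPoint.weight_nonneg (z : ExtPoint v) : 0 ≤ z.weight := zero_le_one.trans z.one_le_weight

/-- A finite measure on stopping beliefs and stopping times under which the decision maker's payoff
is integrable. -/
structure IsLaw (Q : ExtPoint v → ℝ) : Prop where
  nonneg : ∀ z, 0 ≤ Q z
  summable : Summable fun z => Q z * z.weight

/-- What the decision maker gains at `z` by not having stopped with action `a` at time `t`. -/
def ExtPoint.gain (t : ℕ) (a : A) (z : ExtPoint v) : ℝ :=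
  vStar v z.level z.belief - expUtil v t z.belief a

/-- The part of the law after time `t`. -/
def tail (t : ℕ) (Q : ExtPoint v → ℝ) (z : ExtPoint v) : ℝ := if t < z.level then Q z else 0

/-- The expected gain from waiting at time `t` rather than stopping with action `a`. -/
def slack (t : ℕ) (a : A) (Q : ExtPoint v → ℝ) : ℝ := ∑' z, tail t Q z * z.gain t a

/-- A decision maker who knows only that she is to stop later is willing to wait at all times from
`t` on. -/
def Obedient (t : ℕ) (Q : ExtPoint v → ℝ) : Prop := ∀ s, t ≤ s → ∀ a, 0 ≤ slack s a Q

/-- Waiting at time `t` is not strictly better than stopping. -/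
def Tight (t : ℕ) (Q : ExtPoint v → ℝ) : Prop := ∃ a, slack t a Q ≤ 0

lemma ExtPoint.abs_gain_le [Nonempty A] (t : ℕ) (a : A) (z : ExtPoint v) :
    |z.gain t a| ≤ (1 + payoffBound v t) * z.weight := by
  have h1 := abs_expUtil_le v t z.belief a
  have h2 := payoffBound_nonneg v t
  have h3 := abs_nonneg (vStar v z.level z.belief)
  calc |z.gain t a| ≤ |vStar v z.level z.belief| + |expUtil v t z.belief a| := abs_sub _ _
    _ ≤ (1 + payoffBound v t) * z.weight := by
      unfold ExtPoint.weight
      nlinarith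

lemma summable_mul_of_le {Q φ : ExtPoint v → ℝ} (hQ : Summable fun z => Q z * z.weight) {C : ℝ}
    (hφ : ∀ z, |φ z| ≤ C * z.weight) : Summable fun z => Q z * φ z := by
  refine Summable.of_norm_bounded (g := fun z => C * |Q z * z.weight|) (hQ.abs.mul_left C) fun z => ?_
  rw [Real.norm_eq_abs, abs_mul, abs_mul, abs_of_nonneg z.weight_nonneg]
  calc |Q z| * |φ z| ≤ |Q z| * (C * z.weight) := mul_le_mul_of_nonneg_left (hφ z) (abs_nonneg _)
    _ = C * (|Q z| * z.weight) := by ring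

lemma summable_of_weight {Q : ExtPoint v → ℝ} (hQ : Summable fun z => Q z * z.weight) :
    Summable Q := by
  simpa using summable_mul_of_le hQ (φ := fun _ => 1) (C := 1) fun z => by
    simpa using z.one_le_weight

lemma summable_mul_belief {Q : ExtPoint v → ℝ} (hQ : Summable fun z => Q z * z.weight) (θ : Θ) :
    Summable fun z => Q z * z.belief θ :=
  summable_mul_of_le hQ (C := 1) fun z => by
    rw [abs_of_nonneg (stdSimplex.zero_le _ _), one_mul]
    exact (stdSimplex.le_one _ _).trans z.one_le_weight

lemma summable_mul_vStar {Q : ExtPoint v → ℝ} (hQ : Summable fun z => Q z * z.weight) :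
    Summable fun z => Q z * vStar v z.level z.belief :=
  summable_mul_of_le hQ (C := 1) fun z => by
    rw [one_mul]
    exact le_add_of_nonneg_left zero_le_one

lemma summable_mul_expUtil [Nonempty A] {Q : ExtPoint v → ℝ}
    (hQ : Summable fun z => Q z * z.weight) (t : ℕ) (a : A) :
    Summable fun z => Q z * expUtil v t z.belief a :=
  summable_mul_of_le hQ (C := payoffBound v t) fun z =>
    (abs_expUtil_le v t _ a).trans (le_mul_of_one_le_right (payoffBound_nonneg v t) z.one_le_weight)

lemma abs_tail_le (t : ℕ) (Q : ExtPoint v → ℝ) (z : ExtPoint v) : |tail t Q z| ≤ |Q z| := by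
  unfold tail
  split_ifs
  · exact le_rfl
  · simp

lemma summable_tail {Q : ExtPoint v → ℝ} (hQ : Summable fun z => Q z * z.weight) (t : ℕ) :
    Summable fun z => tail t Q z * z.weight := by
  refine Summable.of_norm_bounded hQ.abs fun z => ?_
  rw [Real.norm_eq_abs, abs_mul, abs_mul]
  exact mul_le_mul_of_nonneg_right (abs_tail_le t Q z) (abs_nonneg _)

lemma summable_slack [Nonempty A] {Q : ExtPoint v → ℝ} (hQ : Summable fun z => Q z * z.weight)
    (t : ℕ) (a : A) : Summable fun z => tail t Q z * z.gain t a :=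
  summable_mul_of_le (summable_tail hQ t) (ExtPoint.abs_gain_le t a)

lemma tail_add (t : ℕ) (P Q : ExtPoint v → ℝ) : tail t (P + Q) = tail t P + tail t Q := by
  ext z; simp only [tail, Pi.add_apply]; split_ifs <;> simp

lemma tail_sub (t : ℕ) (P Q : ExtPoint v → ℝ) : tail t (P - Q) = tail t P - tail t Q := by
  ext z; simp only [tail, Pi.sub_apply]; split_ifs <;> simp

lemma tail_smul (t : ℕ) (c : ℝ) (Q : ExtPoint v → ℝ) : tail t (c • Q) = c • tail t Q := by
  ext z; simp only [tail, Pi.smul_apply, smul_eq_mul]; split_ifs <;> simp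

lemma tail_tail {s t : ℕ} (h : s ≤ t) (Q : ExtPoint v → ℝ) : tail t (tail s Q) = tail t Q := by
  ext z; simp only [tail]; split_ifs <;> first | rfl | omega

lemma tail_eq_self {t : ℕ} {Q : ExtPoint v → ℝ} (h : ∀ z, Q z ≠ 0 → t < z.level) :
    tail t Q = Q := by
  ext z
  by_cases hz : Q z = 0
  · simp [tail, hz]
  · simp [tail, h z hz]

lemma tail_eq_zero {t : ℕ} {Q : ExtPoint v → ℝ} (h : ∀ z, Q z ≠ 0 → z.level ≤ t) :
    tail t Q = 0 := by
  ext z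
  by_cases hz : Q z = 0
  · simp [tail, hz]
  · simp [tail, (h z hz).not_gt]

lemma slack_add [Nonempty A] (t : ℕ) (a : A) {P Q : ExtPoint v → ℝ}
    (hP : Summable fun z => P z * z.weight) (hQ : Summable fun z => Q z * z.weight) :
    slack t a (P + Q) = slack t a P + slack t a Q := by
  simp only [slack, tail_add, Pi.add_apply, add_mul]
  exact (summable_slack hP t a).tsum_add (summable_slack hQ t a)

lemma slack_sub [Nonempty A] (t : ℕ) (a : A) {P Q : ExtPoint v → ℝ}
    (hP : Summable fun z => P z * z.weight) (hQ : Summable fun z => Q z * z.weight) :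
    slack t a (P - Q) = slack t a P - slack t a Q := by
  simp only [slack, tail_sub, Pi.sub_apply, sub_mul]
  exact (summable_slack hP t a).tsum_sub (summable_slack hQ t a)

lemma slack_smul (t : ℕ) (a : A) (c : ℝ) (Q : ExtPoint v → ℝ) :
    slack t a (c • Q) = c * slack t a Q := by
  simp only [slack, tail_smul, Pi.smul_apply, smul_eq_mul, mul_assoc]
  exact tsum_mul_left

lemma slack_zero (t : ℕ) (a : A) : slack t a (0 : ExtPoint v → ℝ) = 0 := by
  simp [slack, tail]

lemma slack_tail {s t : ℕ} (h : s ≤ t) (a : A) (Q : ExtPoint v → ℝ) :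
    slack t a (tail s Q) = slack t a Q := by
  simp only [slack, tail_tail h]

lemma slack_eq_zero {t : ℕ} (a : A) {Q : ExtPoint v → ℝ} (h : ∀ z, Q z ≠ 0 → z.level ≤ t) :
    slack t a Q = 0 := by
  simp [slack, tail_eq_zero h]

namespace IsLaw

lemma zero : IsLaw (0 : ExtPoint v → ℝ) := ⟨fun _ => le_rfl, by simp⟩

lemma add {P Q : ExtPoint v → ℝ} (hP : IsLaw P) (hQ : IsLaw Q) : IsLaw (P + Q) :=
  ⟨fun z => add_nonneg (hP.nonneg z) (hQ.nonneg z), by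
    simpa only [Pi.add_apply, add_mul] using hP.summable.add hQ.summable⟩

lemma smul {c : ℝ} (hc : 0 ≤ c) {Q : ExtPoint v → ℝ} (hQ : IsLaw Q) : IsLaw (c • Q) :=
  ⟨fun z => mul_nonneg hc (hQ.nonneg z), by
    simpa only [Pi.smul_apply, smul_eq_mul, mul_assoc] using hQ.summable.mul_left c⟩

lemma mono {P Q : ExtPoint v → ℝ} (hQ : IsLaw Q) (h0 : ∀ z, 0 ≤ P z) (h : ∀ z, P z ≤ Q z) :
    IsLaw P :=
  ⟨h0, Summable.of_nonneg_of_le (fun z => mul_nonneg (h0 z) z.weight_nonneg)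
    (fun z => mul_le_mul_of_nonneg_right (h z) z.weight_nonneg) hQ.summable⟩

lemma tail {Q : ExtPoint v → ℝ} (hQ : IsLaw Q) (t : ℕ) : IsLaw (tail t Q) :=
  ⟨fun z => by unfold AttentionCapture.tail; split_ifs; exacts [hQ.nonneg z, le_rfl],
    summable_tail hQ.summable t⟩

lemma finset_sum {ι : Type*} (s : Finset ι) {D : ι → ExtPoint v → ℝ} (h : ∀ i, IsLaw (D i)) :
    IsLaw (∑ i ∈ s, D i) := by
  classical
  induction s using Finset.induction_on with
  | empty => simpa using zero
  | insert i s hi ih => rw [Finset.sum_insert hi]; exact (h i).add ih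

end IsLaw

lemma Obedient.mono {s t : ℕ} (hst : s ≤ t) {Q : ExtPoint v → ℝ} (h : Obedient s Q) :
    Obedient t Q := fun t' ht' => h t' (hst.trans ht')

lemma Obedient.zero (t : ℕ) : Obedient t (0 : ExtPoint v → ℝ) :=
  fun t' _ a => (slack_zero t' a).ge

lemma Obedient.tail {s t : ℕ} (hst : s ≤ t) {Q : ExtPoint v → ℝ} (h : Obedient s Q) :
    Obedient t (tail t Q) := fun t' ht' a => by
  rw [slack_tail ht']
  exact h t' (hst.trans ht') a

section

variable [Nonempty A]

lemma Obedient.add {t : ℕ} {P Q : ExtPoint v → ℝ} (hP : IsLaw P) (hQ : IsLaw Q)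
    (h : Obedient t P) (h' : Obedient t Q) : Obedient t (P + Q) := fun t' ht' a => by
  rw [slack_add t' a hP.summable hQ.summable]
  exact add_nonneg (h t' ht' a) (h' t' ht' a)

lemma Obedient.smul {t : ℕ} {c : ℝ} (hc : 0 ≤ c) {Q : ExtPoint v → ℝ} (h : Obedient t Q) :
    Obedient t (c • Q) := fun t' ht' a => by
  rw [slack_smul]
  exact mul_nonneg hc (h t' ht' a)

lemma Obedient.finset_sum {ι : Type*} {t : ℕ} (s : Finset ι) {D : ι → ExtPoint v → ℝ}
    (hD : ∀ i, IsLaw (D i)) (h : ∀ i, Obedient t (D i)) : Obedient t (∑ i ∈ s, D i) := by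
  classical
  induction s using Finset.induction_on with
  | empty => simpa using Obedient.zero t
  | insert i s hi ih =>
    rw [Finset.sum_insert hi]
    exact (h i).add (hD i) (IsLaw.finset_sum s hD) ih

lemma Tight.smul {t : ℕ} {c : ℝ} (hc : 0 ≤ c) {Q : ExtPoint v → ℝ} (h : Tight t Q) :
    Tight t (c • Q) := by
  obtain ⟨a, ha⟩ := h
  exact ⟨a, by rw [slack_smul]; exact mul_nonpos_of_nonneg_of_nonpos hc ha⟩

lemma Tight.zero (t : ℕ) : Tight t (0 : ExtPoint v → ℝ) :=
  ⟨Classical.arbitrary A, (slack_zero t _).le⟩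

/-- The obedience constraints are closed under pointwise dominated limits. -/
lemma Obedient.of_tendsto {t : ℕ} {P : ℕ → ExtPoint v → ℝ} {Q R : ExtPoint v → ℝ} (hR : IsLaw R)
    (hP : ∀ n, IsLaw (P n)) (hob : ∀ n, Obedient t (P n)) (hle : ∀ n z, P n z ≤ R z)
    (hlim : ∀ z, Filter.Tendsto (fun n => P n z) Filter.atTop (nhds (Q z))) : Obedient t Q := by
  intro s hs a
  have : Filter.Tendsto (fun n => slack s a (P n)) Filter.atTop (nhds (slack s a Q)) := by
    refine tendsto_tsum_of_dominated_convergence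
      (bound := fun z => R z * ((1 + payoffBound v s) * z.weight)) ?_ ?_ ?_
    · simpa only [mul_left_comm] using hR.summable.mul_left (1 + payoffBound v s)
    · intro z
      refine Filter.Tendsto.mul_const _ ?_
      unfold AttentionCapture.tail
      split_ifs
      · exact hlim z
      · exact tendsto_const_nhds
    · refine Filter.Eventually.of_forall fun n z => ?_
      rw [Real.norm_eq_abs, abs_mul]
      refine mul_le_mul ?_ (z.abs_gain_le s a) (abs_nonneg _) (hR.nonneg z)
      exact (abs_tail_le s (P n) z).trans ((abs_of_nonneg ((hP n).nonneg z)).trans_le (hle n z))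
  exact ge_of_tendsto' this fun n => hob n s hs a

/-- A splitting of the law `Q` into countably many obedient laws. -/
structure Splits (t : ℕ) (Q : ExtPoint v → ℝ) (D : ℕ → ExtPoint v → ℝ) : Prop where
  isLaw : ∀ i, IsLaw (D i)
  obedient : ∀ i, Obedient t (D i)
  hasSum : ∀ z, HasSum (fun i => D i z) (Q z)

lemma Splits.le {t : ℕ} {Q : ExtPoint v → ℝ} {D : ℕ → ExtPoint v → ℝ} (h : Splits t Q D) (i : ℕ)
    (z : ExtPoint v) : D i z ≤ Q z :=
  le_hasSum (h.hasSum z) i fun j _ => (h.isLaw j).nonneg z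

/-- The difference is the sum of the other pieces. Their finite partial sums are obedient and
dominated by `Q`, so the limit is obedient. -/
lemma Splits.obedient_sub {t : ℕ} {Q : ExtPoint v → ℝ} {D : ℕ → ExtPoint v → ℝ}
    (h : Splits t Q D) (hQ : IsLaw Q) (i : ℕ) : Obedient t (Q - D i) := by
  classical
  have hlaw : ∀ j, IsLaw (if j = i then 0 else D j) := fun j => by
    split_ifs
    exacts [IsLaw.zero, h.isLaw j]
  have hsum : ∀ z, HasSum (fun j => (if j = i then 0 else D j) z) (Q z - D i z) := fun z => by
    have := (h.hasSum z).sub (hasSum_ite_eq i (D i z))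
    refine this.congr_fun fun j => ?_
    by_cases hj : j = i
    · simp [hj]
    · simp [hj]
  refine Obedient.of_tendsto (P := fun n => ∑ j ∈ Finset.range n, if j = i then 0 else D j) hQ
    (fun n => IsLaw.finset_sum _ hlaw) (fun n => Obedient.finset_sum _ hlaw fun j => ?_)
    (fun n z => ?_) fun z => ?_
  · split_ifs
    exacts [Obedient.zero t, h.obedient j]
  · rw [Finset.sum_apply]
    refine (sum_le_hasSum _ (fun j _ => (hlaw j).nonneg z) (hsum z)).trans ?_
    exact sub_le_self _ ((h.isLaw i).nonneg z)
  · simpa only [Finset.sum_apply, Pi.sub_apply] using (hsum z).tendsto_sum_nat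

/-! ### Splitting an obedient law into laws that leave the decision maker indifferent. -/

section Peel

variable (impatience : ∀ a θ t t', t' < t → v a θ t < v a θ t')
include impatience

/-- When nobody stops up to time `t`, both dates compare the same future with action `a`, and `a`
pays more at the earlier date. -/
lemma slack_mono {s t : ℕ} (hst : s ≤ t) (a : A) {Q : ExtPoint v → ℝ} (hQ : IsLaw Q)
    (h : ∀ z, Q z ≠ 0 → t < z.level) : slack s a Q ≤ slack t a Q := by
  refine Summable.tsum_le_tsum (fun z => ?_) (summable_slack hQ.summable s a)
    (summable_slack hQ.summable t a)
  rw [tail_eq_self h, tail_eq_self fun z hz => hst.trans_lt (h z hz)]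
  refine mul_le_mul_of_nonneg_left ?_ (hQ.nonneg z)
  exact sub_le_sub_left ((expUtil_strictAnti impatience _ a).antitone hst) _

/-- Before the first possible stopping time the earliest constraint is the hardest one by
`slack_mono`, so checking it covers all of them. -/
lemma obedient_of_support {s t : ℕ} {Q : ExtPoint v → ℝ} (hQ : IsLaw Q)
    (h : ∀ z, Q z ≠ 0 → s ≤ z.level) (ht : ∀ a, 0 ≤ slack t a Q) (hs : Obedient s Q) :
    Obedient t Q := by
  intro t' ht' a
  rcases le_or_gt s t' with hst | hst
  · exact hs t' hst a
  · exact (ht a).trans (slack_mono impatience ht' a hQ fun z hz => hst.trans_le (h z hz))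

omit impatience in
-- The multiple `κ` is the smallest that repairs every constraint of `Y` at time `t`, namely the
-- largest ratio `-slack Y / slack Q`. The constraint of the maximizing action then holds with
-- equality. Since some constraint of `Y` has nonpositive slack, `κ` is nonnegative.
lemma exists_tightening {t : ℕ} {Q Y : ExtPoint v → ℝ} (hQ : IsLaw Q) (hY : IsLaw Y)
    (hpos : ∀ a, 0 < slack t a Q) (hneg : Tight t Y) :
    ∃ κ : ℝ, 0 ≤ κ ∧ (∀ a, 0 ≤ slack t a (Y + κ • Q)) ∧ Tight t (Y + κ • Q) := by
  obtain ⟨a₀, ha₀⟩ := Finite.exists_max fun a => -slack t a Y / slack t a Q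
  obtain ⟨a₁, ha₁⟩ := hneg
  set κ := -slack t a₀ Y / slack t a₀ Q with hκ
  have hκ0 : 0 ≤ κ := (div_nonneg (neg_nonneg.2 ha₁) (hpos a₁).le).trans (ha₀ a₁)
  have hs : ∀ a, slack t a (Y + κ • Q) = slack t a Y + κ * slack t a Q := fun a => by
    rw [slack_add t a hY.summable (hQ.smul hκ0).summable, slack_smul]
  refine ⟨κ, hκ0, fun a => ?_, a₀, ?_⟩
  · rw [hs]
    have := (div_le_iff₀ (hpos a)).1 (ha₀ a)
    linarith
  · rw [hs, hκ, div_mul_cancel₀ _ (hpos a₀).ne']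
    linarith

/-- If it is already known that stopping will occur at one given later belief, then taking its best
action now is better than taking it at the later time. -/
lemma tight_of_support_level {s t : ℕ} (hts : t < s) {Q : ExtPoint v → ℝ} (z : ExtPoint v)
    (hz : z.level = s) (hQ : 0 ≤ Q z) (h : ∀ y, y ≠ z → Q y = 0) : Tight t Q := by
  obtain ⟨a, ha⟩ := exists_expUtil_eq_vStar v s z.belief
  refine ⟨a, ?_⟩
  rw [slack, tsum_eq_single z fun y hy => by simp [tail, h y hy]]
  rw [tail, if_pos (hz ▸ hts)]
  refine mul_nonpos_of_nonneg_of_nonpos hQ ?_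
  rw [ExtPoint.gain, hz, ← ha]
  exact sub_nonpos.2 (expUtil_strictAnti impatience _ a hts).le

/-- One step of the splitting of `Q` into tight laws: after it only a part of `Q` that stops after
time `s` remains. -/
lemma exists_peel {s t : ℕ} (hts : t < s) {Q : ExtPoint v → ℝ} (hQ : IsLaw Q)
    (hsupp : ∀ z, Q z ≠ 0 → s ≤ z.level) (hob : Obedient t Q) :
    ∃ (F : Finset (Option (ExtPoint v))) (D : Option (ExtPoint v) → ExtPoint v → ℝ)
      (R : ExtPoint v → ℝ), (∀ i, IsLaw (D i) ∧ Obedient t (D i) ∧ Tight t (D i)) ∧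
      (∀ i, i ∉ F → D i = 0) ∧ IsLaw R ∧ (∀ z, R z ≠ 0 → s < z.level) ∧ Obedient t R ∧
      Q = ∑ i ∈ F, D i + R := by
  classical
  by_cases htight : Tight t Q
  · refine ⟨{none}, fun i => if i = none then Q else 0, 0, fun i => ?_, fun i hi => ?_, IsLaw.zero,
      fun z hz => (hz rfl).elim, Obedient.zero t, by simp⟩
    · dsimp only
      split_ifs
      exacts [⟨hQ, hob, htight⟩, ⟨IsLaw.zero, Obedient.zero t, Tight.zero t⟩]
    · exact if_neg (by simpa using hi)
  have hpos : ∀ a, 0 < slack t a Q := fun a => by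
    by_contra h
    exact htight ⟨a, not_lt.1 h⟩
  let R₁ := tail s Q
  have hR₁ : IsLaw R₁ := hQ.tail s
  have hR₁s : ∀ z, R₁ z ≠ 0 → s < z.level := fun z hz => by
    by_contra h
    exact hz (if_neg h)
  let good : Prop := ∀ a, 0 ≤ slack t a R₁
  let F : Finset (Option (ExtPoint v)) := Finset.insertNone (finite_level v s).toFinset
  -- These pieces are not worth waiting for at time `t`: each single point of level `s`, and the
  -- later part `R₁` if it violates a constraint at `t`. If `R₁` violates none, it is carried over,
  -- rescaled, as the remainder. Each piece will be mixed with a multiple of `Q` that makes it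
  -- exactly tight.
  let Y : Option (ExtPoint v) → ExtPoint v → ℝ := fun i => match i with
    | none => if good then 0 else R₁
    | some z => if z.level = s then Pi.single z (Q z) else 0
  have hY0 : ∀ i z, 0 ≤ Y i z := by
    rintro (_ | y) z
    · simp only [Y]
      split_ifs
      exacts [le_rfl, hR₁.nonneg z]
    · simp only [Y]
      split_ifs
      · rw [Pi.single_apply]
        split_ifs
        exacts [hQ.nonneg y, le_rfl]
      · exact le_rfl
  have hYQ : ∀ i z, Y i z ≤ Q z := by
    rintro (_ | y) z
    · simp only [Y]
      split_ifs
      · exact hQ.nonneg z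
      · simp only [R₁, tail]
        split_ifs
        exacts [le_rfl, hQ.nonneg z]
    · simp only [Y]
      split_ifs
      · rw [Pi.single_apply]
        split_ifs with h
        exacts [h ▸ le_rfl, hQ.nonneg z]
      · exact hQ.nonneg z
  have hYlaw : ∀ i, IsLaw (Y i) := fun i => hQ.mono (hY0 i) (hYQ i)
  have hYs : ∀ i z, Y i z ≠ 0 → s ≤ z.level := fun i z hz =>
    hsupp z fun h => hz (le_antisymm ((hYQ i z).trans h.le) (hY0 i z))
  have hYtight : ∀ i, Tight t (Y i) := by
    rintro (_ | y)
    · simp only [Y]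
      split_ifs with h
      · exact Tight.zero t
      · simp only [good, not_forall, not_le] at h
        exact h.imp fun a ha => ha.le
    · simp only [Y]
      split_ifs with h
      · refine tight_of_support_level impatience hts y h ?_ fun z hz => Pi.single_eq_of_ne hz _
        rw [Pi.single_eq_same]
        exact hQ.nonneg y
      · exact Tight.zero t
  -- From time `s` on a point of level `s` has no later stopping to compare with, and `R₁` inherits
  -- the constraints of `Q`. The dates from `t` to `s` follow from the constraint at `t` alone.
  have hYob : ∀ i, Obedient s (Y i) := by
    rintro (_ | y) t' ht' a
    · simp only [Y]
      split_ifs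
      · exact (slack_zero t' a).ge
      · rw [slack_tail ht']
        exact hob t' (hts.le.trans ht') a
    · simp only [Y]
      split_ifs with h
      · refine (slack_eq_zero a fun z hz => ?_).ge
        have : z = y := by
          by_contra hne
          exact hz (Pi.single_eq_of_ne hne _)
        rw [this, h]
        exact ht'
      · exact (slack_zero t' a).ge
  choose κ hκ0 hκ hκt using fun i => exists_tightening hQ (hYlaw i) hpos (hYtight i)
  have hsumpos : 0 < 1 + ∑ i ∈ F, κ i :=
    add_pos_of_pos_of_nonneg one_pos (Finset.sum_nonneg fun i _ => hκ0 i)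
  -- The pieces, together with `R₁` if it is carried over, add up to `Q`, and the mixed-in multiples
  -- add up to `(∑ i ∈ F, κ i) • Q`. Rescaling by `w` brings the total back to `Q`.
  set w := (1 + ∑ i ∈ F, κ i)⁻¹ with hw
  have hw0 : 0 ≤ w := inv_nonneg.2 hsumpos.le
  let D : Option (ExtPoint v) → ExtPoint v → ℝ := fun i =>
    if i ∈ F then w • (Y i + κ i • Q) else 0
  let R : ExtPoint v → ℝ := if good then w • R₁ else 0
  have hlaw : ∀ i, IsLaw (Y i + κ i • Q) := fun i => (hYlaw i).add (hQ.smul (hκ0 i))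
  refine ⟨F, D, R, fun i => ?_, fun i hi => if_neg hi, ?_, ?_, ?_, ?_⟩
  · simp only [D]
    split_ifs
    · refine ⟨(hlaw i).smul hw0, Obedient.smul hw0 ?_, (hκt i).smul hw0⟩
      refine obedient_of_support impatience (s := s) (hlaw i) (fun z hz => ?_) (hκ i) ?_
      · by_cases hz' : Y i z = 0
        · refine hsupp z fun h => hz ?_
          simp [hz', h]
        · exact hYs i z hz'
      · exact (hYob i).add (hYlaw i) (hQ.smul (hκ0 i)) ((hob.mono hts.le).smul (hκ0 i))
    · exact ⟨IsLaw.zero, Obedient.zero t, Tight.zero t⟩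
  · simp only [R]
    split_ifs
    exacts [hR₁.smul hw0, IsLaw.zero]
  · intro z hz
    refine hR₁s z fun h => hz ?_
    simp only [R]
    split_ifs <;> simp [h]
  · simp only [R]
    split_ifs with h
    · refine Obedient.smul hw0 (obedient_of_support impatience hR₁ (fun z hz => (hR₁s z hz).le) h ?_)
      exact hob.tail hts.le
    · exact Obedient.zero t
  · have h1 : ∑ i ∈ F, D i = w • (∑ i ∈ F, Y i + (∑ i ∈ F, κ i) • Q) := by
      rw [Finset.sum_smul, ← Finset.sum_add_distrib, Finset.smul_sum]
      exact Finset.sum_congr rfl fun i hi => if_pos hi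
    have h2 : ∑ i ∈ F, Y i + (if good then R₁ else 0) = Q := by
      ext z
      simp only [F, Finset.sum_insertNone, Pi.add_apply, Finset.sum_apply]
      have h3 : ∑ y ∈ (finite_level v s).toFinset, Y (some y) z = if z.level = s then Q z else 0 := by
        have : ∀ y, Y (some y) z = if y = z then (if z.level = s then Q z else 0) else 0 := by
          intro y
          simp only [Y]
          by_cases hyz : y = z
          · subst hyz
            by_cases hy : y.level = s <;> simp [hy]
          · rw [if_neg hyz]
            split_ifs
            · exact Pi.single_eq_of_ne (Ne.symm hyz) _
            · rfl
        rw [Finset.sum_congr rfl fun y _ => this y, Finset.sum_ite_eq']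
        by_cases hz : z.level = s <;> simp [hz]
      rw [h3]
      have h4 : Y none z + (if good then R₁ else 0) z = R₁ z := by
        simp only [Y]
        split_ifs <;> simp
      rw [add_right_comm, h4]
      simp only [R₁, tail]
      by_cases hz : Q z = 0
      · simp [hz]
      · rcases (hsupp z hz).eq_or_lt with h | h
        · simp [h]
        · simp [h, h.ne']
    have h5 : R = w • (if good then R₁ else 0) := by
      simp only [R]
      split_ifs <;> simp
    rw [h1, h5, ← smul_add, add_right_comm, h2]
    have h6 : Q + (∑ i ∈ F, κ i) • Q = (1 + ∑ i ∈ F, κ i) • Q := by rw [add_smul, one_smul]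
    rw [h6, smul_smul, hw, inv_mul_cancel₀ hsumpos.ne', one_smul]

/-- Every obedient law can be split into obedient laws under which the decision maker is indifferent
at time `t`. -/
lemma exists_tight_splits {t : ℕ} {Q : ExtPoint v → ℝ} (hQ : IsLaw Q)
    (hsupp : ∀ z, Q z ≠ 0 → t < z.level) (hob : Obedient t Q) :
    ∃ D : ℕ → ExtPoint v → ℝ, Splits t Q D ∧ ∀ i, Tight t (D i) := by
  classical
  -- After `n` peelings the remainder stops no earlier than `t + 1 + n`. Hence it vanishes at each
  -- given point after finitely many steps, and the pieces sum to `Q` pointwise without any estimate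
  -- on the remainder.
  let Rem : ℕ → Type _ := fun n => {R : ExtPoint v → ℝ //
    IsLaw R ∧ (∀ z, R z ≠ 0 → t + 1 + n ≤ z.level) ∧ Obedient t R}
  have hpeel : ∀ (n : ℕ) (R : Rem n), ∃ (F : Finset (Option (ExtPoint v)))
      (D : Option (ExtPoint v) → ExtPoint v → ℝ) (R' : Rem (n + 1)),
      (∀ i, IsLaw (D i) ∧ Obedient t (D i) ∧ Tight t (D i)) ∧ (∀ i, i ∉ F → D i = 0) ∧
      R.1 = ∑ i ∈ F, D i + R'.1 := by
    intro n R
    obtain ⟨F, D, R', h1, h2, h3, h4, h5, h6⟩ :=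
      exists_peel impatience (s := t + 1 + n) (by omega) R.2.1 R.2.2.1 R.2.2.2
    exact ⟨F, D, ⟨R', h3, fun z hz => h4 z hz, h5⟩, h1, h2, h6⟩
  choose F D R' hD hF hR' using hpeel
  let R : (n : ℕ) → Rem n := fun n =>
    Nat.rec (motive := Rem) ⟨Q, hQ, fun z hz => hsupp z hz, hob⟩ (fun n R => R' n R) n
  have hRzero : R 0 = ⟨Q, hQ, fun z hz => hsupp z hz, hob⟩ := rfl
  have hRsucc : ∀ n, R (n + 1) = R' n (R n) := fun n => rfl
  let D₁ : ℕ × Option (ExtPoint v) → ExtPoint v → ℝ := fun p => D p.1 (R p.1) p.2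
  have hD₁ : ∀ p, IsLaw (D₁ p) ∧ Obedient t (D₁ p) ∧ Tight t (D₁ p) := fun p => hD _ _ _
  have hpart : ∀ N z, ∑ n ∈ Finset.range N, ∑ i ∈ F n (R n), D₁ (n, i) z + (R N).1 z = Q z := by
    intro N z
    induction N with
    | zero => simp [hRzero]
    | succ N ih =>
      have := congrFun (hR' N (R N)) z
      rw [Pi.add_apply, Finset.sum_apply] at this
      rw [Finset.sum_range_succ, hRsucc, add_assoc, ← this, ih]
  have hRvanish : ∀ N z, z.level ≤ N → (R N).1 z = 0 := by
    intro N z hz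
    by_contra h
    have := (R N).2.2.1 z h
    omega
  have hsum : ∀ z, HasSum (fun p => D₁ p z) (Q z) := by
    intro z
    have hfin : ∑ p ∈ (Finset.range z.level).sigma fun n => F n (R n), D₁ (p.1, p.2) z = Q z := by
      rw [Finset.sum_sigma, ← hpart z.level z, hRvanish z.level z le_rfl, add_zero]
    have hz : ∀ p : Σ _ : ℕ, Option (ExtPoint v),
        p ∉ (Finset.range z.level).sigma (fun n => F n (R n)) → D₁ (p.1, p.2) z = 0 := by
      rintro ⟨n, i⟩ hp
      simp only [Finset.mem_sigma, Finset.mem_range, not_and] at hp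
      by_cases hi : i ∈ F n (R n)
      · have hn : z.level ≤ n := by
          by_contra h
          exact hp (not_le.1 h) hi
        have h1 := congrFun (hR' n (R n)) z
        rw [hRvanish n z hn, Pi.add_apply, Finset.sum_apply] at h1
        have h2 := (R' n (R n)).2.1.nonneg z
        have h3 := Finset.single_le_sum (f := fun i => D n (R n) i z)
          (fun i _ => (hD n (R n) i).1.nonneg z) hi
        exact le_antisymm (by simp only [D₁]; linarith) ((hD₁ (n, i)).1.nonneg z)
      · simp [D₁, hF n (R n) i hi]
    have := hasSum_sum_of_ne_finset_zero (L := SummationFilter.unconditional _) hz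
    rw [hfin] at this
    exact (Equiv.sigmaEquivProd ℕ (Option (ExtPoint v))).hasSum_iff.1 this
  -- The countable index set is embedded into `ℕ`; the unused indices receive the zero law, which is
  -- obedient and tight.
  obtain ⟨e, he⟩ := exists_injective_nat (ℕ × Option (ExtPoint v))
  have hcases : ∀ n, (∃ p, Function.extend e D₁ 0 n = D₁ p) ∨ Function.extend e D₁ 0 n = 0 := by
    intro n
    by_cases hn : ∃ p, e p = n
    · obtain ⟨p, rfl⟩ := hn
      exact Or.inl ⟨p, he.extend_apply _ _ _⟩
    · exact Or.inr (Function.extend_apply' _ _ _ hn)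
  have hall : ∀ n, IsLaw (Function.extend e D₁ 0 n) ∧ Obedient t (Function.extend e D₁ 0 n) ∧
      Tight t (Function.extend e D₁ 0 n) := by
    intro n
    rcases hcases n with ⟨p, hp⟩ | h0
    · rw [hp]
      exact hD₁ p
    · rw [h0]
      exact ⟨IsLaw.zero, Obedient.zero t, Tight.zero t⟩
  refine ⟨Function.extend e D₁ 0, ⟨fun n => (hall n).1, fun n => (hall n).2.1, fun z => ?_⟩,
    fun n => (hall n).2.2⟩
  refine ((hasSum_extend_zero he).2 (hsum z)).congr_fun fun n => ?_
  by_cases hn : ∃ p, e p = n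
  · obtain ⟨p, rfl⟩ := hn
    rw [he.extend_apply, he.extend_apply]
  · rw [Function.extend_apply' _ _ _ hn, Function.extend_apply' _ _ _ hn]
    rfl

end Peel

end

end

section

variable {v : A → Θ → ℕ → ℝ}

/-! ### Summation by levels -/

/-- The extremal points of level `s`. -/
def levelSet (v : A → Θ → ℕ → ℝ) (s : ℕ) : Finset (ExtPoint v) := (finite_level v s).toFinset

@[simp]
lemma mem_levelSet {s : ℕ} {z : ExtPoint v} : z ∈ levelSet v s ↔ z.level = s := by
  simp [levelSet]

lemma summable_of_levels {g : ExtPoint v → ℝ} (hg : ∀ z, 0 ≤ g z)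
    (h : Summable fun s => ∑ z ∈ levelSet v s, g z) : Summable g := by
  classical
  refine summable_of_sum_le (c := ∑' s, ∑ z ∈ levelSet v s, g z) hg fun u => ?_
  calc ∑ z ∈ u, g z ≤ ∑ z ∈ (u.image ExtPoint.level).biUnion (levelSet v), g z := by
        refine Finset.sum_le_sum_of_subset_of_nonneg (fun z hz => ?_) fun z _ _ => hg z
        simp only [Finset.mem_biUnion, Finset.mem_image]
        exact ⟨z.level, ⟨z, hz, rfl⟩, mem_levelSet.2 rfl⟩
    _ = ∑ s ∈ u.image ExtPoint.level, ∑ z ∈ levelSet v s, g z := by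
        refine Finset.sum_biUnion fun s _ s' _ hss' => Finset.disjoint_left.2 fun z hz hz' => hss' ?_
        rw [← mem_levelSet.1 hz, ← mem_levelSet.1 hz']
    _ ≤ _ := h.sum_le_tsum _ fun s _ => Finset.sum_nonneg fun z _ => hg z

lemma hasSum_levels {g : ExtPoint v → ℝ} (hg : Summable g) :
    HasSum (fun s => ∑ z ∈ levelSet v s, g z) (∑' z, g z) := by
  have := hg.hasSum.tsum_fiberwise (fun z : ExtPoint v => z.level)
  refine this.congr_fun fun s => ?_
  have h : (levelSet v s : Set (ExtPoint v)) = ExtPoint.level ⁻¹' {s} := by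
    ext z
    simp
  rw [← Finset.tsum_subtype' (levelSet v s) g, h]

/-! ### Sums along a stopping time -/

lemma hasSum_of_telescope {c e : ℕ → ℝ} {t : ℕ} (he : ∀ s, 0 ≤ e s)
    (h : ∀ n, t ≤ n → c n = e (n + 1) + c (n + 1))
    (hc : Filter.Tendsto c Filter.atTop (nhds 0)) :
    HasSum (fun s => if t < s then e s else 0) (c t) := by
  rw [hasSum_iff_tendsto_nat_of_nonneg fun s => by split_ifs; exacts [he s, le_rfl]]
  have hpart : ∀ k, ∑ s ∈ Finset.range (t + 1 + k), (if t < s then e s else 0) =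
      c t - c (t + k) := by
    intro k
    induction k with
    | zero =>
      rw [add_zero, add_zero, sub_self]
      exact Finset.sum_eq_zero fun s hs => if_neg (by have := Finset.mem_range.1 hs; omega)
    | succ k ih =>
      rw [← add_assoc, Finset.sum_range_succ, ih, if_pos (by omega), h (t + k) (by omega),
        show t + 1 + k = t + k + 1 by ring, show t + (k + 1) = t + k + 1 by ring]
      ring
  have h2 : Filter.Tendsto (fun k => c t - c (t + k)) Filter.atTop (nhds (c t)) := by
    have := (hc.comp (Filter.tendsto_add_atTop_nat t)).const_sub (c t)
    simpa [Function.comp_def, add_comm] using this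
  refine (Filter.tendsto_add_atTop_iff_nat (t + 1)).1 ?_
  refine h2.congr fun k => ?_
  rw [← hpart k, add_comm k]

/-- The terms `e` are bounded above in terms of `p` but may be very negative, so summability has to
be proved. The differences from `M * p` are nonnegative, and their partial sums are bounded because
the telescoped inequality bounds those of `e` from below by `u t - M`. For the limit only an upper
bound on the remainder `u n` is needed. -/
lemma summable_and_le_of_telescope {u e p q : ℕ → ℝ} {t : ℕ} {M : ℝ} (hp : ∀ s, 0 ≤ p s)
    (hM : 0 ≤ M) (hps : Summable p) (hep : ∀ s, e s ≤ M * p s)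
    (h : ∀ n, t ≤ n → u n ≤ e (n + 1) + u (n + 1)) (hu : ∀ n, u n ≤ M * q n)
    (hq : Filter.Tendsto q Filter.atTop (nhds 0)) (hq1 : ∀ n, q n ≤ 1) :
    Summable (fun s => if t < s then e s else 0) ∧
      u t ≤ ∑' s, if t < s then e s else 0 := by
  have hpart : ∀ k, u t ≤ ∑ s ∈ Finset.range (t + 1 + k), (if t < s then e s else 0) +
      u (t + k) := by
    intro k
    induction k with
    | zero =>
      rw [add_zero, add_zero, Finset.sum_eq_zero fun s hs =>
        if_neg (by have := Finset.mem_range.1 hs; omega)]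
      simp
    | succ k ih =>
      rw [← add_assoc, Finset.sum_range_succ, if_pos (by omega)]
      have := h (t + k) (by omega)
      rw [show t + 1 + k = t + k + 1 by ring, show t + (k + 1) = t + k + 1 by ring]
      rw [show t + 1 + k = t + k + 1 by ring] at ih
      linarith
  have hd : Summable fun s => M * p s - if t < s then e s else 0 := by
    refine summable_of_sum_range_le (c := M * ∑' s, p s - u t + M) (fun s => ?_) fun n => ?_
    · split_ifs
      · exact sub_nonneg.2 (hep s)
      · simpa using mul_nonneg hM (hp s)
    · have h1 : ∑ s ∈ Finset.range n, (M * p s - if t < s then e s else 0) ≤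
          ∑ s ∈ Finset.range (t + 1 + n), (M * p s - if t < s then e s else 0) := by
        refine Finset.sum_le_sum_of_subset_of_nonneg
          (Finset.range_subset_range.2 (by omega)) fun s _ _ => ?_
        split_ifs
        · exact sub_nonneg.2 (hep s)
        · simpa using mul_nonneg hM (hp s)
      refine h1.trans ?_
      rw [Finset.sum_sub_distrib, ← Finset.mul_sum]
      have h2 : ∑ s ∈ Finset.range (t + 1 + n), p s ≤ ∑' s, p s :=
        hps.sum_le_tsum _ fun s _ => hp s
      have h3 := hpart n
      have h4 := (hu (t + n)).trans (mul_le_of_le_one_right hM (hq1 (t + n)))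
      have h5 := mul_le_mul_of_nonneg_left h2 hM
      linarith
  have hs : Summable (fun s => if t < s then e s else 0) := by
    simpa using (hps.mul_left M).sub hd
  refine ⟨hs, ?_⟩
  have h1 : Filter.Tendsto (fun k => ∑ s ∈ Finset.range (t + 1 + k),
      (if t < s then e s else 0) + M * q (t + k)) Filter.atTop
      (nhds ((∑' s, if t < s then e s else 0) + M * 0)) := by
    refine Filter.Tendsto.add ?_ (Filter.Tendsto.const_mul M ?_)
    · have := hs.hasSum.tendsto_sum_nat.comp (Filter.tendsto_add_atTop_nat (t + 1))
      simpa [Function.comp_def, add_comm, add_left_comm] using this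
    · simpa [Function.comp_def, add_comm] using hq.comp (Filter.tendsto_add_atTop_nat t)
  rw [mul_zero, add_zero] at h1
  exact ge_of_tendsto' h1 fun k => (hpart k).trans (add_le_add_right (hu _) _)

/-! ### The designer's payoff -/

lemma expPayoff_eq (f : A → ℕ → ℝ) {d : A × ℕ → ℝ} (hd : ∀ x, 0 ≤ d x)
    (h : Summable fun x => d x * f x.1 x.2) :
    expPayoff f (fun x => ENNReal.ofReal (d x)) = ((∑' x, d x * f x.1 x.2 : ℝ) : EReal) := by
  have hp : Summable fun x => d x * max (f x.1 x.2) 0 :=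
    Summable.of_norm_bounded h.abs fun x => by
      rw [Real.norm_eq_abs, abs_mul, abs_mul]
      refine mul_le_mul_of_nonneg_left ?_ (abs_nonneg _)
      rw [abs_of_nonneg (le_max_right _ _)]
      exact max_le (le_abs_self _) (abs_nonneg _)
  have hn : Summable fun x => d x * max (-f x.1 x.2) 0 :=
    Summable.of_norm_bounded h.abs fun x => by
      rw [Real.norm_eq_abs, abs_mul, abs_mul]
      refine mul_le_mul_of_nonneg_left ?_ (abs_nonneg _)
      rw [abs_of_nonneg (le_max_right _ _)]
      exact max_le (neg_le_abs _) (abs_nonneg _)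
  have key : ∀ g : A × ℕ → ℝ, (Summable fun x => d x * max (g x) 0) →
      ∑' x, ENNReal.ofReal (d x) * ENNReal.ofReal (g x) =
        ENNReal.ofReal (∑' x, d x * max (g x) 0) := by
    intro g hg
    rw [ENNReal.ofReal_tsum_of_nonneg (fun x => mul_nonneg (hd x) (le_max_right _ _)) hg]
    refine tsum_congr fun x => ?_
    rw [ENNReal.ofReal_mul (hd x)]
    congr 1
    rcases le_total 0 (g x) with h0 | h0
    · rw [max_eq_left h0]
    · rw [max_eq_right h0, ENNReal.ofReal_of_nonpos h0, ENNReal.ofReal_zero]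
  unfold expPayoff
  rw [key _ hp, key _ hn, EReal.coe_ennreal_ofReal, EReal.coe_ennreal_ofReal,
    max_eq_left (tsum_nonneg fun x => mul_nonneg (hd x) (le_max_right _ _)),
    max_eq_left (tsum_nonneg fun x => mul_nonneg (hd x) (le_max_right _ _)), ← EReal.coe_sub,
    ← hp.tsum_sub hn]
  congr 2
  ext x
  rw [← mul_sub]
  congr 1
  rcases le_total 0 (f x.1 x.2) with h0 | h0
  · rw [max_eq_left h0, max_eq_right (neg_nonpos.2 h0), sub_zero]
  · rw [max_eq_right h0, max_eq_left (neg_nonneg.2 h0)]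
    ring

/-- If the positive part is summable and the whole series is not, then the negative part is infinite
and the payoff is `⊥`, so the bound is trivial in that case. -/
lemma expPayoff_le (f : A → ℕ → ℝ) {d : A × ℕ → ℝ} (hd : ∀ x, 0 ≤ d x) {c : ℝ}
    (hpos : Summable fun x => d x * max (f x.1 x.2) 0)
    (h : (Summable fun x => d x * f x.1 x.2) → ∑' x, d x * f x.1 x.2 ≤ c) :
    expPayoff f (fun x => ENNReal.ofReal (d x)) ≤ c := by
  by_cases hs : Summable fun x => d x * f x.1 x.2
  · rw [expPayoff_eq f hd hs]
    exact EReal.coe_le_coe_iff.2 (h hs)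
  · have key : ∀ (g : A × ℕ → ℝ) x, ENNReal.ofReal (d x) * ENNReal.ofReal (g x) =
        ENNReal.ofReal (d x * max (g x) 0) := by
      intro g x
      rw [ENNReal.ofReal_mul (hd x)]
      congr 1
      rcases le_total 0 (g x) with h0 | h0
      · rw [max_eq_left h0]
      · rw [max_eq_right h0, ENNReal.ofReal_of_nonpos h0, ENNReal.ofReal_zero]
    have hneg : ∑' x, ENNReal.ofReal (d x) * ENNReal.ofReal (-f x.1 x.2) = ⊤ := by
      by_contra hne
      simp only [key fun x => -f x.1 x.2] at hne
      have h1 := ENNReal.summable_toReal hne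
      refine hs ((hpos.sub h1).congr fun x => ?_)
      rw [ENNReal.toReal_ofReal (mul_nonneg (hd x) (le_max_right _ _)), ← mul_sub]
      congr 1
      rcases le_total 0 (f x.1 x.2) with h0 | h0
      · rw [max_eq_left h0, max_eq_right (neg_nonpos.2 h0), sub_zero]
      · rw [max_eq_right h0, max_eq_left (neg_nonneg.2 h0)]
        ring
    have hfin : ∑' x, ENNReal.ofReal (d x) * ENNReal.ofReal (f x.1 x.2) ≠ ⊤ := by
      simp only [key fun x => f x.1 x.2]
      exact hpos.tsum_ofReal_ne_top
    unfold expPayoff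
    rw [hneg, EReal.coe_ennreal_top, EReal.sub_top]
    exact bot_le

/-! ### The stopping time of the decision maker -/

lemma le_stopFrom (v : A → Θ → ℕ → ℝ) (I : InfoStructure μ₀) (t : ℕ) (ω : Path Θ) :
    (t : ℕ∞) ≤ stopFrom v I t ω :=
  le_iInf₂ fun _ hs => Nat.cast_le.2 hs.1

lemma lt_stopFrom_iff {I : InfoStructure μ₀} {s t : ℕ} {ω : Path Θ} :
    (s : ℕ∞) < stopFrom v I t ω ↔ ∀ u, t ≤ u → u ≤ s → ¬ StopsAt v I u ω := by
  constructor
  · intro h u htu hus hu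
    have : stopFrom v I t ω ≤ u := iInf₂_le u ⟨htu, hu⟩
    exact (h.trans_le (this.trans (Nat.cast_le.2 hus))).false
  · intro h
    have : ((s + 1 : ℕ) : ℕ∞) ≤ stopFrom v I t ω := le_iInf₂ fun u hu => by
      rw [Nat.cast_le]
      by_contra hlt
      exact h u hu.1 (by omega) hu.2
    exact (Nat.cast_lt.2 (Nat.lt_succ_self s)).trans_le this

lemma stopFrom_eq_iff {I : InfoStructure μ₀} {s t : ℕ} {ω : Path Θ} :
    stopFrom v I t ω = s ↔ t ≤ s ∧ StopsAt v I s ω ∧ ∀ u, t ≤ u → u < s → ¬ StopsAt v I u ω := by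
  constructor
  · intro h
    have hts : t ≤ s := by
      have := le_stopFrom v I t ω
      rw [h] at this
      exact_mod_cast this
    have hbefore : ∀ u, t ≤ u → u < s → ¬ StopsAt v I u ω := fun u htu hus hu => by
      have : stopFrom v I t ω ≤ u := iInf₂_le u ⟨htu, hu⟩
      rw [h] at this
      exact absurd (Nat.cast_le.1 this) (by omega)
    refine ⟨hts, ?_, hbefore⟩
    by_contra hs
    refine (lt_stopFrom_iff (v := v) (I := I) (s := s) (t := t) (ω := ω)).2 (fun u htu hus => ?_)
      |>.ne' h
    rcases hus.eq_or_lt with rfl | hlt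
    exacts [hs, hbefore u htu hlt]
  · rintro ⟨hts, hs, hbefore⟩
    refine le_antisymm (iInf₂_le s ⟨hts, hs⟩) (le_iInf₂ fun u hu => ?_)
    rw [Nat.cast_le]
    by_contra hlt
    exact hbefore u hu.1 (by omega) hu.2

section Measurability

variable [Nonempty A] (impatience : ∀ a θ t t', t' < t → v a θ t < v a θ t')
include impatience

lemma measurableSet_lt_stopFrom (I : InfoStructure μ₀) (t s : ℕ) :
    MeasurableSet[hist Θ s] {ω | (s : ℕ∞) < stopFrom v I t ω} := by
  have : {ω | (s : ℕ∞) < stopFrom v I t ω} =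
      ⋂ u, ⋂ (_ : t ≤ u), ⋂ (_ : u ≤ s), {ω | StopsAt v I u ω}ᶜ := by
    ext ω
    simp only [mem_ofPred_eq, lt_stopFrom_iff, mem_iInter, mem_compl_iff]
  rw [this]
  exact MeasurableSet.iInter fun u => MeasurableSet.iInter fun _ => MeasurableSet.iInter fun h =>
    (measurableSet_stopsAt impatience I h).compl

lemma measurableSet_stopFrom_eq (I : InfoStructure μ₀) (t s : ℕ) :
    MeasurableSet[hist Θ s] {ω | stopFrom v I t ω = s} := by
  have : {ω | stopFrom v I t ω = s} = {ω | t ≤ s} ∩ ({ω | StopsAt v I s ω} ∩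
      ⋂ u, ⋂ (_ : t ≤ u), ⋂ (_ : u < s), {ω | StopsAt v I u ω}ᶜ) := by
    ext ω
    simp only [mem_ofPred_eq, stopFrom_eq_iff, mem_iInter, mem_compl_iff, mem_inter_iff]
  rw [this]
  exact (MeasurableSet.const _).inter ((measurableSet_stopsAt impatience I le_rfl).inter
    (MeasurableSet.iInter fun u => MeasurableSet.iInter fun _ => MeasurableSet.iInter fun h =>
      (measurableSet_stopsAt impatience I h.le).compl))

end Measurability

end

/-! ### From information structures to laws on extremal points. -/

section

variable {v : A → Θ → ℕ → ℝ}

/-! ### Integrals of beliefs over events -/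

lemma measurable_belief_coord (s : ℕ) (θ : Θ) : Measurable fun ω : Path Θ => (ω s).1 θ :=
  (measurable_belief_apply θ).comp (measurable_fst.comp (measurable_pi_apply s))

lemma integrable_belief_coord (P : Measure (Path Θ)) [IsFiniteMeasure P] (s : ℕ) (θ : Θ) :
    Integrable (fun ω => (ω s).1 θ) P :=
  Integrable.of_bound (C := 1) (measurable_belief_coord s θ).aestronglyMeasurable
    (Filter.Eventually.of_forall fun ω => by
      rw [Real.norm_eq_abs, abs_of_nonneg (stdSimplex.zero_le _ _)]
      exact stdSimplex.le_one _ _)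

lemma setIntegral_expUtil (P : Measure (Path Θ)) [IsFiniteMeasure P] (F : Set (Path Θ)) (u s : ℕ)
    (a : A) : ∫ ω in F, expUtil v u (ω s).1 a ∂P =
      ∑ θ, (∫ ω in F, (ω s).1 θ ∂P) * v a θ u := by
  unfold expUtil
  rw [integral_finsetSum _ fun θ _ => ((integrable_belief_coord P s θ).integrableOn).mul_const _]
  exact Finset.sum_congr rfl fun θ _ => integral_mul_const _ _

lemma integrable_expUtil_coord [Nonempty A] (P : Measure (Path Θ)) [IsFiniteMeasure P] (u s : ℕ)
    (a : A) : Integrable (fun ω => expUtil v u (ω s).1 a) P :=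
  Integrable.of_bound (C := payoffBound v u)
    ((measurable_expUtil v u a).comp
      (measurable_fst.comp (measurable_pi_apply s))).aestronglyMeasurable
    (Filter.Eventually.of_forall fun _ => abs_expUtil_le v u _ a)

lemma integrable_vStar_path [Nonempty A] (P : Measure (Path Θ)) [IsFiniteMeasure P] (u s : ℕ) :
    Integrable (fun ω => vStar v u (ω s).1) P :=
  Integrable.of_bound (C := payoffBound v u)
    ((measurable_vStar v u).comp
      (measurable_fst.comp (measurable_pi_apply s))).aestronglyMeasurable
    (Filter.Eventually.of_forall fun _ => abs_vStar_le v u _)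

lemma sum_setIntegral_belief (P : Measure (Path Θ)) [IsFiniteMeasure P] (F : Set (Path Θ)) (s : ℕ) :
    ∑ θ, ∫ ω in F, (ω s).1 θ ∂P = P.real F := by
  rw [← integral_finsetSum _ fun θ _ => (integrable_belief_coord P s θ).integrableOn]
  simp [stdSimplex.sum_eq_one]

/-- The stopping beliefs on an event on which the best responses at time `s` are those in `S` can
be replaced by extremal ones. -/
lemma exists_split_event (P : Measure (Path Θ)) [IsFiniteMeasure P] [Nonempty A] {s : ℕ} {S : Set A}
    {F : Set (Path Θ)} (hFm : MeasurableSet F) (hF : ∀ ω ∈ F, bestResp v s (ω s).1 = S) :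
    ∃ w : ExtPoint v → ℝ, (∀ z, 0 ≤ w z) ∧
      (∀ z, w z ≠ 0 → z.level = s ∧ S ⊆ bestResp v s z.belief ∧ P F ≠ 0) ∧
      (∑ z ∈ levelSet v s, w z = P.real F) ∧
      ∀ θ, ∑ z ∈ levelSet v s, w z * z.belief θ = ∫ ω in F, (ω s).1 θ ∂P := by
  by_cases hP : P F = 0
  · refine ⟨0, fun _ => le_rfl, fun z hz => (hz rfl).elim, by simp [measureReal_def, hP],
      fun θ => ?_⟩
    rw [Measure.restrict_eq_zero.2 hP]
    simp
  have hpos : 0 < P.real F := ENNReal.toReal_pos hP (measure_ne_top P F)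
  -- The average stopping belief on `F`.
  let x : Θ → ℝ := fun θ => (P.real F)⁻¹ * ∫ ω in F, (ω s).1 θ ∂P
  have hx : x ∈ stdSimplex ℝ Θ := by
    refine ⟨fun θ => mul_nonneg (inv_nonneg.2 hpos.le)
      (integral_nonneg fun ω => stdSimplex.zero_le _ _), ?_⟩
    simp only [x]
    rw [← Finset.mul_sum, sum_setIntegral_belief, inv_mul_cancel₀ hpos.ne']
  have hexp : ∀ a, expUtil v s (⟨x, hx⟩ : Belief Θ) a =
      (P.real F)⁻¹ * ∫ ω in F, expUtil v s (ω s).1 a ∂P := by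
    intro a
    rw [setIntegral_expUtil, Finset.mul_sum]
    exact Finset.sum_congr rfl fun θ _ => mul_assoc _ _ _
  -- Optimality of an action in `S` is a system of linear inequalities in the belief, so it passes
  -- to the average.
  have hreg : x ∈ optRegion v s S := by
    refine ⟨⟨x, hx⟩, rfl, fun a ha b => ?_⟩
    rw [hexp, hexp]
    refine mul_le_mul_of_nonneg_left ?_ (inv_nonneg.2 hpos.le)
    refine setIntegral_mono_on (integrable_expUtil_coord P s s b).integrableOn
      (integrable_expUtil_coord P s s a).integrableOn hFm fun ω hω => ?_
    rw [← hF ω hω] at ha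
    exact ha b
  obtain ⟨w, h0, h1, h2, h3⟩ := exists_extremal_split v s S hreg
  refine ⟨fun z => P.real F * w z, fun z => mul_nonneg hpos.le (h0 z), fun z hz => ?_, ?_,
    fun θ => ?_⟩
  · obtain ⟨h4, h5⟩ := h1 z (right_ne_zero_of_mul hz)
    exact ⟨h4, h5, hP⟩
  · rw [← Finset.mul_sum]
    exact (congrArg _ h2).trans (mul_one _)
  · simp only [mul_assoc]
    rw [← Finset.mul_sum]
    refine (congrArg _ (h3 θ)).trans ?_
    rw [mul_inv_cancel_left₀ hpos.ne']

lemma sum_split_expUtil {P : Measure (Path Θ)} [IsFiniteMeasure P] {s : ℕ} {F : Set (Path Θ)}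
    {w : ExtPoint v → ℝ}
    (hw : ∀ θ, ∑ z ∈ levelSet v s, w z * z.belief θ = ∫ ω in F, (ω s).1 θ ∂P) (u : ℕ) (a : A) :
    ∑ z ∈ levelSet v s, w z * expUtil v u z.belief a = ∫ ω in F, expUtil v u (ω s).1 a ∂P := by
  rw [setIntegral_expUtil]
  simp only [← hw, expUtil, Finset.mul_sum, Finset.sum_mul]
  rw [Finset.sum_comm]
  exact Finset.sum_congr rfl fun θ _ => Finset.sum_congr rfl fun z _ => by ring

/-! ### Continuation after an event -/

lemma cond_eq_smul_restrict {Ω : Type*} [MeasurableSpace Ω] (P : Measure Ω) (B : Set Ω) :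
    P[|B] = (P B)⁻¹ • P.restrict B := rfl

lemma integrable_cond {Ω : Type*} [MeasurableSpace Ω] {P : Measure Ω} {B : Set Ω} {g : Ω → ℝ}
    (hg : Integrable g P) (hB : P B ≠ 0) : Integrable g P[|B] := by
  rw [cond_eq_smul_restrict]
  exact hg.restrict.smul_measure (ENNReal.inv_ne_top.2 hB)

/-- Conditioning on an event that lies in the past of time `s` only replaces `E` by `E ∩ B`, which
is still a time-`s` event, and rescales. -/
lemma setIntegral_cond_condExp (I : InfoStructure μ₀) {s t : ℕ} (hts : t ≤ s) {B E : Set (Path Θ)}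
    (hB : MeasurableSet[hist Θ t] B) (hE : MeasurableSet[hist Θ s] E) {g : Path Θ → ℝ}
    (hg : Integrable g I.law) :
    ∫ ω in E, (I.law[g | hist Θ s]) ω ∂I.law[|B] = ∫ ω in E, g ω ∂I.law[|B] := by
  have hE' : MeasurableSet E := (hist Θ).le s _ hE
  rw [cond_eq_smul_restrict, Measure.restrict_smul, Measure.restrict_restrict hE',
    integral_smul_measure, integral_smul_measure,
    setIntegral_condExp ((hist Θ).le s) hg (hE.inter ((hist Θ).mono hts _ hB))]

section Continuation

variable [Nonempty A] (impatience : ∀ a θ t t', t' < t → v a θ t < v a θ t')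
  (I : InfoStructure μ₀) {t : ℕ} {B : Set (Path Θ)} (hB : MeasurableSet[hist Θ t] B)
  (hB0 : I.law B ≠ 0) (hfin : ∀ᵐ ω ∂I.law[|B], stopFrom v I t ω < ⊤)

lemma setOf_lt_stopFrom_eq_union (n : ℕ) : {ω | (n : ℕ∞) < stopFrom v I t ω} =
    {ω | stopFrom v I t ω = (n + 1 : ℕ)} ∪ {ω | ((n + 1 : ℕ) : ℕ∞) < stopFrom v I t ω} := by
  ext ω
  simp only [mem_ofPred_eq, mem_union]
  rw [eq_comm, ← le_iff_eq_or_lt, Nat.cast_add, Nat.cast_one,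
    ENat.add_one_le_iff (ENat.natCast_ne_top n)]

lemma disjoint_stopFrom (n : ℕ) : Disjoint {ω | stopFrom v I t ω = n}
    {ω | (n : ℕ∞) < stopFrom v I t ω} :=
  Set.disjoint_left.2 fun _ h h' => (h' : _ < _).ne' h

include impatience

lemma setIntegral_lt_stopFrom {P : Measure (Path Θ)} {g : Path Θ → ℝ} (hg : Integrable g P)
    (n : ℕ) : ∫ ω in {ω | (n : ℕ∞) < stopFrom v I t ω}, g ω ∂P =
      ∫ ω in {ω | stopFrom v I t ω = (n + 1 : ℕ)}, g ω ∂P +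
        ∫ ω in {ω | ((n + 1 : ℕ) : ℕ∞) < stopFrom v I t ω}, g ω ∂P := by
  rw [setOf_lt_stopFrom_eq_union, setIntegral_union (disjoint_stopFrom I _)
    ((hist Θ).le _ _ (measurableSet_lt_stopFrom impatience I t _)) hg.integrableOn hg.integrableOn]

lemma integral_eq_stop_add_wait {P : Measure (Path Θ)} {g : Path Θ → ℝ} (hg : Integrable g P) :
    ∫ ω, g ω ∂P = ∫ ω in {ω | stopFrom v I t ω = t}, g ω ∂P +
        ∫ ω in {ω | (t : ℕ∞) < stopFrom v I t ω}, g ω ∂P := by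
  rw [← setIntegral_union (disjoint_stopFrom I _)
    ((hist Θ).le _ _ (measurableSet_lt_stopFrom impatience I t _)) hg.integrableOn hg.integrableOn]
  have : {ω | stopFrom v I t ω = t} ∪ {ω | (t : ℕ∞) < stopFrom v I t ω} = univ := by
    ext ω
    simp only [mem_union, mem_ofPred_eq, mem_univ, iff_true]
    rw [eq_comm]
    exact (le_stopFrom v I t ω).eq_or_lt
  rw [this, setIntegral_univ]

lemma tendsto_measure_lt_stopFrom {P : Measure (Path Θ)} [IsFiniteMeasure P]
    (hfin : ∀ᵐ ω ∂P, stopFrom v I t ω < ⊤) :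
    Filter.Tendsto (fun n : ℕ => P.real {ω | (n : ℕ∞) < stopFrom v I t ω}) Filter.atTop
      (nhds 0) := by
  have h := tendsto_measure_iInter_atTop (μ := P)
    (s := fun n : ℕ => {ω | (n : ℕ∞) < stopFrom v I t ω})
    (fun n => ((hist Θ).le _ _ (measurableSet_lt_stopFrom impatience I t n)).nullMeasurableSet)
    (fun m n hmn ω (hω : (n : ℕ∞) < _) => show (m : ℕ∞) < _ from (Nat.cast_le.2 hmn).trans_lt hω) ⟨0, measure_ne_top P _⟩
  have h0 : P (⋂ n : ℕ, {ω | (n : ℕ∞) < stopFrom v I t ω}) = 0 := by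
    refine measure_mono_null (fun ω hω => ?_) (ae_iff.1 hfin)
    simp only [mem_iInter, mem_ofPred_eq] at hω ⊢
    intro hlt
    obtain ⟨n, hn⟩ := ENat.ne_top_iff_exists.1 hlt.ne
    exact (hω n).ne hn
  rw [h0] at h
  simpa [measureReal_def, Function.comp_def] using
    (ENNReal.tendsto_toReal ENNReal.zero_ne_top).comp h

include hB hB0 hfin

/-- Optional stopping for the belief martingale: on the event of still waiting, the mean belief of
one period is passed on to those who stop in the next and those who do not. Beliefs are bounded, so
the remainder vanishes with the probability of waiting. -/
lemma hasSum_belief_stop {t' : ℕ} (ht' : t ≤ t') (θ : Θ) :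
    HasSum (fun s : ℕ => if t' < s then
        ∫ ω in {ω | stopFrom v I t ω = s}, (ω s).1 θ ∂I.law[|B] else 0)
      (∫ ω in {ω | (t' : ℕ∞) < stopFrom v I t ω}, (ω t').1 θ ∂I.law[|B]) := by
  have : IsProbabilityMeasure I.law[|B] := cond_isProbabilityMeasure hB0
  refine hasSum_of_telescope
    (c := fun n => ∫ ω in {ω | (n : ℕ∞) < stopFrom v I t ω}, (ω n).1 θ ∂I.law[|B])
    (e := fun s => ∫ ω in {ω | stopFrom v I t ω = s}, (ω s).1 θ ∂I.law[|B])
    (fun s => integral_nonneg fun ω => stdSimplex.zero_le _ _) (fun n hn => ?_) ?_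
  · rw [← setIntegral_lt_stopFrom impatience I (integrable_belief_coord _ (n + 1) θ)]
    have h := setIntegral_cond_condExp I (ht'.trans hn) hB
      (measurableSet_lt_stopFrom impatience I t n) (integrable_belief_coord I.law (n + 1) θ)
    rw [← h]
    refine integral_congr_ae (ae_restrict_of_ae ?_)
    have hm : ∀ᵐ ω ∂I.law[|B], (I.law[fun ω => (ω (n + 1)).1 θ | hist Θ n]) ω = (ω n).1 θ :=
      cond_absolutelyContinuous.ae_le (I.martingale n θ)
    filter_upwards [hm] with ω h using h.symm
  · refine squeeze_zero (fun n => integral_nonneg fun ω => stdSimplex.zero_le _ _) (fun n => ?_)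
      (tendsto_measure_lt_stopFrom impatience I hfin)
    refine (setIntegral_mono (integrable_belief_coord _ n θ).integrableOn
      (integrable_const (1 : ℝ)).integrableOn fun ω => stdSimplex.le_one _ _).trans ?_
    simp

/-- Waiting reveals that `v*` is at most the continuation value. By `value_le_max` the value at the
next date is at most `v*` on the paths that stop there and at most the continuation value on those
that wait, so the inequality telescopes. What is left after `n` periods is at most a constant times
the probability of still waiting. -/
lemma vStar_stop_sums {t' : ℕ} (ht' : t ≤ t') :
    Summable (fun s : ℕ => if t' < s then
        ∫ ω in {ω | stopFrom v I t ω = s}, vStar v s (ω s).1 ∂I.law[|B] else 0) ∧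
      ∫ ω in {ω | (t' : ℕ∞) < stopFrom v I t ω}, vStar v t' (ω t').1 ∂I.law[|B] ≤
        ∑' s : ℕ, if t' < s then
          ∫ ω in {ω | stopFrom v I t ω = s}, vStar v s (ω s).1 ∂I.law[|B] else 0 := by
  have : IsProbabilityMeasure I.law[|B] := cond_isProbabilityMeasure hB0
  set P := I.law[|B] with hP
  have hac : P ≪ I.law := cond_absolutelyContinuous
  have hWm : ∀ n : ℕ, MeasurableSet {ω | (n : ℕ∞) < stopFrom v I t ω} := fun n =>
    (hist Θ).le _ _ (measurableSet_lt_stopFrom impatience I t n)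
  have hSm : ∀ n : ℕ, MeasurableSet {ω | stopFrom v I t ω = n} := fun n =>
    (hist Θ).le _ _ (measurableSet_stopFrom_eq impatience I t n)
  have hUint : ∀ n, Integrable (value v I n) P := fun n =>
    integrable_cond (integrable_value impatience I n) hB0
  have hcint : ∀ n, Integrable (contValue v I n) P := fun n =>
    integrable_cond integrable_condExp hB0
  have hcont : ∀ n, t ≤ n → ∫ ω in {ω | (n : ℕ∞) < stopFrom v I t ω}, contValue v I n ω ∂P =
      ∫ ω in {ω | (n : ℕ∞) < stopFrom v I t ω}, value v I (n + 1) ω ∂P := fun n hn =>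
    setIntegral_cond_condExp I hn hB (measurableSet_lt_stopFrom impatience I t n)
      (integrable_value impatience I (n + 1))
  have hwait : ∀ (n : ℕ) ω, t ≤ n → (n : ℕ∞) < stopFrom v I t ω →
      vStar v n (ω n).1 ≤ contValue v I n ω := fun n ω hn h =>
    not_lt.1 (lt_stopFrom_iff.1 h n hn le_rfl)
  have hconst : ∀ (F : Set (Path Θ)) (c : ℝ), ∫ _ in F, c ∂P = c * P.real F := fun F c => by
    simp [mul_comm]
  have hp : Summable fun s : ℕ => if t' < s then P.real {ω | stopFrom v I t ω = s} else 0 := by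
    have := summable_sum (s := Finset.univ) fun θ (_ : θ ∈ Finset.univ) =>
      (hasSum_belief_stop impatience I hB hB0 hfin ht' θ).summable
    refine this.congr fun s => ?_
    split_ifs
    · exact sum_setIntegral_belief _ _ s
    · simp
  have hp0 : ∀ s : ℕ, 0 ≤ if t' < s then P.real {ω | stopFrom v I t ω = s} else 0 := fun s => by
    split_ifs
    exacts [measureReal_nonneg, le_rfl]
  have key := summable_and_le_of_telescope (t := t') (M := payoffBound v 0)
    (u := fun n => ∫ ω in {ω | (n : ℕ∞) < stopFrom v I t ω}, value v I (n + 1) ω ∂P)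
    (e := fun s => if t' < s then
      ∫ ω in {ω | stopFrom v I t ω = s}, vStar v s (ω s).1 ∂P else 0)
    (q := fun n : ℕ => P.real {ω | (n : ℕ∞) < stopFrom v I t ω}) hp0 (payoffBound_nonneg v 0) hp
    (fun s => ?_) (fun n hn => ?_) (fun n => ?_) (tendsto_measure_lt_stopFrom impatience I hfin)
    fun n => measureReal_le_one
  · have hite : (fun s : ℕ => if t' < s then (if t' < s then
        ∫ ω in {ω | stopFrom v I t ω = s}, vStar v s (ω s).1 ∂P else 0) else 0) =
        fun s : ℕ => if t' < s then
          ∫ ω in {ω | stopFrom v I t ω = s}, vStar v s (ω s).1 ∂P else 0 := by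
      ext s
      split_ifs <;> rfl
    rw [hite] at key
    refine ⟨key.1, le_trans ?_ key.2⟩
    rw [← hcont t' ht']
    exact setIntegral_mono_on (integrable_vStar_path P t' t').integrableOn (hcint t').integrableOn
      (hWm t') fun ω hω => hwait t' ω ht' hω
  · split_ifs
    · rw [← hconst]
      exact setIntegral_mono (integrable_vStar_path P s s).integrableOn
        (integrable_const _).integrableOn fun ω => vStar_le_payoffBound_zero impatience _ _
    · simp
  · rw [if_pos (by omega), setIntegral_lt_stopFrom impatience I (hUint (n + 1)),
      ← hcont (n + 1) (by omega)]
    have hmax := hac.ae_le (value_le_max impatience I (n + 1))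
    refine add_le_add ?_ ?_
    · refine setIntegral_mono_on_ae (hUint _).integrableOn
        (integrable_vStar_path P _ _).integrableOn (hSm _) ?_
      filter_upwards [hmax] with ω h hω
      exact h.trans (max_le le_rfl (stopFrom_eq_iff.1 hω).2.1.le)
    · refine setIntegral_mono_on_ae (hUint _).integrableOn (hcint _).integrableOn (hWm _) ?_
      filter_upwards [hmax] with ω h hω
      exact h.trans (max_le (hwait (n + 1) ω (by omega) hω) le_rfl)
  · rw [← hconst]
    refine setIntegral_mono_ae (hUint _).integrableOn (integrable_const _).integrableOn ?_
    exact hac.ae_le (value_le_bound impatience I (n + 1))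

end Continuation

end

section

variable {v : A → Θ → ℕ → ℝ} [Nonempty A]

/-! ### Reduction to laws on extremal points -/

lemma TieBreak.integrable_rule (γ : TieBreak v) (P : Measure (Path Θ)) [IsFiniteMeasure P] (s : ℕ)
    (a : A) : Integrable (fun ω => γ.rule s (ω s).1 a) P :=
  Integrable.of_bound (C := 1)
    ((measurable_belief_apply a).comp ((γ.measurable s).comp
      (measurable_fst.comp (measurable_pi_apply s)))).aestronglyMeasurable
    (Filter.Eventually.of_forall fun ω => by
      rw [Real.norm_eq_abs, abs_of_nonneg (stdSimplex.zero_le _ _)]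
      exact stdSimplex.le_one _ _)

lemma TieBreak.sum_setIntegral_rule (γ : TieBreak v) (P : Measure (Path Θ)) [IsFiniteMeasure P]
    (F : Set (Path Θ)) (s : ℕ) : ∑ a, ∫ ω in F, γ.rule s (ω s).1 a ∂P = P.real F := by
  rw [← integral_finsetSum _ fun a _ => (γ.integrable_rule P s a).integrableOn]
  simp [stdSimplex.sum_eq_one]

/-- The stopping beliefs on an event can be replaced by extremal ones, which is harmless for the
decision maker and weakly good for the designer. -/
lemma exists_level_split (P : Measure (Path Θ)) [IsFiniteMeasure P] (s : ℕ) {E : Set (Path Θ)}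
    (hE : MeasurableSet E) : ∃ w : ExtPoint v → ℝ, (∀ z, 0 ≤ w z) ∧
      (∀ z, w z ≠ 0 → z.level = s ∧ P E ≠ 0) ∧
      (∀ θ, ∑ z ∈ levelSet v s, w z * z.belief θ = ∫ ω in E, (ω s).1 θ ∂P) ∧
      (∑ z ∈ levelSet v s, w z * vStar v s z.belief = ∫ ω in E, vStar v s (ω s).1 ∂P) ∧
      ∀ (γ : TieBreak v) (f : A → ℕ → ℝ) (φ : ℝ → ℝ), Monotone φ →
        ∑ a, (∫ ω in E, γ.rule s (ω s).1 a ∂P) * φ (f a s) ≤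
          ∑ z ∈ levelSet v s, w z * φ (indirectPayoff v f z.belief s) := by
  classical
  -- On a cell of this partition the set of best responses is constant, which is what
  -- `exists_split_event` requires.
  let F : Set A → Set (Path Θ) := fun S => E ∩ {ω | bestResp v s (ω s).1 = S}
  have hFm : ∀ S, MeasurableSet (F S) := fun S => hE.inter
    (measurable_fst.comp (measurable_pi_apply s) (measurableSet_bestResp_eq v s S))
  have hFS : ∀ S, ∀ ω ∈ F S, bestResp v s (ω s).1 = S := fun S ω hω => hω.2
  have hFE : ∀ g : Path Θ → ℝ, Integrable g P → ∫ ω in E, g ω ∂P = ∑ S, ∫ ω in F S, g ω ∂P := by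
    intro g hg
    rw [← integral_iUnion_fintype hFm (fun S S' hSS' => Set.disjoint_left.2 fun ω h h' =>
      hSS' (h.2.symm.trans h'.2)) fun S => hg.integrableOn]
    congr 2
    ext ω
    simp [F]
  choose w h0 h1 h2 h3 using fun S => exists_split_event P (hFm S) (hFS S)
  have hsum : ∀ g : ExtPoint v → ℝ, ∑ z ∈ levelSet v s, (∑ S, w S z) * g z =
      ∑ S, ∑ z ∈ levelSet v s, w S z * g z := by
    intro g
    simp only [Finset.sum_mul]
    exact Finset.sum_comm
  have hcase : ∀ S : Set A, S.Nonempty ∨ (F S = ∅ ∧ ∀ z, w S z = 0) := by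
    intro S
    rcases S.eq_empty_or_nonempty with rfl | hS
    · right
      have hempty : F ∅ = ∅ := by
        ext ω
        simp only [F, mem_inter_iff, mem_ofPred_eq, mem_empty_iff_false, iff_false, not_and]
        exact fun _ => (bestResp_nonempty v s _).ne_empty
      refine ⟨hempty, fun z => ?_⟩
      by_contra hz
      exact (h1 ∅ z hz).2.2 (by rw [hempty, measure_empty])
    · exact Or.inl hS
  refine ⟨fun z => ∑ S, w S z, fun z => Finset.sum_nonneg fun S _ => h0 S z, fun z hz => ?_,
    fun θ => ?_, ?_, fun γ f φ hφ => ?_⟩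
  · obtain ⟨S, -, hS⟩ := Finset.exists_ne_zero_of_sum_ne_zero hz
    obtain ⟨h4, -, h5⟩ := h1 S z hS
    exact ⟨h4, fun h => h5 (measure_mono_null inter_subset_left h)⟩
  · rw [hsum, hFE _ (integrable_belief_coord P s θ)]
    exact Finset.sum_congr rfl fun S _ => h3 S θ
  · rw [hsum, hFE _ (integrable_vStar_path P s s)]
    refine Finset.sum_congr rfl fun S _ => ?_
    rcases hcase S with ⟨a, ha⟩ | ⟨hF, hw⟩
    -- Any fixed `a ∈ S` is optimal at the original beliefs in the cell and at the extremal beliefs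
    -- that replace them, so `v*` equals a single linear functional at all of them.
    · have e1 : ∑ z ∈ levelSet v s, w S z * vStar v s z.belief =
          ∑ z ∈ levelSet v s, w S z * expUtil v s z.belief a := by
        refine Finset.sum_congr rfl fun z _ => ?_
        by_cases hz : w S z = 0
        · simp [hz]
        · rw [mem_bestResp_iff.1 ((h1 S z hz).2.1 ha)]
      rw [e1, sum_split_expUtil (h3 S)]
      refine setIntegral_congr_fun (hFm S) fun ω hω => ?_
      exact mem_bestResp_iff.1 ((hFS S ω hω).symm ▸ ha)
    · simp [hF, hw]
  · rw [hsum]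
    have hrule : ∀ a, ∫ ω in E, γ.rule s (ω s).1 a ∂P = ∑ S, ∫ ω in F S, γ.rule s (ω s).1 a ∂P :=
      fun a => hFE _ (γ.integrable_rule P s a)
    simp only [hrule, Finset.sum_mul]
    rw [Finset.sum_comm]
    refine Finset.sum_le_sum fun S _ => ?_
    rcases hcase S with hS | ⟨hF, hw⟩
    -- The rule plays only actions in `S`, so it does no better than the designer's favourite in
    -- `S`, which is still optimal at the extremal beliefs.
    · calc ∑ a, (∫ ω in F S, γ.rule s (ω s).1 a ∂P) * φ (f a s)
          ≤ ∑ a, (∫ ω in F S, γ.rule s (ω s).1 a ∂P) * φ (f (bestAction f s S) s) := by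
            refine Finset.sum_le_sum fun a _ => ?_
            by_cases ha : a ∈ S
            · exact mul_le_mul_of_nonneg_left (hφ (le_bestAction f s ha))
                (integral_nonneg fun ω => stdSimplex.zero_le _ _)
            · have : ∫ ω in F S, γ.rule s (ω s).1 a ∂P = 0 := by
                refine setIntegral_eq_zero_of_forall_eq_zero fun ω hω => ?_
                by_contra hne
                refine ha ((hFS S ω hω) ▸ γ.proper s _ a ?_)
                exact (stdSimplex.zero_le _ _).lt_of_ne' hne
              simp [this]
        _ = ∑ z ∈ levelSet v s, w S z * φ (f (bestAction f s S) s) := by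
            rw [← Finset.sum_mul, ← Finset.sum_mul, γ.sum_setIntegral_rule, h2]
        _ ≤ _ := by
            refine Finset.sum_le_sum fun z _ => ?_
            by_cases hz : w S z = 0
            · simp [hz]
            · exact mul_le_mul_of_nonneg_left
                (hφ (le_indirectPayoff f ((h1 S z hz).2.1 (bestAction_mem f s hS)))) (h0 S z)
    · simp [hF, hw]

lemma outcomeDist_eq_ofReal (I : InfoStructure μ₀) (γ : TieBreak v) (t : ℕ) (P : Measure (Path Θ))
    [IsFiniteMeasure P] : outcomeDist v I γ t P = fun x => ENNReal.ofReal
      (∫ ω in {ω | stopFrom v I t ω = x.2}, γ.rule x.2 (ω x.2).1 x.1 ∂P) := by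
  ext x
  rw [outcomeDist, ofReal_integral_eq_lintegral_ofReal (γ.integrable_rule P x.2 x.1).integrableOn
    (Filter.Eventually.of_forall fun ω => stdSimplex.zero_le _ _)]

lemma summable_prod_of_sums {d : A × ℕ → ℝ} (hd : ∀ x, 0 ≤ d x)
    (h : Summable fun s => ∑ a, d (a, s)) : Summable d := by
  have : Summable fun p : ℕ × A => d (p.2, p.1) :=
    (summable_prod_of_nonneg fun p => hd _).2 ⟨fun s => Summable.of_finite, by simpa using h⟩
  exact (Equiv.prodComm ℕ A).summable_iff.1 this

lemma tsum_prod_sums {d : A × ℕ → ℝ} (hd : Summable d) :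
    HasSum (fun s => ∑ a, d (a, s)) (∑' x, d x) := by
  have h1 : HasSum (fun p : ℕ × A => d (p.2, p.1)) (∑' x, d x) :=
    (Equiv.prodComm ℕ A).hasSum_iff.2 hd.hasSum
  exact h1.prod_fiberwise fun s => hasSum_fintype _

/-- The laws on extremal points that a continuation after an event generates. -/
theorem exists_law_of_structure (impatience : ∀ a θ t t', t' < t → v a θ t < v a θ t')
    (I : InfoStructure μ₀) (γ : TieBreak v) {t : ℕ} {B : Set (Path Θ)}
    (hB : MeasurableSet[hist Θ t] B) (hB0 : I.law B ≠ 0)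
    (hfin : ∀ᵐ ω ∂I.law[|B], stopFrom v I t ω < ⊤) :
    ∃ Q : ExtPoint v → ℝ, IsLaw Q ∧
      (∀ z, Q z ≠ 0 → t ≤ z.level ∧ I.law[|B] {ω | stopFrom v I t ω = z.level} ≠ 0) ∧
      Obedient t Q ∧ (∀ θ, HasSum (fun z => Q z * z.belief θ) (∫ ω, (ω t).1 θ ∂I.law[|B])) ∧
      (∫ ω, vStar v t (ω t).1 ∂I.law[|B] ≤ ∑' z, Q z * vStar v z.level z.belief) ∧
      ∀ f : A → ℕ → ℝ, (Summable fun z => Q z * indirectPayoff v f z.belief z.level) →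
        expPayoff f (outcomeDist v I γ t I.law[|B]) ≤
          ((∑' z, Q z * indirectPayoff v f z.belief z.level : ℝ) : EReal) := by
  have hprob : IsProbabilityMeasure I.law[|B] := cond_isProbabilityMeasure hB0
  set P := I.law[|B] with hP
  have hSm : ∀ n : ℕ, MeasurableSet {ω | stopFrom v I t ω = n} := fun n =>
    (hist Θ).le _ _ (measurableSet_stopFrom_eq impatience I t n)
  choose w h0 h1 h2 h3 h4 using fun s => exists_level_split (v := v) P s (hSm s)
  let Q : ExtPoint v → ℝ := fun z => w z.level z
  have hQ0 : ∀ z, 0 ≤ Q z := fun z => h0 _ z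
  have hlev : ∀ (g : ExtPoint v → ℕ → ℝ) (s : ℕ), ∑ z ∈ levelSet v s, Q z * g z z.level =
      ∑ z ∈ levelSet v s, w s z * g z s := fun g s =>
    Finset.sum_congr rfl fun z hz => by
      have : z.level = s := mem_levelSet.1 hz
      simp only [Q, this]
  have hlevB : ∀ θ s, ∑ z ∈ levelSet v s, Q z * z.belief θ =
      ∫ ω in {ω | stopFrom v I t ω = s}, (ω s).1 θ ∂P := fun θ s =>
    (hlev (fun z _ => z.belief θ) s).trans (h2 s θ)
  have hlevV : ∀ s, ∑ z ∈ levelSet v s, Q z * vStar v z.level z.belief =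
      ∫ ω in {ω | stopFrom v I t ω = s}, vStar v s (ω s).1 ∂P := fun s =>
    (hlev (fun z s => vStar v s z.belief) s).trans (h3 s)
  have hlevM : ∀ s, ∑ z ∈ levelSet v s, Q z = P.real {ω | stopFrom v I t ω = s} := fun s => by
    rw [← sum_setIntegral_belief P _ s, ← Finset.sum_congr rfl fun θ _ => hlevB θ s,
      Finset.sum_comm]
    refine Finset.sum_congr rfl fun z _ => ?_
    rw [← Finset.mul_sum, stdSimplex.sum_eq_one, mul_one]
  have hsupp : ∀ z, Q z ≠ 0 → t ≤ z.level ∧ P {ω | stopFrom v I t ω = z.level} ≠ 0 := by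
    intro z hz
    have h5 := (h1 _ z hz).2
    refine ⟨?_, h5⟩
    obtain ⟨ω, hω⟩ := nonempty_of_measure_ne_zero h5
    exact (stopFrom_eq_iff.1 hω).1
  have hfirst : ∀ g : ℕ → ℝ, (∀ s, s < t → g s = 0) →
      g = fun s => (if s = t then g t else 0) + if t < s then g s else 0 := by
    intro g hg
    ext s
    rcases lt_trichotomy s t with h | h | h
    · simp [h.ne, h.not_gt, hg s h]
    · simp [h]
    · simp [h.ne', h]
  have hempty : ∀ s : ℕ, s < t → {ω | stopFrom v I t ω = s} = ∅ := fun s hs => by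
    ext ω
    simp only [mem_ofPred_eq, mem_empty_iff_false, iff_false]
    exact fun h => absurd (stopFrom_eq_iff.1 h).1 (by omega)
  have hBsum : ∀ θ, HasSum (fun s : ℕ => ∫ ω in {ω | stopFrom v I t ω = s}, (ω s).1 θ ∂P)
      (∫ ω, (ω t).1 θ ∂P) := by
    intro θ
    rw [hfirst (fun s : ℕ => ∫ ω in {ω | stopFrom v I t ω = s}, (ω s).1 θ ∂P)
      (fun s hs => by simp [hempty s hs]),
      integral_eq_stop_add_wait impatience I (t := t) (integrable_belief_coord P t θ)]
    exact (hasSum_ite_eq t _).add (hasSum_belief_stop impatience I hB hB0 hfin le_rfl θ)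
  have hVsums := fun t' (ht' : t ≤ t') => vStar_stop_sums impatience I hB hB0 hfin ht'
  have hVsum : HasSum (fun s : ℕ => ∫ ω in {ω | stopFrom v I t ω = s}, vStar v s (ω s).1 ∂P)
      (∫ ω in {ω | stopFrom v I t ω = t}, vStar v t (ω t).1 ∂P + ∑' s : ℕ, if t < s then
        ∫ ω in {ω | stopFrom v I t ω = s}, vStar v s (ω s).1 ∂P else 0) := by
    rw [hfirst (fun s : ℕ => ∫ ω in {ω | stopFrom v I t ω = s}, vStar v s (ω s).1 ∂P)
      (fun s hs => by simp [hempty s hs])]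
    refine (hasSum_ite_eq t _).add ?_
    have := (hVsums t le_rfl).1.hasSum
    simpa using this
  have hMsum : Summable fun s => ∑ z ∈ levelSet v s, Q z := by
    have := summable_sum (s := Finset.univ) fun θ (_ : θ ∈ Finset.univ) => (hBsum θ).summable
    refine this.congr fun s => ?_
    rw [hlevM, sum_setIntegral_belief]
  -- Payoffs are bounded above, so the weight is controlled by a constant minus `v*`, whose sums
  -- over levels are already known to converge.
  have hbound : ∀ z : ExtPoint v, z.weight ≤
      (1 + 2 * payoffBound v 0) - vStar v z.level z.belief := by
    intro z
    have h5 := vStar_le_payoffBound_zero impatience z.level z.belief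
    have h6 := payoffBound_nonneg v 0
    unfold ExtPoint.weight
    rcases abs_cases (vStar v z.level z.belief) with ⟨h, _⟩ | ⟨h, _⟩ <;> rw [h] <;> linarith
  have hlaw : IsLaw Q := by
    refine ⟨hQ0, ?_⟩
    have h5 : Summable fun z => Q z * ((1 + 2 * payoffBound v 0) - vStar v z.level z.belief) := by
      refine summable_of_levels (fun z => mul_nonneg (hQ0 z) (z.weight_nonneg.trans (hbound z))) ?_
      simp only [mul_sub, Finset.sum_sub_distrib, ← Finset.sum_mul, hlevV]
      exact (hMsum.mul_right _).sub hVsum.summable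
    exact Summable.of_nonneg_of_le (fun z => mul_nonneg (hQ0 z) z.weight_nonneg)
      (fun z => mul_le_mul_of_nonneg_left (hbound z) (hQ0 z)) h5
  have hbary : ∀ θ, HasSum (fun z => Q z * z.belief θ) (∫ ω, (ω t).1 θ ∂P) := by
    intro θ
    have h5 := summable_mul_belief hlaw.summable θ
    have h6 := hasSum_levels h5
    simp only [hlevB] at h6
    rw [(hBsum θ).unique h6]
    exact h5.hasSum
  refine ⟨Q, hlaw, hsupp, ?_, hbary, ?_, fun f hf => ?_⟩
  · intro t' ht' a
    have h5 := hasSum_levels (summable_slack hlaw.summable t' a)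
    -- Level by level, the slack at `t'` is the expected stopping payoff after `t'` minus that of
    -- `a` at the stopping beliefs after `t'`. By the martingale property the latter sums to the
    -- payoff of `a` at the beliefs of those still waiting, and this is at most the integral of `v*`
    -- that `vStar_stop_sums` bounds.
    have h6 : (fun s => ∑ z ∈ levelSet v s, tail t' Q z * z.gain t' a) = fun s : ℕ =>
        (if t' < s then ∫ ω in {ω | stopFrom v I t ω = s}, vStar v s (ω s).1 ∂P else 0) -
        ∑ θ, (if t' < s then ∫ ω in {ω | stopFrom v I t ω = s}, (ω s).1 θ ∂P else 0) *
          v a θ t' := by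
      ext s
      by_cases hs : t' < s
      · simp only [if_pos hs]
        rw [← hlevV, ← setIntegral_expUtil, ← sum_split_expUtil (hlevB · s),
          ← Finset.sum_sub_distrib]
        refine Finset.sum_congr rfl fun z hz => ?_
        rw [tail, if_pos (by rwa [mem_levelSet.1 hz]), ExtPoint.gain, mul_sub]
      · simp only [if_neg hs, zero_mul, Finset.sum_const_zero, sub_zero]
        refine Finset.sum_eq_zero fun z hz => ?_
        rw [tail, if_neg (by rwa [mem_levelSet.1 hz]), zero_mul]
    rw [h6] at h5
    have h7 := (hVsums t' ht').1.hasSum.sub (hasSum_sum (s := Finset.univ) fun θ _ =>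
      (hasSum_belief_stop impatience I hB hB0 hfin ht' θ).mul_right (v a θ t'))
    have h8 : slack t' a Q = _ := h5.unique h7
    rw [h8, ← setIntegral_expUtil, sub_nonneg]
    refine le_trans ?_ (hVsums t' ht').2
    exact setIntegral_mono (integrable_expUtil_coord P t' t' a).integrableOn
      (integrable_vStar_path P t' t').integrableOn fun ω => expUtil_le_vStar v t' _ a
  · have h5 := hasSum_levels (summable_mul_vStar hlaw.summable)
    simp only [hlevV] at h5
    rw [h5.unique hVsum, integral_eq_stop_add_wait impatience I (t := t)
      (integrable_vStar_path P t t)]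
    exact add_le_add_right (hVsums t le_rfl).2 _
  · rw [outcomeDist_eq_ofReal]
    have hd0 : ∀ x : A × ℕ, 0 ≤ ∫ ω in {ω | stopFrom v I t ω = x.2}, γ.rule x.2 (ω x.2).1 x.1 ∂P :=
      fun x => integral_nonneg fun ω => stdSimplex.zero_le _ _
    have hlevP : ∀ (φ : ℝ → ℝ), Monotone φ → ∀ s : ℕ,
        ∑ a, (∫ ω in {ω | stopFrom v I t ω = s}, γ.rule s (ω s).1 a ∂P) * φ (f a s) ≤
          ∑ z ∈ levelSet v s, Q z * φ (indirectPayoff v f z.belief z.level) := by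
      intro φ hφ s
      rw [hlev (fun z s => φ (indirectPayoff v f z.belief s)) s]
      exact h4 s γ f φ hφ
    refine expPayoff_le f hd0 ?_ fun hs => ?_
    · refine summable_prod_of_sums (fun x => mul_nonneg (hd0 x) (le_max_right _ _)) ?_
      -- The positive part of the original payoff is dominated by that of the law: the monotone map
      -- is first `x ↦ max x 0`, for summability, and then the identity, for the bound.
      have h5 : Summable fun z => Q z * max (indirectPayoff v f z.belief z.level) 0 :=
        Summable.of_norm_bounded hf.abs fun z => by
          rw [Real.norm_eq_abs, abs_mul, abs_mul]
          refine mul_le_mul_of_nonneg_left ?_ (abs_nonneg _)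
          rw [abs_of_nonneg (le_max_right _ _)]
          exact max_le (le_abs_self _) (abs_nonneg _)
      refine Summable.of_nonneg_of_le (fun s => Finset.sum_nonneg fun a _ =>
        mul_nonneg (hd0 (a, s)) (le_max_right _ _)) (fun s => ?_) (hasSum_levels h5).summable
      exact hlevP (fun x => max x 0) (monotone_id.max monotone_const) s
    · refine hasSum_le (fun s => ?_) (tsum_prod_sums hs) (hasSum_levels hf)
      exact hlevP (fun x => x) monotone_id s

end

/-! ### From laws to information structures. -/

section

variable [Nonempty A] {v : A → Θ → ℕ → ℝ}

/-! ### Barycenters -/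

open Classical in
/-- The barycenter of the law `Q` (and `μ₀` if `Q` is zero). -/
def barycenter (μ₀ : Belief Θ) (Q : ExtPoint v → ℝ) : Belief Θ :=
  if h : (fun θ => (∑' z, Q z)⁻¹ * ∑' z, Q z * z.belief θ) ∈ stdSimplex ℝ Θ then ⟨_, h⟩ else μ₀

lemma sum_tsum_mul_belief {Q : ExtPoint v → ℝ} (hQ : IsLaw Q) :
    ∑ θ, ∑' z, Q z * z.belief θ = ∑' z, Q z := by
  rw [← Summable.tsum_finsetSum fun θ _ => summable_mul_belief hQ.summable θ]
  refine tsum_congr fun z => ?_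
  rw [← Finset.mul_sum, stdSimplex.sum_eq_one, mul_one]

/-- Kept in multiplied form so that the zero law, whose barycenter is an arbitrary default, is no
exception. -/
lemma tsum_mul_barycenter (μ₀ : Belief Θ) {Q : ExtPoint v → ℝ} (hQ : IsLaw Q) (θ : Θ) :
    (∑' z, Q z) * barycenter μ₀ Q θ = ∑' z, Q z * z.belief θ := by
  by_cases h0 : ∑' z, Q z = 0
  · have hz : Q = 0 := by
      have := (hasSum_zero_iff_of_nonneg hQ.nonneg).1 (h0 ▸ (summable_of_weight hQ.summable).hasSum)
      exact this
    simp [hz]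
  · have h : (fun θ => (∑' z, Q z)⁻¹ * ∑' z, Q z * z.belief θ) ∈ stdSimplex ℝ Θ := by
      refine ⟨fun θ => mul_nonneg (inv_nonneg.2 (tsum_nonneg hQ.nonneg))
        (tsum_nonneg fun z => mul_nonneg (hQ.nonneg z) (stdSimplex.zero_le _ _)), ?_⟩
      rw [← Finset.mul_sum, sum_tsum_mul_belief hQ, inv_mul_cancel₀ h0]
    have : barycenter μ₀ Q θ = (∑' z, Q z)⁻¹ * ∑' z, Q z * z.belief θ := by
      rw [barycenter, dif_pos h]
      rfl
    rw [this, mul_inv_cancel_left₀ h0]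

lemma tsum_mul_expUtil {Q : ExtPoint v → ℝ} (hQ : IsLaw Q) {c : ℝ} {μ : Belief Θ}
    (h : ∀ θ, ∑' z, Q z * z.belief θ = c * μ θ) (t : ℕ) (a : A) :
    ∑' z, Q z * expUtil v t z.belief a = c * expUtil v t μ a := by
  have h1 : ∑' z, Q z * expUtil v t z.belief a = ∑ θ, (∑' z, Q z * z.belief θ) * v a θ t := by
    simp only [← tsum_mul_right]
    rw [← Summable.tsum_finsetSum fun θ _ => (summable_mul_belief hQ.summable θ).mul_right _]
    refine tsum_congr fun z => ?_
    simp only [expUtil, Finset.mul_sum, mul_assoc]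
  rw [h1, expUtil, Finset.mul_sum]
  exact Finset.sum_congr rfl fun θ _ => by rw [h, mul_assoc]

lemma slack_eq_sub {Q : ExtPoint v → ℝ} (hQ : IsLaw Q) {t : ℕ} (hsupp : ∀ z, Q z ≠ 0 → t < z.level)
    {c : ℝ} {μ : Belief Θ} (h : ∀ θ, ∑' z, Q z * z.belief θ = c * μ θ) (a : A) :
    slack t a Q = ∑' z, Q z * vStar v z.level z.belief - c * expUtil v t μ a := by
  rw [slack, tail_eq_self hsupp, ← tsum_mul_expUtil hQ h t a,
    ← (summable_mul_vStar hQ.summable).tsum_sub (summable_mul_expUtil hQ.summable t a)]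
  simp only [ExtPoint.gain, mul_sub]

/-! ### Trees of laws -/

/-- A law together with a rule that says how the laws of later stopping beliefs and times are split
up as time passes. -/
structure Tree (v : A → Θ → ℕ → ℝ) (μ₀ : Belief Θ) where
  root : ExtPoint v → ℝ
  isLaw : IsLaw root
  support : ∀ z, root z ≠ 0 → 0 < z.level
  obedient : Obedient 0 root
  bary : ∀ θ, HasSum (fun z => root z * z.belief θ) (μ₀ θ)
  split : ℕ → (ExtPoint v → ℝ) → ℕ → ExtPoint v → ℝ
  splits : ∀ t Q, IsLaw Q → (∀ z, Q z ≠ 0 → t < z.level) → Obedient t Q → Splits t Q (split t Q)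

namespace Tree

variable (T : Tree v μ₀)

/-- The law after the messages `σ 1, …, σ t`. -/
def node : ℕ → (ℕ → ℕ) → ExtPoint v → ℝ
  | 0, _ => T.root
  | t + 1, σ => T.split (t + 1) (tail (t + 1) (node t σ)) (σ (t + 1))

lemma node_spec (t : ℕ) (σ : ℕ → ℕ) : IsLaw (T.node t σ) ∧
    (∀ z, T.node t σ z ≠ 0 → t < z.level) ∧ Obedient t (T.node t σ) := by
  induction t with
  | zero => exact ⟨T.isLaw, T.support, T.obedient⟩
  | succ t ih =>
    have hsupp : ∀ z, tail (t + 1) (T.node t σ) z ≠ 0 → t + 1 < z.level := fun z hz => by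
      by_contra h
      exact hz (if_neg h)
    have h := T.splits (t + 1) _ (ih.1.tail (t + 1)) hsupp (ih.2.2.tail (Nat.le_succ t))
    refine ⟨h.isLaw _, fun z hz => hsupp z fun h0 => hz ?_, h.obedient _⟩
    exact le_antisymm ((h.le _ z).trans h0.le) ((h.isLaw _).nonneg z)

lemma node_splits (t : ℕ) (σ : ℕ → ℕ) : Splits (t + 1) (tail (t + 1) (T.node t σ))
    (T.split (t + 1) (tail (t + 1) (T.node t σ))) :=
  T.splits (t + 1) _ ((T.node_spec t σ).1.tail (t + 1)) (fun z hz => by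
    by_contra h
    exact hz (if_neg h)) ((T.node_spec t σ).2.2.tail (Nat.le_succ t))

lemma node_nonneg (t : ℕ) (σ : ℕ → ℕ) (z : ExtPoint v) : 0 ≤ T.node t σ z :=
  (T.node_spec t σ).1.nonneg z

lemma node_le_root (t : ℕ) (σ : ℕ → ℕ) (z : ExtPoint v) : T.node t σ z ≤ T.root z := by
  induction t with
  | zero => exact le_rfl
  | succ t ih =>
    refine ((T.node_splits t σ).le _ z).trans (le_trans ?_ ih)
    unfold tail
    split_ifs
    exacts [le_rfl, T.node_nonneg t σ z]

lemma node_congr {t : ℕ} {σ σ' : ℕ → ℕ} (h : ∀ u ≤ t, σ u = σ' u) : T.node t σ = T.node t σ' := by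
  induction t with
  | zero => rfl
  | succ t ih => simp only [node, ih fun u hu => h u (hu.trans (Nat.le_succ t)), h (t + 1) le_rfl]

/-- What is left of the root law if a node is removed is still obedient. -/
lemma obedient_root_sub_node (t : ℕ) (σ : ℕ → ℕ) :
    Obedient t (T.root - T.node t σ) := by
  induction t with
  | zero => simpa [node] using Obedient.zero 0
  | succ t ih =>
    intro t' ht' a
    -- Removing the child instead of its parent leaves in addition the sibling laws, which are
    -- obedient, and the part of the parent that stops at `t + 1`, which has no slack from then on.
    have h : 0 ≤ slack t' a (tail (t + 1) (T.node t σ) - T.node (t + 1) σ) :=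
      (T.node_splits t σ).obedient_sub ((T.node_spec t σ).1.tail (t + 1)) (σ (t + 1)) t' ht' a
    have h' := ih t' (by omega) a
    have s1 := (T.node_spec t σ).1.summable
    have s2 := (T.node_spec (t + 1) σ).1.summable
    rw [slack_sub t' a (summable_tail s1 _) s2, slack_tail ht'] at h
    rw [slack_sub t' a T.isLaw.summable s1] at h'
    rw [slack_sub t' a T.isLaw.summable s2]
    linarith

/-- Complete histories: a sequence of messages and an extremal belief and time of stopping. -/
abbrev Leaf (v : A → Θ → ℕ → ℝ) : Type _ := (ℕ →₀ ℕ) × ExtPoint v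

/-- Messages are recorded only for times before stopping. -/
def Valid (l : Leaf v) : Prop := 0 < l.2.level ∧ ∀ u, u = 0 ∨ l.2.level ≤ u → l.1 u = 0

open Classical in
/-- The probability of a complete history. -/
def mass (l : Leaf v) : ℝ := if Valid l then T.node (l.2.level - 1) l.1 l.2 else 0

lemma mass_nonneg (l : Leaf v) : 0 ≤ T.mass l := by
  unfold mass
  split_ifs
  exacts [T.node_nonneg _ _ _, le_rfl]

lemma valid_of_mass {l : Leaf v} (h : T.mass l ≠ 0) : Valid l := by
  by_contra h'
  exact h (if_neg h')

lemma hasSum_of_tsum_ofReal {ι : Type*} {g : ι → ℝ} {c : ℝ} (hg : ∀ i, 0 ≤ g i) (hc : 0 ≤ c)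
    (h : ∑' i, ENNReal.ofReal (g i) = ENNReal.ofReal c) : HasSum g c := by
  have hs : Summable g := by
    have := ENNReal.summable_toReal (h ▸ ENNReal.ofReal_ne_top)
    exact this.congr fun i => (ENNReal.toReal_ofReal (hg i))
  rw [← ENNReal.ofReal_tsum_of_nonneg hg hs, ENNReal.ofReal_eq_ofReal_iff (tsum_nonneg hg) hc] at h
  exact h ▸ hs.hasSum

open Classical in
-- The probability that a node gives to `z` is the total over all message sequences that continue
-- its own. The induction is on the number of further splits before stopping at `z`: the pieces of
-- each split sum back to the tail of their parent. With no split left, validity forces the sequence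
-- to be zero after `t`, so one term survives.
lemma tsum_mass_node {z : ExtPoint v} (k : ℕ) : ∀ {t : ℕ}, t + k + 1 = z.level →
    ∀ σ : ℕ →₀ ℕ, σ 0 = 0 → ∑' σ' : ℕ →₀ ℕ, (if ∀ u ≤ t, σ' u = σ u then
      ENNReal.ofReal (T.mass (σ', z)) else 0) = ENNReal.ofReal (T.node t σ z) := by
  induction k with
  | zero =>
    intro t ht σ h0
    have hagree : ∀ u ≤ t, σ.filter (· ≤ t) u = σ u := fun u hu =>
      Finsupp.filter_apply_pos (· ≤ t) _ hu
    have hout : ∀ u, ¬ u ≤ t → σ.filter (· ≤ t) u = 0 := fun u hu =>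
      Finsupp.filter_apply_neg (· ≤ t) _ hu
    have hval : Valid (σ.filter (· ≤ t), z) := by
      refine ⟨by simp only; omega, fun u hu => ?_⟩
      rcases hu with rfl | hu
      · exact (hagree 0 (Nat.zero_le t)).trans h0
      · exact hout u (by simp only at hu; omega)
    rw [tsum_eq_single (σ.filter (· ≤ t)), if_pos hagree, mass, if_pos hval]
    · simp only
      rw [show z.level - 1 = t by omega, T.node_congr hagree]
    · intro σ' hne
      split_ifs with hag
      swap
      · rfl
      rw [ENNReal.ofReal_eq_zero, mass, if_neg]
      rintro ⟨-, hv⟩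
      refine hne (Finsupp.ext fun u => ?_)
      by_cases hu : u ≤ t
      · rw [hagree u hu, hag u hu]
      · rw [hout u hu]
        exact hv u (Or.inr (by simp only; omega))
  | succ k ih =>
    intro t ht σ h0
    have hstep : ∀ i, ∑' σ' : ℕ →₀ ℕ, (if ∀ u ≤ t + 1, σ' u = σ.update (t + 1) i u then
        ENNReal.ofReal (T.mass (σ', z)) else 0) =
        ENNReal.ofReal (T.split (t + 1) (tail (t + 1) (T.node t σ)) i z) := by
      intro i
      rw [ih (by omega) (σ.update (t + 1) i) (by simp [h0])]
      have hcongr : T.node t (σ.update (t + 1) i) = T.node t σ := T.node_congr fun u hu => by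
        simp only [Finsupp.coe_update]
        rw [Function.update_of_ne (by omega)]
      simp only [node, hcongr]
      simp
    have hiff : ∀ (σ' : ℕ →₀ ℕ) (i : ℕ), (∀ u ≤ t + 1, σ' u = σ.update (t + 1) i u) ↔
        ((∀ u ≤ t, σ' u = σ u) ∧ σ' (t + 1) = i) := by
      intro σ' i
      simp only [Finsupp.coe_update]
      constructor
      · intro h
        refine ⟨fun u hu => ?_, ?_⟩
        · rw [h u (by omega), Function.update_of_ne (by omega)]
        · rw [h (t + 1) le_rfl, Function.update_self]
      · rintro ⟨h, h'⟩ u hu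
        rcases hu.eq_or_lt with rfl | hlt
        · rw [h', Function.update_self]
        · rw [Function.update_of_ne (by omega), h u (by omega)]
    have hsum := (T.node_splits t σ).hasSum z
    have hD : ∑' i, ENNReal.ofReal (T.split (t + 1) (tail (t + 1) (T.node t σ)) i z) =
        ENNReal.ofReal (T.node t σ z) := by
      rw [← ENNReal.ofReal_tsum_of_nonneg (fun i => ((T.node_splits t σ).isLaw i).nonneg z)
        hsum.summable, hsum.tsum_eq, tail, if_pos (by omega)]
    rw [← hD, ← tsum_congr hstep, ENNReal.tsum_comm]
    refine tsum_congr fun σ' => ?_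
    simp only [hiff]
    rw [tsum_eq_single (σ' (t + 1))]
    · simp
    · intro i hi
      rw [if_neg fun h => hi h.2.symm]

/-- The message sent at a continuation. -/
def code (i : ℕ) : ℝ := if i = 0 then 0 else i + 1

lemma code_ne_one (i : ℕ) : code i ≠ 1 := by
  unfold code
  split_ifs with h
  · exact zero_ne_one
  · simpa using h

lemma code_injective : Function.Injective code := by
  intro i j h
  unfold code at h
  split_ifs at h with hi hj hj
  · rw [hi, hj]
  · have : (0 : ℝ) ≤ j := Nat.cast_nonneg j
    linarith
  · have : (0 : ℝ) ≤ i := Nat.cast_nonneg i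
    linarith
  · exact_mod_cast add_right_cancel h

/-- The path of beliefs and messages along a complete history. -/
def path (l : Leaf v) : Path Θ := fun u =>
  if u < l.2.level then (barycenter μ₀ (T.node u l.1), code (l.1 u)) else (l.2.belief, 1)

lemma path_of_lt {l : Leaf v} {u : ℕ} (h : u < l.2.level) :
    T.path l u = (barycenter μ₀ (T.node u l.1), code (l.1 u)) := if_pos h

lemma path_of_le {l : Leaf v} {u : ℕ} (h : l.2.level ≤ u) : T.path l u = (l.2.belief, 1) :=
  if_neg h.not_gt

lemma message_eq_one_iff {l : Leaf v} {u : ℕ} : (T.path l u).2 = 1 ↔ l.2.level ≤ u := by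
  rcases lt_or_ge u l.2.level with h | h
  · rw [T.path_of_lt h]
    simp [code_ne_one, h]
  · rw [T.path_of_le h]
    simp [h]

/-- Codes are injective and never equal the stop message `1`, so an unfinished history records
exactly the messages so far; the beliefs are functions of these. -/
lemma history_eq_iff_of_lt {l l' : Leaf v} {t : ℕ} (h : t < l.2.level) :
    (∀ u ≤ t, T.path l' u = T.path l u) ↔ t < l'.2.level ∧ ∀ u ≤ t, l'.1 u = l.1 u := by
  constructor
  · intro heq
    have hlt : ∀ u ≤ t, u < l'.2.level := fun u hu => by
      by_contra hle
      have := T.message_eq_one_iff.2 (not_lt.1 hle)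
      rw [heq u hu, T.message_eq_one_iff] at this
      omega
    refine ⟨hlt t le_rfl, fun u hu => code_injective ?_⟩
    have := congrArg Prod.snd (heq u hu)
    rwa [T.path_of_lt (hlt u hu), T.path_of_lt (by omega)] at this
  · rintro ⟨h', hag⟩ u hu
    rw [T.path_of_lt (by omega), T.path_of_lt (by omega), hag u hu,
      T.node_congr fun w hw => hag w (hw.trans hu)]

/-- Once the stop message has appeared, the path shows the stopping pair and all earlier messages.
Validity fixes the messages from then on, so nothing else distinguishes two leaves. -/
lemma history_eq_iff_of_le {l l' : Leaf v} {t : ℕ} (h : l.2.level ≤ t) (hl : Valid l)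
    (hl' : Valid l') : (∀ u ≤ t, T.path l' u = T.path l u) ↔ l' = l := by
  constructor
  · intro heq
    have h1 : l'.2.level ≤ l.2.level := by
      rw [← T.message_eq_one_iff, heq _ h, T.message_eq_one_iff]
    have h2 : l.2.level ≤ l'.2.level := by
      rw [← T.message_eq_one_iff (l := l), ← heq _ (h1.trans h), T.message_eq_one_iff]
    have hlev := le_antisymm h1 h2
    have hz : l'.2 = l.2 := by
      refine ExtPoint.ext' ?_ hlev
      have := congrArg Prod.fst (heq _ h)
      rwa [T.path_of_le h1, T.path_of_le le_rfl] at this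
    refine Prod.ext (Finsupp.ext fun u => ?_) hz
    by_cases hu : u < l.2.level
    · have := congrArg Prod.snd (heq u (by omega))
      rw [T.path_of_lt (by omega), T.path_of_lt hu] at this
      exact code_injective this
    · rw [hl.2 u (Or.inr (by omega)), hl'.2 u (Or.inr (by omega))]
  · rintro rfl u _
    rfl

open Classical in
/-- The law of the stopping belief and the stopping time after the time-`t` history of `l`. -/
def lawAt (t : ℕ) (l : Leaf v) : ExtPoint v → ℝ :=
  if t < l.2.level then T.node t l.1 else Pi.single l.2 (T.mass l)

lemma mass_le_node {l : Leaf v} (hl : T.mass l ≠ 0) {t : ℕ} (h : t < l.2.level) :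
    T.mass l ≤ T.node t l.1 l.2 := by
  classical
  have h1 := T.tsum_mass_node (z := l.2) (l.2.level - 1 - t) (t := t) (by omega) l.1
    ((T.valid_of_mass hl).2 0 (Or.inl rfl))
  have h2 := ENNReal.le_tsum (f := fun σ' : ℕ →₀ ℕ => if ∀ u ≤ t, σ' u = l.1 u then
      ENNReal.ofReal (T.mass (σ', l.2)) else 0) l.1
  simp only [implies_true, if_true, h1] at h2
  exact (ENNReal.ofReal_le_ofReal_iff (T.node_nonneg _ _ _)).1 h2

lemma mass_le_root {l : Leaf v} : T.mass l ≤ T.root l.2 := by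
  unfold mass
  split_ifs
  exacts [T.node_le_root _ _ _, T.isLaw.nonneg _]

lemma lawAt_nonneg (t : ℕ) (l : Leaf v) (z : ExtPoint v) : 0 ≤ T.lawAt t l z := by
  unfold lawAt
  split_ifs
  · exact T.node_nonneg _ _ _
  · rw [Pi.single_apply]
    split_ifs
    exacts [T.mass_nonneg l, le_rfl]

lemma lawAt_le_root (t : ℕ) (l : Leaf v) (z : ExtPoint v) : T.lawAt t l z ≤ T.root z := by
  unfold lawAt
  split_ifs
  · exact T.node_le_root _ _ _
  · rw [Pi.single_apply]
    split_ifs with h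
    exacts [h ▸ T.mass_le_root, T.isLaw.nonneg _]

lemma isLaw_lawAt (t : ℕ) (l : Leaf v) : IsLaw (T.lawAt t l) :=
  T.isLaw.mono (T.lawAt_nonneg t l) (T.lawAt_le_root t l)

lemma mass_le_lawAt {l : Leaf v} (hl : T.mass l ≠ 0) (t : ℕ) : T.mass l ≤ T.lawAt t l l.2 := by
  unfold lawAt
  split_ifs with h
  · exact T.mass_le_node hl h
  · rw [Pi.single_eq_same]

lemma tsum_lawAt_pos {l : Leaf v} (hl : T.mass l ≠ 0) (t : ℕ) : 0 < ∑' z, T.lawAt t l z :=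
  (((T.mass_nonneg l).lt_of_ne' hl).trans_le (T.mass_le_lawAt hl t)).trans_le
    ((summable_of_weight (T.isLaw_lawAt t l).summable).le_tsum l.2
      fun z _ => T.lawAt_nonneg t l z)

lemma tsum_lawAt_mul_belief (t : ℕ) (l : Leaf v) (θ : Θ) :
    (∑' z, T.lawAt t l z) * (T.path l t).1 θ = ∑' z, T.lawAt t l z * z.belief θ := by
  unfold lawAt
  split_ifs with h
  · rw [T.path_of_lt h]
    exact tsum_mul_barycenter μ₀ (T.node_spec t l.1).1 θ
  · rw [T.path_of_le (not_lt.1 h), tsum_eq_single l.2 fun z hz => Pi.single_eq_of_ne hz _,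
      tsum_eq_single l.2 fun z hz => by rw [Pi.single_eq_of_ne hz, zero_mul]]

lemma lt_level_of_lawAt {t : ℕ} {l : Leaf v} (h : t < l.2.level) {z : ExtPoint v}
    (hz : T.lawAt t l z ≠ 0) : t < z.level := by
  rw [lawAt, if_pos h] at hz
  exact (T.node_spec t l.1).2.1 z hz

lemma eq_of_lawAt {t : ℕ} {l : Leaf v} (h : l.2.level ≤ t) {z : ExtPoint v}
    (hz : T.lawAt t l z ≠ 0) : z = l.2 := by
  rw [lawAt, if_neg h.not_gt] at hz
  by_contra hne
  exact hz (Pi.single_eq_of_ne hne _)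

open Classical in
-- This identifies `lawAt` as the unnormalized conditional law of the stopping pair given the
-- history. Before stopping it is `tsum_mass_node`; afterwards the history determines the leaf.
lemma hasSum_mass_history {l : Leaf v} (hl : T.mass l ≠ 0) (t : ℕ) (z : ExtPoint v) :
    HasSum (fun σ : ℕ →₀ ℕ => if ∀ u ≤ t, T.path (σ, z) u = T.path l u then T.mass (σ, z) else 0)
      (T.lawAt t l z) := by
  have hval := T.valid_of_mass hl
  rcases lt_or_ge t l.2.level with h | h
  · rw [lawAt, if_pos h]
    simp only [T.history_eq_iff_of_lt h]
    by_cases hz : t < z.level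
    · simp only [hz, true_and]
      refine hasSum_of_tsum_ofReal (fun σ => ?_) (T.node_nonneg _ _ _) ?_
      · split_ifs
        exacts [T.mass_nonneg _, le_rfl]
      · rw [← T.tsum_mass_node (z := z) (z.level - 1 - t) (t := t) (by omega) l.1
          (hval.2 0 (Or.inl rfl))]
        refine tsum_congr fun σ => ?_
        split_ifs <;> simp
    · have : T.node t l.1 z = 0 := by
        by_contra hne
        exact hz ((T.node_spec t l.1).2.1 z hne)
      simp only [hz, false_and, if_false, this]
      exact hasSum_zero
  · rw [lawAt, if_neg h.not_gt]
    have hterm : ∀ σ : ℕ →₀ ℕ, (if ∀ u ≤ t, T.path (σ, z) u = T.path l u then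
        T.mass (σ, z) else 0) = if (σ, z) = l then T.mass l else 0 := by
      intro σ
      by_cases hσ : T.mass (σ, z) = 0
      · rw [hσ]
        split_ifs with h1 h2 h2
        · exact (hl (h2 ▸ hσ)).elim
        · rfl
        · exact (hl (h2 ▸ hσ)).elim
        · rfl
      · rw [if_congr (T.history_eq_iff_of_le h hval (T.valid_of_mass hσ)) rfl rfl]
        split_ifs with h1
        · rw [h1]
        · rfl
    simp only [hterm]
    by_cases hz : z = l.2
    · subst hz
      rw [Pi.single_eq_same]
      refine (hasSum_ite_eq l.1 (T.mass l)).congr_fun fun σ => ?_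
      congr 1
      simp [Prod.ext_iff]
    · rw [Pi.single_eq_of_ne hz]
      refine hasSum_zero.congr_fun fun σ => ?_
      exact if_neg fun h => hz (congrArg Prod.snd h)

end Tree

end

section

variable [Nonempty A] {v : A → Θ → ℕ → ℝ}

/-! ### The information structure of a tree -/

/-- A function of the time-`t` history is constant on the paths that share it, so at a history of
positive probability a conditional expectation is a plain average. -/
lemma condExp_mul_measureReal_historyEvent {P : Measure (Path Θ)} [IsProbabilityMeasure P]
    {g : Path Θ → ℝ} (hg : Integrable g P) (t : ℕ) (ω : Path Θ) :
    (P[g | hist Θ t]) ω * P.real (historyEvent t ω) = ∫ ω' in historyEvent t ω, g ω' ∂P := by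
  have hE := measurableSet_historyEvent t ω
  rw [← setIntegral_condExp ((hist Θ).le t) hg hE,
    setIntegral_congr_fun (g := fun _ => (P[g | hist Θ t]) ω) ((hist Θ).le t _ hE) fun ω' hω' =>
      eq_of_history stronglyMeasurable_condExp.measurable hω']
  simp [mul_comm]

namespace Tree

variable (T : Tree v μ₀)

/-- The distribution over paths. -/
def measure : Measure (Path Θ) :=
  Measure.sum fun l : Leaf v => ENNReal.ofReal (T.mass l) • Measure.dirac (T.path l)

lemma ae_measure_iff {p : Path Θ → Prop} :
    (∀ᵐ ω ∂T.measure, p ω) ↔ ∀ l, T.mass l ≠ 0 → p (T.path l) := by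
  rw [measure, Measure.ae_sum_iff]
  refine forall_congr' fun l => ?_
  by_cases hl : T.mass l = 0
  · simp [hl]
  · have : ENNReal.ofReal (T.mass l) ≠ 0 := by
      rw [Ne, ENNReal.ofReal_eq_zero, not_le]
      exact (T.mass_nonneg l).lt_of_ne' hl
    rw [Measure.ae_ennreal_smul_measure_iff this, ae_dirac_eq]
    simp [hl]

lemma lintegral_measure (g : Path Θ → ℝ≥0∞) :
    ∫⁻ ω, g ω ∂T.measure = ∑' l, ENNReal.ofReal (T.mass l) * g (T.path l) := by
  rw [measure, lintegral_sum_measure]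
  refine tsum_congr fun l => ?_
  rw [lintegral_smul_measure, lintegral_dirac, smul_eq_mul]

lemma tsum_ofReal_mass (z : ExtPoint v) :
    ∑' σ : ℕ →₀ ℕ, ENNReal.ofReal (T.mass (σ, z)) = ENNReal.ofReal (T.root z) := by
  classical
  by_cases hz : 0 < z.level
  · have := T.tsum_mass_node (z := z) (z.level - 1) (t := 0) (by omega) 0 rfl
    refine Eq.trans (tsum_congr fun σ => ?_) this
    split_ifs with h
    · rfl
    · rw [ENNReal.ofReal_eq_zero, mass, if_neg]
      rintro ⟨-, hv⟩
      refine h fun u hu => ?_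
      rw [Nat.le_zero.1 hu]
      exact hv 0 (Or.inl rfl)
  · have h0 : T.root z = 0 := by
      by_contra h
      exact hz (T.support z h)
    rw [h0, ENNReal.ofReal_zero, ENNReal.tsum_eq_zero]
    intro σ
    rw [ENNReal.ofReal_eq_zero, mass, if_neg fun h => hz h.1]

lemma tsum_mass_mul (φ : ExtPoint v → ℝ≥0∞) :
    ∑' l : Leaf v, ENNReal.ofReal (T.mass l) * φ l.2 = ∑' z, ENNReal.ofReal (T.root z) * φ z := by
  rw [ENNReal.tsum_prod (f := fun σ z => ENNReal.ofReal (T.mass (σ, z)) * φ z), ENNReal.tsum_comm]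
  refine tsum_congr fun z => ?_
  rw [ENNReal.tsum_mul_right, T.tsum_ofReal_mass]

lemma hasSum_root : HasSum T.root 1 := by
  have h := sum_tsum_mul_belief T.isLaw
  rw [Finset.sum_congr rfl fun θ _ => (T.bary θ).tsum_eq, stdSimplex.sum_eq_one] at h
  exact h ▸ (summable_of_weight T.isLaw.summable).hasSum

instance : IsProbabilityMeasure T.measure := by
  refine ⟨?_⟩
  rw [← lintegral_one, T.lintegral_measure, T.tsum_mass_mul fun _ => 1]
  simp only [mul_one]
  rw [← ENNReal.ofReal_tsum_of_nonneg T.isLaw.nonneg T.hasSum_root.summable, T.hasSum_root.tsum_eq,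
    ENNReal.ofReal_one]

lemma integrable_measure {g : Path Θ → ℝ} {C : ℝ}
    (h : ∀ l, T.mass l ≠ 0 → |g (T.path l)| ≤ C * l.2.weight) : Integrable g T.measure := by
  refine ⟨?_, ?_⟩
  · rw [measure, aestronglyMeasurable_sum_measure_iff]
    exact fun l => aestronglyMeasurable_dirac.smul_measure _
  · rw [HasFiniteIntegral, T.lintegral_measure]
    calc ∑' l, ENNReal.ofReal (T.mass l) * ‖g (T.path l)‖ₑ
        ≤ ∑' l : Leaf v, ENNReal.ofReal (T.mass l) * ENNReal.ofReal (C * l.2.weight) := by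
          refine ENNReal.tsum_le_tsum fun l => ?_
          by_cases hl : T.mass l = 0
          · simp [hl]
          · rw [Real.enorm_eq_ofReal_abs]
            gcongr
            exact h l hl
      _ = ∑' z, ENNReal.ofReal (T.root z * (C * z.weight)) := by
          rw [T.tsum_mass_mul fun z => ENNReal.ofReal (C * z.weight)]
          exact tsum_congr fun z => (ENNReal.ofReal_mul (T.isLaw.nonneg z)).symm
      _ < ⊤ := by
          refine lt_top_iff_ne_top.2 (Summable.tsum_ofReal_ne_top ?_)
          simpa only [mul_left_comm] using T.isLaw.summable.mul_left C

/-- Group the leaves through the given history by their stopping pair: on them `g` depends on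
nothing else, and `lawAt` collects the weights. -/
lemma hasSum_setIntegral {l : Leaf v} (hl : T.mass l ≠ 0) (t : ℕ) {g : Path Θ → ℝ}
    (hg : Integrable g T.measure) {φ : ExtPoint v → ℝ}
    (hφ : ∀ l', T.mass l' ≠ 0 → (∀ u ≤ t, T.path l' u = T.path l u) → g (T.path l') = φ l'.2) :
    HasSum (fun z => T.lawAt t l z * φ z)
      (∫ ω in historyEvent t (T.path l), g ω ∂T.measure) := by
  classical
  have hE : MeasurableSet (historyEvent t (T.path l)) :=
    (hist Θ).le t _ (measurableSet_historyEvent t _)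
  rw [← integral_indicator hE]
  have h1 := hasSum_integral_measure (hg.indicator hE)
  have h2 : ∀ l' : Leaf v, ∫ ω, (historyEvent t (T.path l)).indicator g ω
      ∂(ENNReal.ofReal (T.mass l') • Measure.dirac (T.path l')) =
      (if ∀ u ≤ t, T.path l' u = T.path l u then T.mass l' else 0) * φ l'.2 := by
    intro l'
    rw [integral_smul_measure, integral_dirac, ENNReal.toReal_ofReal (T.mass_nonneg l'),
      smul_eq_mul]
    by_cases h0 : T.mass l' = 0
    · simp [h0]
    by_cases hag : ∀ u ≤ t, T.path l' u = T.path l u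
    · rw [if_pos hag, indicator_of_mem (show T.path l' ∈ historyEvent t (T.path l) from hag),
        hφ l' h0 hag]
    · rw [if_neg hag, indicator_of_notMem (show T.path l' ∉ historyEvent t (T.path l) from hag),
        mul_zero, zero_mul]
  simp only [h2] at h1
  have h3 : HasSum (fun p : ExtPoint v × (ℕ →₀ ℕ) =>
      (if ∀ u ≤ t, T.path (p.2, p.1) u = T.path l u then T.mass (p.2, p.1) else 0) * φ p.1)
      (∫ ω, (historyEvent t (T.path l)).indicator g ω ∂T.measure) :=
    (Equiv.prodComm (ExtPoint v) (ℕ →₀ ℕ)).hasSum_iff.2 h1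
  exact h3.prod_fiberwise fun z => (T.hasSum_mass_history hl t z).mul_right (φ z)

lemma measureReal_historyEvent {l : Leaf v} (hl : T.mass l ≠ 0) (t : ℕ) :
    T.measure.real (historyEvent t (T.path l)) = ∑' z, T.lawAt t l z := by
  have := T.hasSum_setIntegral hl t (integrable_const (1 : ℝ)) (φ := fun _ => 1)
    fun _ _ _ => rfl
  simpa using this.tsum_eq.symm

/-- The upper limit recovers the stopping belief as a function of the path. The belief at each time
is its conditional expectation, which yields the martingale property by the tower rule. -/
lemma limsup_path (l : Leaf v) (θ : Θ) :
    Filter.limsup (fun u => (T.path l u).1 θ) Filter.atTop = l.2.belief θ := by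
  have : (fun u => (T.path l u).1 θ) =ᶠ[Filter.atTop] fun _ => l.2.belief θ := by
    filter_upwards [Filter.eventually_ge_atTop l.2.level] with u hu
    rw [T.path_of_le hu]
  rw [Filter.limsup_congr this, Filter.limsup_const]

lemma integrable_limsup (θ : Θ) :
    Integrable (fun ω : Path Θ => Filter.limsup (fun u => (ω u).1 θ) Filter.atTop) T.measure :=
  T.integrable_measure (C := 1) fun l _ => by
    rw [T.limsup_path, abs_of_nonneg (stdSimplex.zero_le _ _), one_mul]
    exact (stdSimplex.le_one _ _).trans l.2.one_le_weight

lemma condExp_limsup (t : ℕ) (θ : Θ) :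
    T.measure[fun ω : Path Θ => Filter.limsup (fun u => (ω u).1 θ) Filter.atTop | hist Θ t]
      =ᵐ[T.measure] fun ω => (ω t).1 θ := by
  refine T.ae_measure_iff.2 fun l hl => ?_
  have h1 := condExp_mul_measureReal_historyEvent (T.integrable_limsup θ) t (T.path l)
  have h2 := T.hasSum_setIntegral hl t (T.integrable_limsup θ) (φ := fun z => z.belief θ)
    fun l' _ _ => T.limsup_path l' θ
  rw [T.measureReal_historyEvent hl, ← h2.tsum_eq, ← T.tsum_lawAt_mul_belief, mul_comm] at h1
  exact mul_left_cancel₀ (T.tsum_lawAt_pos hl t).ne' h1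

lemma barycenter_root : barycenter μ₀ T.root = μ₀ := by
  ext θ
  have := tsum_mul_barycenter μ₀ T.isLaw θ
  rwa [T.hasSum_root.tsum_eq, one_mul, (T.bary θ).tsum_eq] at this

/-- The information structure given by a tree of laws. -/
def info : InfoStructure μ₀ where
  law := T.measure
  isProb := inferInstance
  initial := T.ae_measure_iff.2 fun l hl => by
    have hv := T.valid_of_mass hl
    rw [T.path_of_lt hv.1, hv.2 0 (Or.inl rfl)]
    exact Prod.ext T.barycenter_root (by simp [code])
  martingale t θ :=
    (condExp_congr_ae (T.condExp_limsup (t + 1) θ).symm).trans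
      ((condExp_condExp_of_le ((hist Θ).mono (Nat.le_succ t)) ((hist Θ).le (t + 1))).trans
        (T.condExp_limsup t θ))

/-! ### The decision maker's behaviour -/

section Behaviour

variable (impatience : ∀ a θ t t', t' < t → v a θ t < v a θ t')
include impatience

/-- The belief is frozen after the stop message, so `stopsAt_of_constant` applies. -/
lemma stopsAt {l : Leaf v} (hl : T.mass l ≠ 0) {u : ℕ} (hu : l.2.level ≤ u) :
    StopsAt v T.info u (T.path l) := by
  have hE : MeasurableSet[hist Θ u] {ω : Path Θ | (ω u).2 = 1} :=
    (measurable_snd.comp (measurable_coord (le_refl u))) (measurableSet_singleton (1 : ℝ))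
  have := stopsAt_of_constant impatience T.info hE (T.ae_measure_iff.2 fun l' _ h w hw => by
    have h' := T.message_eq_one_iff.1 h
    rw [T.path_of_le h', T.path_of_le (h'.trans hw)])
  exact T.ae_measure_iff.1 this l hl (T.message_eq_one_iff.2 hu)

omit impatience in
/-- The first time from `t` on at which the message is stop. -/
def stopMessage (t : ℕ) (ω : Path Θ) : WithTop ℕ :=
  ⨅ (s : ℕ) (_ : t ≤ s ∧ (ω s).2 = 1), (s : ℕ∞)

omit impatience [Nonempty A] in
lemma stopMessage_le_iff {t i : ℕ} {ω : Path Θ} :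
    stopMessage t ω ≤ i ↔ ∃ s, s ≤ i ∧ t ≤ s ∧ (ω s).2 = 1 := by
  constructor
  · intro h
    by_contra! hne
    have : ((i + 1 : ℕ) : ℕ∞) ≤ stopMessage t ω := le_iInf₂ fun s hs => by
      rw [Nat.cast_le]
      by_contra hlt
      exact hne s (by omega) hs.1 hs.2
    have h' : ((i + 1 : ℕ) : ℕ∞) ≤ (i : ℕ) := this.trans h
    exact absurd (Nat.cast_le.1 h') (by omega)
  · rintro ⟨s, hsi, hs⟩
    have h1 : stopMessage t ω ≤ (s : ℕ∞) := iInf₂_le s hs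
    have h2 : (s : ℕ∞) ≤ (i : ℕ∞) := Nat.cast_le.2 hsi
    exact h1.trans h2

omit impatience [Nonempty A] in
lemma isStoppingTime_stopMessage (t : ℕ) : IsStoppingTime (hist Θ) (stopMessage (Θ := Θ) t) := by
  intro i
  have : {ω : Path Θ | stopMessage t ω ≤ WithTop.some i} =
      ⋃ s, ⋃ (_ : s ≤ i), ⋃ (_ : t ≤ s), {ω : Path Θ | (ω s).2 = 1} := by
    ext ω
    rw [mem_ofPred_eq]
    refine stopMessage_le_iff.trans ?_
    simp only [mem_iUnion, exists_prop, mem_ofPred_eq]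
  rw [this]
  exact MeasurableSet.iUnion fun s => MeasurableSet.iUnion fun hs => MeasurableSet.iUnion fun _ =>
    (measurable_snd.comp (measurable_coord hs)) (measurableSet_singleton (1 : ℝ))

omit impatience in
lemma stopMessage_path (t : ℕ) (l : Leaf v) :
    stopMessage t (T.path l) = ((max l.2.level t : ℕ) : ℕ∞) := by
  refine le_antisymm ?_ (le_iInf₂ fun s hs => ?_)
  · exact iInf₂_le (max l.2.level t) ⟨le_max_right _ _, T.message_eq_one_iff.2 (le_max_left _ _)⟩
  · exact Nat.cast_le.2 (max_le (T.message_eq_one_iff.1 hs.2) hs.1)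

omit impatience in
lemma payoff_stopMessage (t : ℕ) (l : Leaf v) :
    (Plan.optimalAt v (stopMessage t) (isStoppingTime_stopMessage t)).payoff v (T.path l) =
      vStar v (max l.2.level t) l.2.belief := by
  rw [Plan.payoff_optimalAt, T.stopMessage_path]
  change vStar v (max l.2.level t) (T.path l (max l.2.level t)).1 = _
  rw [T.path_of_le (le_max_left _ _)]

omit impatience in
lemma stopMessage_availableFrom (t : ℕ) :
    (Plan.optimalAt v (stopMessage t) (isStoppingTime_stopMessage t)).AvailableFrom v T.info t := by
  refine ⟨T.ae_measure_iff.2 fun l _ => ?_, ?_⟩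
  · have h : (Plan.optimalAt v (stopMessage t) (isStoppingTime_stopMessage t)).time (T.path l) =
      ((max l.2.level t : ℕ) : ℕ∞) := T.stopMessage_path t l
    rw [h]
    exact ⟨WithTop.coe_le_coe.2 (le_max_right _ _), WithTop.coe_lt_top _⟩
  · refine T.integrable_measure (C := 1 + payoffBound v t) fun l _ => ?_
    rw [T.payoff_stopMessage]
    have h1 := l.2.one_le_weight
    have h2 := payoffBound_nonneg v t
    rcases le_total t l.2.level with h | h
    · rw [max_eq_left h]
      have h3 : |vStar v l.2.level l.2.belief| ≤ l.2.weight := by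
        unfold ExtPoint.weight
        linarith
      nlinarith
    · rw [max_eq_right h]
      have h3 := abs_vStar_le v t l.2.belief
      nlinarith

/-- Acting when the stop message arrives is a plan available from `t + 1`, so the continuation value
is at least its conditional payoff. Obedience of the current node says that this payoff is at least
that of every action now. -/
lemma not_stopsAt {l : Leaf v} (hl : T.mass l ≠ 0) {t : ℕ} (ht : t < l.2.level) :
    ¬ StopsAt v T.info t (T.path l) := by
  have hpos := T.tsum_lawAt_pos hl t
  have hlaw := T.isLaw_lawAt t l
  have hP := T.stopMessage_availableFrom (t + 1)
  set P := Plan.optimalAt v (stopMessage (t + 1)) (isStoppingTime_stopMessage (Θ := Θ) (t + 1))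
  have hPi : Integrable (P.payoff v) T.measure := hP.2
  have hvi : Integrable (value v T.info (t + 1)) T.measure :=
    integrable_value impatience T.info (t + 1)
  have hEm := measurableSet_historyEvent t (T.path l)
  have h1 : contValue v T.info t (T.path l) * ∑' z, T.lawAt t l z =
      ∫ ω in historyEvent t (T.path l), value v T.info (t + 1) ω ∂T.measure := by
    rw [← T.measureReal_historyEvent hl]
    exact condExp_mul_measureReal_historyEvent hvi t _
  have h2 : ∫ ω in historyEvent t (T.path l), P.payoff v ω ∂T.measure ≤
      ∫ ω in historyEvent t (T.path l), value v T.info (t + 1) ω ∂T.measure := by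
    rw [← setIntegral_condExp ((hist Θ).le (t + 1)) hPi
      ((hist Θ).mono (Nat.le_succ t) _ hEm)]
    refine setIntegral_mono_ae integrable_condExp.integrableOn
      hvi.integrableOn ?_
    exact (isValue_value impatience T.info (t + 1)).upper P hP
  have h3 := T.hasSum_setIntegral hl t hPi
    (φ := fun z => vStar v z.level z.belief) fun l' _ hl' => by
      have := ((T.history_eq_iff_of_lt ht).1 hl').1
      rw [T.payoff_stopMessage, max_eq_left (by omega)]
  rw [← h1, ← h3.tsum_eq] at h2
  rw [StopsAt, not_lt]
  refine vStar_le fun a => le_of_mul_le_mul_right (le_trans ?_ h2) hpos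
  have hob : 0 ≤ slack t a (T.lawAt t l) := by
    rw [lawAt, if_pos ht]
    exact (T.node_spec t l.1).2.2 t le_rfl a
  rw [slack_eq_sub hlaw (fun z hz => T.lt_level_of_lawAt ht hz)
    (fun θ => (T.tsum_lawAt_mul_belief t l θ).symm), sub_nonneg, mul_comm] at hob
  exact hob

lemma stopFrom_path {l : Leaf v} (hl : T.mass l ≠ 0) {t : ℕ} (ht : t ≤ l.2.level) :
    stopFrom v T.info t (T.path l) = l.2.level :=
  stopFrom_eq_iff.2 ⟨ht, T.stopsAt impatience hl le_rfl, fun _ _ hu =>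
    T.not_stopsAt impatience hl hu⟩

end Behaviour

end Tree

end

section

variable [Nonempty A] {v : A → Θ → ℕ → ℝ}

/-! ### The outcome under favourable tie-breaking -/

/-- A decision maker who pays attention at time `t` stops at the time and with the belief of `z`. -/
def hitEvent (I : InfoStructure μ₀) (t : ℕ) (z : ExtPoint v) : Set (Path Θ) :=
  {ω | stopFrom v I t ω = z.level ∧ (ω z.level).1 = z.belief}

lemma eq_of_mem_hitEvent {I : InfoStructure μ₀} {t : ℕ} {z z' : ExtPoint v} {ω : Path Θ}
    (h : ω ∈ hitEvent I t z) (h' : ω ∈ hitEvent I t z') : z = z' := by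
  have hl : z.level = z'.level := by
    have := h.1.symm.trans h'.1
    exact_mod_cast this
  exact ExtPoint.ext' (by rw [← h.2, ← h'.2, hl]) hl

lemma pairwise_disjoint_hitEvent (I : InfoStructure μ₀) (t : ℕ) :
    Pairwise (Function.onFun Disjoint fun z : ExtPoint v => hitEvent I t z) :=
  fun _ _ hz => disjoint_left.2 fun _ h h' => hz (eq_of_mem_hitEvent h h')

/-- The level identity is required for all `φ` because it is used twice: with the absolute value for
summability and with the identity for the sum. -/
lemma expPayoff_eq_of_levels {n : ExtPoint v → ℝ} (hn : ∀ z, 0 ≤ n z) {f : A → ℕ → ℝ}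
    {d : A × ℕ → ℝ} (hd : ∀ x, 0 ≤ d x)
    (hf : Summable fun z => n z * indirectPayoff v f z.belief z.level)
    (h : ∀ (φ : ℝ → ℝ) (s : ℕ), ∑ a, d (a, s) * φ (f a s) =
      ∑ z ∈ levelSet v s, n z * φ (indirectPayoff v f z.belief z.level)) :
    expPayoff f (fun x => ENNReal.ofReal (d x)) =
      ((∑' z, n z * indirectPayoff v f z.belief z.level : ℝ) : EReal) := by
  have h1 : Summable fun x : A × ℕ => d x * |f x.1 x.2| := by
    refine summable_prod_of_sums (fun x => mul_nonneg (hd x) (abs_nonneg _)) ?_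
    simp only [h abs]
    refine (hasSum_levels (g := fun z => n z * |indirectPayoff v f z.belief z.level|) ?_).summable
    simpa only [abs_mul, abs_of_nonneg (hn _)] using hf.abs
  have h2 : Summable fun x : A × ℕ => d x * f x.1 x.2 := by
    refine Summable.of_abs ?_
    simpa only [abs_mul, abs_of_nonneg (hd _)] using h1
  rw [expPayoff_eq f hd h2]
  congr 1
  refine (tsum_prod_sums h2).unique ?_
  simpa only [h fun x => x] using hasSum_levels hf

section Behaviour

variable (impatience : ∀ a θ t t', t' < t → v a θ t < v a θ t')
include impatience

lemma measurableSet_hitEvent (I : InfoStructure μ₀) (t : ℕ) (z : ExtPoint v) :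
    MeasurableSet (hitEvent I t z) :=
  ((hist Θ).le _ _ (measurableSet_stopFrom_eq impatience I t z.level)).inter
    (measurable_fst.comp (measurable_pi_apply z.level) (measurableSet_singleton z.belief))

lemma ae_exists_mem_hitEvent (I : InfoStructure μ₀) (t : ℕ) (Q : Measure (Path Θ))
    [IsProbabilityMeasure Q] {n : ExtPoint v → ℝ} (hn : ∀ z, Q.real (hitEvent I t z) = n z)
    (h1 : HasSum n 1) : ∀ᵐ ω ∂Q, ∃ z : ExtPoint v, ω ∈ hitEvent I t z := by
  have hn0 : ∀ z, 0 ≤ n z := fun z => hn z ▸ measureReal_nonneg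
  have : Q (⋃ z : ExtPoint v, hitEvent I t z) = 1 := by
    rw [measure_iUnion (pairwise_disjoint_hitEvent I t) fun z => measurableSet_hitEvent impatience I t z]
    have h2 : ∀ z : ExtPoint v, Q (hitEvent I t z) = ENNReal.ofReal (n z) := fun z => by
      rw [← hn, ofReal_measureReal]
    simp only [h2]
    rw [← ENNReal.ofReal_tsum_of_nonneg hn0 h1.summable, h1.tsum_eq, ENNReal.ofReal_one]
  rw [← prob_compl_eq_zero_iff (MeasurableSet.iUnion fun z =>
    measurableSet_hitEvent impatience I t z)] at this
  filter_upwards [compl_mem_ae_iff.2 this] with ω hω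
  simpa using hω

/-- The measure `Q` is arbitrary so that the formula covers the law of a structure, its conditioning
on a history and the conditional expectation kernel alike. Only the probabilities of the countably
many hit events enter. -/
lemma expPayoff_favourableTieBreak (I : InfoStructure μ₀) (t : ℕ) (Q : Measure (Path Θ))
    [IsProbabilityMeasure Q] (f : A → ℕ → ℝ) {n : ExtPoint v → ℝ}
    (hn : ∀ z, Q.real (hitEvent I t z) = n z) (h1 : HasSum n 1)
    (hs : Summable fun z => n z * indirectPayoff v f z.belief z.level) :
    expPayoff f (outcomeDist v I (favourableTieBreak v f) t Q) =
      ((∑' z, n z * indirectPayoff v f z.belief z.level : ℝ) : EReal) := by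
  classical
  have hn0 : ∀ z, 0 ≤ n z := fun z => hn z ▸ measureReal_nonneg
  have hae := ae_exists_mem_hitEvent impatience I t Q hn h1
  have hd : ∀ (s : ℕ) (a : A), ∫ ω in {ω | stopFrom v I t ω = s},
      (favourableTieBreak v f).rule s (ω s).1 a ∂Q =
      ∑ z ∈ levelSet v s, n z * (favourableTieBreak v f).rule s z.belief a := by
    intro s a
    have hset : ({ω | stopFrom v I t ω = s} : Set (Path Θ)) =ᵐ[Q]
        ⋃ z ∈ levelSet v s, hitEvent I t z := by
      filter_upwards [hae] with ω hω
      refine propext ⟨fun h => ?_, fun h => ?_⟩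
      · obtain ⟨z, hz⟩ := hω
        have hzs : z.level = s := by
          have := hz.1.symm.trans h
          exact_mod_cast this
        exact mem_biUnion (mem_levelSet.2 hzs) hz
      · obtain ⟨z, hz, hω'⟩ := mem_iUnion₂.1 h
        exact mem_levelSet.1 hz ▸ hω'.1
    rw [setIntegral_congr_set hset, integral_biUnion_finset _
      (fun z _ => measurableSet_hitEvent impatience I t z) (fun z _ z' _ h => pairwise_disjoint_hitEvent I t h)
      fun z _ => ((favourableTieBreak v f).integrable_rule Q s a).integrableOn]
    refine Finset.sum_congr rfl fun z hz => ?_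
    rw [setIntegral_congr_fun (g := fun _ => (favourableTieBreak v f).rule s z.belief a)
      (measurableSet_hitEvent impatience I t z) fun ω hω => by
        have := hω.2
        rw [mem_levelSet.1 hz] at this
        simp only [this]]
    simp [hn]
  rw [outcomeDist_eq_ofReal]
  refine expPayoff_eq_of_levels hn0 (fun x => integral_nonneg fun ω => stdSimplex.zero_le _ _) hs
    fun φ s => ?_
  simp only [hd, Finset.sum_mul]
  rw [Finset.sum_comm]
  refine Finset.sum_congr rfl fun z hz => ?_
  simp only [mul_assoc, ← Finset.mul_sum, favourableTieBreak_apply, ite_mul, one_mul, zero_mul,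
    Finset.sum_ite_eq', Finset.mem_univ, if_true]
  rw [apply_bestAction_eq v f, mem_levelSet.1 hz]

end Behaviour

lemma expPayoff_of_stop_zero (I : InfoStructure μ₀) (γ : TieBreak v) (f : A → ℕ → ℝ)
    (Q : Measure (Path Θ)) [IsProbabilityMeasure Q]
    (h : ∀ᵐ ω ∂Q, stopFrom v I 0 ω = 0 ∧ ω 0 = (μ₀, 0)) :
    expPayoff f (outcomeDist v I γ 0 Q) = ((∑ a, γ.rule 0 μ₀ a * f a 0 : ℝ) : EReal) := by
  classical
  have hd : ∀ x : A × ℕ, ∫ ω in {ω | stopFrom v I 0 ω = x.2}, γ.rule x.2 (ω x.2).1 x.1 ∂Q =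
      if x.2 = 0 then γ.rule 0 μ₀ x.1 else 0 := by
    rintro ⟨a, s⟩
    split_ifs with hs
    · obtain rfl : s = 0 := hs
      have hset : ({ω | stopFrom v I 0 ω = ((0 : ℕ) : ℕ∞)} : Set (Path Θ)) =ᵐ[Q] univ := by
        filter_upwards [h] with ω hω
        exact propext ⟨fun _ => trivial, fun _ => hω.1⟩
      rw [setIntegral_congr_set hset, setIntegral_univ,
        integral_congr_ae (g := fun _ => γ.rule 0 μ₀ a)]
      · simp
      · filter_upwards [h] with ω hω
        simp only [hω.2]
    · have hset : ({ω | stopFrom v I 0 ω = (s : ℕ∞)} : Set (Path Θ)) =ᵐ[Q] (∅ : Set _) := by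
        filter_upwards [h] with ω hω
        refine propext ⟨fun h' => ?_, fun h' => h'.elim⟩
        refine hs ?_
        have := h'.symm.trans hω.1
        exact_mod_cast this
      rw [setIntegral_congr_set hset, setIntegral_empty]
  rw [outcomeDist_eq_ofReal]
  simp only [hd]
  have hinj : Function.Injective fun a : A => (a, 0) := fun a b hab => (Prod.ext_iff.1 hab).1
  have hout : ∀ x : A × ℕ, x ∉ range (fun a : A => (a, 0)) →
      (if x.2 = 0 then γ.rule 0 μ₀ x.1 else 0) * f x.1 x.2 = 0 := by
    rintro ⟨a, s⟩ hx
    rw [if_neg, zero_mul]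
    rintro rfl
    exact hx ⟨a, rfl⟩
  have hsum : HasSum (fun x : A × ℕ => (if x.2 = 0 then γ.rule 0 μ₀ x.1 else 0) * f x.1 x.2)
      (∑ a, γ.rule 0 μ₀ a * f a 0) := by
    rw [← hinj.hasSum_iff hout]
    simpa [Function.comp_def] using
      hasSum_fintype fun a => γ.rule 0 μ₀ a * f a 0
  rw [expPayoff_eq f (fun x => by split_ifs; exacts [stdSimplex.zero_le _ _, le_rfl])
    hsum.summable, hsum.tsum_eq]

lemma TieBreak.sum_rule_mul_le (γ : TieBreak v) (f : A → ℕ → ℝ) (t : ℕ) (μ : Belief Θ) :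
    ∑ a, γ.rule t μ a * f a t ≤ indirectPayoff v f μ t := by
  calc ∑ a, γ.rule t μ a * f a t ≤ ∑ a, γ.rule t μ a * indirectPayoff v f μ t := by
        refine Finset.sum_le_sum fun a _ => ?_
        rcases (stdSimplex.zero_le (γ.rule t μ) a).eq_or_lt with h | h
        · simp [← h]
        · exact mul_le_mul_of_nonneg_left (le_indirectPayoff f (γ.proper t μ a h)) h.le
    _ = _ := by rw [← Finset.sum_mul, stdSimplex.sum_eq_one, one_mul]

lemma sum_favourableTieBreak_mul (f : A → ℕ → ℝ) (t : ℕ) (μ : Belief Θ) :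
    ∑ a, (favourableTieBreak v f).rule t μ a * f a t = indirectPayoff v f μ t := by
  classical
  simp only [favourableTieBreak_apply, ite_mul, one_mul, zero_mul, Finset.sum_ite_eq',
    Finset.mem_univ, if_true, apply_bestAction_eq]

/-! ### The outcome of a tree -/

lemma historyEvent_zero_ae_eq_univ (I : InfoStructure μ₀) {ω : Path Θ} (hω : ω 0 = (μ₀, 0)) :
    historyEvent 0 ω =ᵐ[I.law] (univ : Set (Path Θ)) := by
  filter_upwards [I.initial] with ω' hω'
  refine propext ⟨fun _ => trivial, fun _ s hs => ?_⟩
  rw [Nat.le_zero.1 hs, hω, hω']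

lemma cond_historyEvent_zero (I : InfoStructure μ₀) {ω : Path Θ} (hω : ω 0 = (μ₀, 0)) :
    I.law[|historyEvent 0 ω] = I.law := by
  have h := historyEvent_zero_ae_eq_univ I hω
  rw [cond_eq_smul_restrict, Measure.restrict_congr_set h, measure_congr h]
  simp

lemma ae_cond {P : Measure (Path Θ)} {B : Set (Path Θ)} (hB : MeasurableSet B)
    {p : Path Θ → Prop} (h : ∀ᵐ ω ∂P, ω ∈ B → p ω) : ∀ᵐ ω ∂P[|B], p ω := by
  rw [cond_eq_smul_restrict]
  exact Measure.ae_smul_measure ((ae_restrict_iff' hB).2 h) _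

namespace Tree

variable (T : Tree v μ₀) (impatience : ∀ a θ t t', t' < t → v a θ t < v a θ t')
include impatience

lemma admissible : Admissible v T.info :=
  T.ae_measure_iff.2 fun l hl => by
    rw [stopTime, T.stopFrom_path impatience hl (Nat.zero_le _)]
    exact ENat.natCast_lt_top _

omit impatience in
lemma historyEvent_pos {l : Leaf v} (hl : T.mass l ≠ 0) (t : ℕ) :
    0 < T.info.law (historyEvent t (T.path l)) := by
  refine pos_iff_ne_zero.2 fun h => ?_
  have h1 := T.measureReal_historyEvent hl t
  rw [measureReal_def, show T.measure (historyEvent t (T.path l)) = 0 from h] at h1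
  exact (T.tsum_lawAt_pos hl t).ne h1

omit impatience in
lemma le_level_of_history {l l' : Leaf v} {t : ℕ} (ht : t ≤ l.2.level)
    (h : ∀ u ≤ t, T.path l' u = T.path l u) : t ≤ l'.2.level := by
  by_contra hlt
  have h1 := T.message_eq_one_iff.2 (le_refl l'.2.level)
  rw [h _ (by omega), T.message_eq_one_iff] at h1
  omega

lemma path_mem_hitEvent_iff {l : Leaf v} (hl : T.mass l ≠ 0) {t : ℕ} (ht : t ≤ l.2.level)
    {z : ExtPoint v} : T.path l ∈ hitEvent T.info t z ↔ l.2 = z := by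
  have hself : T.path l ∈ hitEvent T.info t l.2 :=
    ⟨T.stopFrom_path impatience hl ht, by rw [T.path_of_le le_rfl]⟩
  exact ⟨fun h => eq_of_mem_hitEvent hself h, fun h => h ▸ hself⟩

lemma setIntegral_hitEvent {l : Leaf v} (hl : T.mass l ≠ 0) {t : ℕ} (ht : t ≤ l.2.level)
    (z : ExtPoint v) : ∫ ω in historyEvent t (T.path l),
      (hitEvent T.info t z).indicator (fun _ => (1 : ℝ)) ω ∂T.measure = T.lawAt t l z := by
  classical
  have := T.hasSum_setIntegral hl t
    ((integrable_const (1 : ℝ)).indicator (measurableSet_hitEvent impatience T.info t z))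
    (φ := fun z' => if z' = z then 1 else 0) fun l' hl' hag => by
      simp only [indicator_apply,
        T.path_mem_hitEvent_iff impatience hl' (T.le_level_of_history ht hag)]
  rw [← this.tsum_eq, tsum_eq_single z fun z' hz' => by simp [hz']]
  simp

lemma cond_hitEvent {l : Leaf v} (hl : T.mass l ≠ 0) {t : ℕ} (ht : t ≤ l.2.level)
    (z : ExtPoint v) : (T.measure[|historyEvent t (T.path l)]).real (hitEvent T.info t z) =
      (∑' z, T.lawAt t l z)⁻¹ * T.lawAt t l z := by
  have hE : MeasurableSet (historyEvent t (T.path l)) :=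
    (hist Θ).le t _ (measurableSet_historyEvent t _)
  have hm := measurableSet_hitEvent impatience T.info t z
  rw [measureReal_def, cond_apply hE, ENNReal.toReal_mul, ENNReal.toReal_inv, ← measureReal_def,
    ← measureReal_def, T.measureReal_historyEvent hl, ← T.setIntegral_hitEvent impatience hl ht,
    setIntegral_indicator hm]
  simp

lemma condExpKernel_hitEvent (t : ℕ) : ∀ᵐ ω ∂T.measure, ∀ z : ExtPoint v,
    (condExpKernel T.measure (hist Θ t) ω).real (hitEvent T.info t z) =
      (T.measure[(hitEvent T.info t z).indicator (fun _ => (1 : ℝ)) | hist Θ t]) ω :=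
  ae_all_iff.2 fun z => condExpKernel_ae_eq_condExp ((hist Θ).le t)
    (measurableSet_hitEvent impatience T.info t z)

omit impatience in
lemma hasSum_lawAt_normalized {l : Leaf v} (hl : T.mass l ≠ 0) (t : ℕ) :
    HasSum (fun z => (∑' z, T.lawAt t l z)⁻¹ * T.lawAt t l z) 1 := by
  have := (summable_of_weight (T.isLaw_lawAt t l).summable).hasSum.mul_left (∑' z, T.lawAt t l z)⁻¹
  rwa [inv_mul_cancel₀ (T.tsum_lawAt_pos hl t).ne'] at this

variable (f : A → ℕ → ℝ) (hf : Summable fun z => T.root z * indirectPayoff v f z.belief z.level)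
include hf

omit impatience in
lemma summable_lawAt_mul (t : ℕ) (l : Leaf v) :
    Summable fun z => T.lawAt t l z * indirectPayoff v f z.belief z.level := by
  refine Summable.of_norm_bounded hf.abs fun z => ?_
  rw [Real.norm_eq_abs, abs_mul, abs_mul, abs_of_nonneg (T.lawAt_nonneg t l z),
    abs_of_nonneg (T.isLaw.nonneg z)]
  exact mul_le_mul_of_nonneg_right (T.lawAt_le_root t l z) (abs_nonneg _)

lemma expPayoff_of_hitEvent {l : Leaf v} (hl : T.mass l ≠ 0) {t : ℕ}
    (Q : Measure (Path Θ)) [IsProbabilityMeasure Q]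
    (hQ : ∀ z, Q.real (hitEvent T.info t z) = (∑' z, T.lawAt t l z)⁻¹ * T.lawAt t l z) :
    expPayoff f (outcomeDist v T.info (favourableTieBreak v f) t Q) =
      (((∑' z, T.lawAt t l z)⁻¹ *
        ∑' z, T.lawAt t l z * indirectPayoff v f z.belief z.level : ℝ) : EReal) := by
  rw [expPayoff_favourableTieBreak impatience T.info t Q f hQ (T.hasSum_lawAt_normalized hl t)]
  · simp only [mul_assoc, tsum_mul_left]
  · simpa only [mul_assoc] using (T.summable_lawAt_mul f hf t l).mul_left _

lemma expPayoff_cond {l : Leaf v} (hl : T.mass l ≠ 0) {t : ℕ} (ht : t ≤ l.2.level) :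
    expPayoff f (outcomeDist v T.info (favourableTieBreak v f) t
        (T.info.law[|historyEvent t (T.path l)])) =
      (((∑' z, T.lawAt t l z)⁻¹ *
        ∑' z, T.lawAt t l z * indirectPayoff v f z.belief z.level : ℝ) : EReal) := by
  have := cond_isProbabilityMeasure (T.historyEvent_pos hl t).ne'
  exact T.expPayoff_of_hitEvent impatience f hf hl _ (T.cond_hitEvent impatience hl ht)

/-- The history of a leaf of positive mass has positive probability, so on the countably many hit
events the kernel agrees with elementary conditioning. -/
lemma expPayoff_condExpKernel (t : ℕ) : ∀ l, T.mass l ≠ 0 → t ≤ l.2.level →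
    expPayoff f (outcomeDist v T.info (favourableTieBreak v f) t
        (condExpKernel T.info.law (hist Θ t) (T.path l))) =
      (((∑' z, T.lawAt t l z)⁻¹ *
        ∑' z, T.lawAt t l z * indirectPayoff v f z.belief z.level : ℝ) : EReal) := by
  intro l hl ht
  refine T.expPayoff_of_hitEvent impatience f hf hl _ fun z => ?_
  have h1 := T.ae_measure_iff.1 (T.condExpKernel_hitEvent impatience t) l hl z
  have h2 := condExp_mul_measureReal_historyEvent
    ((integrable_const (μ := T.measure) (1 : ℝ)).indicator
      (measurableSet_hitEvent impatience T.info t z)) t (T.path l)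
  rw [← h1, T.setIntegral_hitEvent impatience hl ht, T.measureReal_historyEvent hl] at h2
  rw [← h2, mul_comm, mul_assoc, mul_inv_cancel₀ (T.tsum_lawAt_pos hl t).ne', mul_one]
  rfl

end Tree

end

/-! ### The designer's problem as a choice of a feasible law. -/

section

variable [Nonempty A] {v : A → Θ → ℕ → ℝ}

/-! ### Feasible laws -/

/-- The laws of stopping beliefs and stopping times under obedience. -/
structure IsFeasible (μ₀ : Belief Θ) (Q : ExtPoint v → ℝ) : Prop where
  isLaw : IsLaw Q
  support : ∀ z, Q z ≠ 0 → 0 < z.level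
  obedient : Obedient 0 Q
  bary : ∀ θ, HasSum (fun z => Q z * z.belief θ) (μ₀ θ)

namespace Tree

variable (T : Tree v μ₀)

lemma isFeasible_root : IsFeasible μ₀ T.root := ⟨T.isLaw, T.support, T.obedient, T.bary⟩

lemma exists_mass_ne_zero : ∃ l, T.mass l ≠ 0 := by
  by_contra! h
  have : ∀ᵐ ω ∂T.measure, False := T.ae_measure_iff.2 fun l hl => hl (h l)
  exact this.exists.elim fun _ h => h

lemma path_zero {l : Leaf v} (hl : T.mass l ≠ 0) : T.path l 0 = (μ₀, 0) :=
  T.ae_measure_iff.1 T.info.initial l hl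

lemma lawAt_zero {l : Leaf v} (hl : T.mass l ≠ 0) : T.lawAt 0 l = T.root :=
  if_pos (T.valid_of_mass hl).1

section Behaviour

variable (impatience : ∀ a θ t t', t' < t → v a θ t < v a θ t')
include impatience

lemma measureReal_hitEvent_zero (z : ExtPoint v) :
    T.measure.real (hitEvent T.info 0 z) = T.root z := by
  obtain ⟨l, hl⟩ := T.exists_mass_ne_zero
  have h := T.cond_hitEvent impatience hl (Nat.zero_le _) z
  rw [T.lawAt_zero hl, T.hasSum_root.tsum_eq, inv_one, one_mul,
    show T.measure[|historyEvent 0 (T.path l)] = T.measure from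
      cond_historyEvent_zero T.info (T.path_zero hl)] at h
  exact h

lemma designerPayoff_info (f : A → ℕ → ℝ)
    (hf : Summable fun z => T.root z * indirectPayoff v f z.belief z.level) :
    designerPayoff v f T.info (favourableTieBreak v f) =
      ((∑' z, T.root z * indirectPayoff v f z.belief z.level : ℝ) : EReal) :=
  expPayoff_favourableTieBreak impatience T.info 0 T.measure f
    (T.measureReal_hitEvent_zero impatience) T.hasSum_root hf

end Behaviour

end Tree

namespace IsFeasible

/-- The tree in which only continue and stop are ever communicated. -/
def uninformativeTree {Q : ExtPoint v → ℝ} (hQ : IsFeasible μ₀ Q) : Tree v μ₀ where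
  root := Q
  isLaw := hQ.isLaw
  support := hQ.support
  obedient := hQ.obedient
  bary := hQ.bary
  split _ Q' i := if i = 0 then Q' else 0
  splits t Q' h _ hob :=
    { isLaw := fun i => by
        split_ifs
        exacts [h, IsLaw.zero]
      obedient := fun i => by
        split_ifs
        exacts [hob, Obedient.zero t]
      hasSum := fun z => by
        have := hasSum_ite_eq (0 : ℕ) (Q' z)
        refine this.congr_fun fun i => ?_
        split_ifs <;> rfl }

/-- Every split puts all its mass on message `0`, so along paths of positive probability the node
before stopping depends on time only. The continuation beliefs are therefore deterministic. -/
lemma extremalObedient (impatience : ∀ a θ t t', t' < t → v a θ t < v a θ t')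
    {Q : ExtPoint v → ℝ} (hQ : IsFeasible μ₀ Q) :
    ExtremalObedient v hQ.uninformativeTree.info := by
  set T := hQ.uninformativeTree with hT
  refine ⟨fun t => barycenter μ₀ (T.node t 0), T.ae_measure_iff.2 fun l hl t hmsg => ?_⟩
  have ht : t < l.2.level := by
    by_contra hlt
    have := T.message_eq_one_iff.2 (not_lt.1 hlt)
    rw [hmsg t le_rfl] at this
    exact zero_ne_one this
  refine ⟨T.not_stopsAt impatience hl ht, ?_⟩
  rcases (Nat.succ_le_of_lt ht).eq_or_lt with h | h
  · refine Or.inl ⟨T.message_eq_one_iff.2 h.ge, ?_, T.stopsAt impatience hl h.ge⟩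
    rw [T.path_of_le h.ge]
    have := l.2.2
    change l.2.belief ∈ extBeliefs v l.2.level at this
    rwa [← h] at this
  · right
    have h1 : l.1 (t + 1) = 0 := by
      -- A message other than `0` leads to the zero law, so such a leaf would have no mass.
      by_contra hne
      have h2 := T.mass_le_node hl h
      have h3 : T.node (t + 1) l.1 l.2 = 0 := by
        change (if l.1 (t + 1) = 0 then tail (t + 1) (T.node t l.1) else 0) l.2 = 0
        rw [if_neg hne]
        rfl
      exact hl (le_antisymm (h3 ▸ h2) (T.mass_nonneg l))
    have h4 : ∀ u ≤ t + 1, l.1 u = (0 : ℕ → ℕ) u := by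
      intro u hu
      rcases hu.eq_or_lt with rfl | hu
      · exact h1
      · have := hmsg u (by omega)
        rw [T.path_of_lt (by omega)] at this
        refine Tree.code_injective (this.trans ?_)
        simp [Tree.code]
    rw [T.path_of_lt h, T.node_congr h4, h1]
    exact ⟨by simp [Tree.code], rfl⟩

lemma exists_mem_feasibleDists (impatience : ∀ a θ t t', t' < t → v a θ t < v a θ t')
    {Q : ExtPoint v → ℝ} (hQ : IsFeasible μ₀ Q) : ∃ p ∈ feasibleDists v μ₀, p.mass = Q :=
  ⟨⟨Q, hQ.isLaw.nonneg, hQ.uninformativeTree.hasSum_root⟩, ⟨hQ.uninformativeTree.info,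
    hQ.extremalObedient impatience,
    fun z => (hQ.uninformativeTree.measureReal_hitEvent_zero impatience z).symm⟩, rfl⟩

end IsFeasible

/-- The whole space serves as the conditioning event at time `0`. Waiting at time `0` is what keeps
the law away from level `0`. -/
lemma exists_isFeasible_of_structure (impatience : ∀ a θ t t', t' < t → v a θ t < v a θ t')
    (I : InfoStructure μ₀) (γ : TieBreak v) (hadm : Admissible v I)
    (h0 : ∀ᵐ ω ∂I.law, ¬ StopsAt v I 0 ω) : ∃ Q : ExtPoint v → ℝ, IsFeasible μ₀ Q ∧
      ∀ f : A → ℕ → ℝ, (Summable fun z => Q z * indirectPayoff v f z.belief z.level) →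
        designerPayoff v f I γ ≤
          ((∑' z, Q z * indirectPayoff v f z.belief z.level : ℝ) : EReal) := by
  obtain ⟨Q, hlaw, hsupp, hob, hbary, -, hpay⟩ := exists_law_of_structure impatience I γ (t := 0)
    (B := univ) MeasurableSet.univ (by simp) (by rw [cond_univ]; exact hadm)
  rw [cond_univ] at hsupp hpay
  refine ⟨Q, ⟨hlaw, fun z hz => Nat.pos_of_ne_zero fun hz0 => (hsupp z hz).2 ?_, hob, fun θ => ?_⟩,
    hpay⟩
  · rw [hz0]
    refine measure_mono_null (t := {ω | ¬ ¬ StopsAt v I 0 ω}) (fun ω hω => ?_) h0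
    exact not_not.2 (stopFrom_eq_iff.1 hω).2.1
  · have := hbary θ
    rwa [cond_univ, integral_congr_ae (g := fun _ => μ₀ θ) (by
      filter_upwards [I.initial] with ω hω
      rw [hω]), integral_const, probReal_univ, one_smul] at this

/-- Feasible laws all lie in the compact set, so the maximizer `p` over that set bounds their
payoffs. Instead of verifying that `p` itself is feasible, the structure that induces `p` is turned
into a feasible law that does at least as well. -/
lemma exists_optimal_law (impatience : ∀ a θ t t', t' < t → v a θ t < v a θ t')
    {f : A → ℕ → ℝ} (hf : CompactnessAssumption v μ₀ f)
    (hne : ∃ Q : ExtPoint v → ℝ, IsFeasible μ₀ Q) :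
    ∃ Q : ExtPoint v → ℝ, IsFeasible μ₀ Q ∧ ∀ Q' : ExtPoint v → ℝ, IsFeasible μ₀ Q' →
      (Summable fun z => Q' z * indirectPayoff v f z.belief z.level) ∧
      ∑' z, Q' z * indirectPayoff v f z.belief z.level ≤
        ∑' z, Q z * indirectPayoff v f z.belief z.level := by
  obtain ⟨hsum, _, hcomp, hcont⟩ := hf
  have hne' : (feasibleDists v μ₀).Nonempty := by
    obtain ⟨Q, hQ⟩ := hne
    obtain ⟨p, hp, -⟩ := hQ.exists_mem_feasibleDists impatience
    exact ⟨p, hp⟩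
  obtain ⟨p, hp, hmax⟩ := hcomp.exists_isMaxOn hne' hcont
  have hsum' : ∀ Q : ExtPoint v → ℝ, IsFeasible μ₀ Q →
      Summable fun z => Q z * indirectPayoff v f z.belief z.level := by
    intro Q hQ
    obtain ⟨q, hq, rfl⟩ := hQ.exists_mem_feasibleDists impatience
    exact hsum q hq
  have hle : ∀ Q : ExtPoint v → ℝ, IsFeasible μ₀ Q →
      ∑' z, Q z * indirectPayoff v f z.belief z.level ≤
        ∑' z : ExtPoint v, p.mass z * indirectPayoff v f z.belief z.level := by
    intro Q hQ
    obtain ⟨q, hq, rfl⟩ := hQ.exists_mem_feasibleDists impatience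
    exact hmax hq
  obtain ⟨I, ⟨μC, hI⟩, hpI⟩ := id hp
  have hhit : ∀ z : ExtPoint v, I.law.real (hitEvent I 0 z) = p.mass z := fun z => (hpI z).symm
  have hadm : Admissible v I := by
    filter_upwards [ae_exists_mem_hitEvent impatience I 0 I.law hhit p.hasSum_one] with ω hω
    obtain ⟨z, hz⟩ := hω
    rw [stopTime, hz.1]
    exact ENat.natCast_lt_top _
  have h0 : ∀ᵐ ω ∂I.law, ¬ StopsAt v I 0 ω := by
    filter_upwards [hI, I.initial] with ω hω hω0
    refine (hω 0 fun s hs => ?_).1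
    rw [Nat.le_zero.1 hs, hω0]
  obtain ⟨Q, hQ, hpay⟩ := exists_isFeasible_of_structure impatience I (favourableTieBreak v f) hadm h0
  have h1 := expPayoff_favourableTieBreak impatience I 0 I.law f hhit p.hasSum_one (hsum p hp)
  have h2 := hpay f (hsum' Q hQ)
  rw [designerPayoff, jointDist, h1, EReal.coe_le_coe_iff] at h2
  exact ⟨Q, hQ, fun Q' hQ' => ⟨hsum' Q' hQ', (hle Q' hQ').trans h2⟩⟩

end

section

variable [Nonempty A] {v : A → Θ → ℕ → ℝ}

/-! ### Bounds on the designer's payoff and the value of no information -/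

section Bounds

variable (impatience : ∀ a θ t t', t' < t → v a θ t < v a θ t')
include impatience

/-- The initial history is deterministic, so the decision maker either stops at time `0` almost
surely, with the first bound, or waits almost surely, with a feasible law to compare with. -/
lemma designerPayoff_le_or_exists_isFeasible (I : InfoStructure μ₀) (γ : TieBreak v)
    (hadm : Admissible v I) (f : A → ℕ → ℝ) :
    designerPayoff v f I γ ≤ (indirectPayoff v f μ₀ 0 : EReal) ∨
      ∃ Q : ExtPoint v → ℝ, IsFeasible μ₀ Q ∧
        ((Summable fun z => Q z * indirectPayoff v f z.belief z.level) →
          designerPayoff v f I γ ≤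
            ((∑' z, Q z * indirectPayoff v f z.belief z.level : ℝ) : EReal)) := by
  have hiff : ∀ᵐ ω ∂I.law, StopsAt v I 0 ω ↔ StopsAt v I 0 fun _ => (μ₀, 0) := by
    filter_upwards [I.initial] with ω hω
    refine mem_iff_of_history (S := {ω | StopsAt v I 0 ω})
      (measurableSet_stopsAt impatience I le_rfl) fun s hs => ?_
    rw [Nat.le_zero.1 hs, hω]
  by_cases h : StopsAt v I 0 fun _ => (μ₀, 0)
  · left
    rw [designerPayoff, jointDist, expPayoff_of_stop_zero I γ f I.law, EReal.coe_le_coe_iff]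
    · exact γ.sum_rule_mul_le f 0 μ₀
    · filter_upwards [hiff, I.initial] with ω hω hω0
      refine ⟨?_, hω0⟩
      exact_mod_cast stopFrom_eq_iff.2 ⟨le_rfl, hω.2 h, fun u _ hu => absurd hu (Nat.not_lt_zero u)⟩
  · right
    obtain ⟨Q, hQ, hpay⟩ := exists_isFeasible_of_structure impatience I γ hadm (by
      filter_upwards [hiff] with ω hω
      rwa [hω])
    exact ⟨Q, hQ, hpay f⟩

lemma designerPayoff_le {f : A → ℕ → ℝ} {V : ℝ} (h0 : indirectPayoff v f μ₀ 0 ≤ V)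
    (hV : ∀ Q : ExtPoint v → ℝ, IsFeasible μ₀ Q →
      (Summable fun z => Q z * indirectPayoff v f z.belief z.level) ∧
        ∑' z, Q z * indirectPayoff v f z.belief z.level ≤ V)
    (I : InfoStructure μ₀) (γ : TieBreak v) (hadm : Admissible v I) :
    designerPayoff v f I γ ≤ V := by
  rcases designerPayoff_le_or_exists_isFeasible impatience I γ hadm f with h | ⟨Q, hQ, h⟩
  · exact h.trans (EReal.coe_le_coe_iff.2 h0)
  · exact (h (hV Q hQ).1).trans (EReal.coe_le_coe_iff.2 (hV Q hQ).2)

end Bounds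

/-- An alternative at the initial history is an admissible structure. -/
lemma AlternativeAt.admissible {I : InfoStructure μ₀} {ω : Path Θ} (hω : ω 0 = (μ₀, 0))
    (h : AlternativeAt v 0 ω I) : Admissible v I := by
  have := h.2
  rwa [cond_historyEvent_zero I hω] at this

/-- The structure that never reveals anything. -/
def noInfo (μ₀ : Belief Θ) : InfoStructure μ₀ where
  law := Measure.dirac fun _ => (μ₀, 0)
  isProb := inferInstance
  initial := by
    rw [ae_dirac_iff (measurableSet_eq_fun (measurable_pi_apply 0) measurable_const)]
  martingale t θ := by
    have h : ∀ s, (fun ω : Path Θ => (ω s).1 θ) =ᵐ[Measure.dirac fun _ => (μ₀, 0)]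
        fun _ => μ₀ θ := fun s => by
      rw [Filter.EventuallyEq, ae_dirac_iff (measurableSet_eq_fun
        (measurable_belief_coord s θ) measurable_const)]
    refine (condExp_congr_ae (h (t + 1))).trans ?_
    rw [condExp_const ((hist Θ).le t)]
    exact (h t).symm

section NoInfo

variable (impatience : ∀ a θ t t', t' < t → v a θ t < v a θ t')
include impatience

lemma stopFrom_noInfo : ∀ᵐ ω ∂(noInfo μ₀).law, stopFrom v (noInfo μ₀) 0 ω = 0 ∧ ω 0 = (μ₀, 0) := by
  have hconst : ∀ᵐ ω ∂(noInfo μ₀).law, ∀ s, (ω s).1 = μ₀ := by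
    refine ae_all_iff.2 fun s => ?_
    change ∀ᵐ ω ∂(Measure.dirac fun _ => (μ₀, (0 : ℝ)) : Measure (Path Θ)), (ω s).1 = μ₀
    have hm : Measurable fun ω : Path Θ => (ω s).1 := measurable_fst.comp (measurable_pi_apply s)
    rw [ae_dirac_iff (measurableSet_eq_fun hm measurable_const)]
  have := stopsAt_of_constant impatience (noInfo μ₀) (s := 0) MeasurableSet.univ (by
    filter_upwards [hconst] with ω hω _ u _
    rw [hω, hω])
  filter_upwards [this, (noInfo μ₀).initial] with ω hω hω0
  refine ⟨?_, hω0⟩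
  exact_mod_cast stopFrom_eq_iff.2
    ⟨le_rfl, hω trivial, fun u _ hu => absurd hu (Nat.not_lt_zero u)⟩

lemma admissible_noInfo : Admissible v (noInfo μ₀) := by
  filter_upwards [stopFrom_noInfo impatience] with ω hω
  rw [stopTime, hω.1]
  exact ENat.natCast_lt_top 0

lemma designerPayoff_noInfo (f : A → ℕ → ℝ) :
    designerPayoff v f (noInfo μ₀) (favourableTieBreak v f) = (indirectPayoff v f μ₀ 0 : EReal) := by
  rw [designerPayoff, jointDist, expPayoff_of_stop_zero _ _ f _ (stopFrom_noInfo impatience),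
    sum_favourableTieBreak_mul]

/-- Attention ends at time `0`, so only the initial history matters, and the alternatives there are
the admissible structures. -/
lemma sequentiallyOptimal_noInfo {f : A → ℕ → ℝ}
    (h : ∀ (I : InfoStructure μ₀) (γ : TieBreak v), Admissible v I →
      designerPayoff v f I γ ≤ (indirectPayoff v f μ₀ 0 : EReal)) :
    SequentiallyOptimal v f (noInfo μ₀) (favourableTieBreak v f) := by
  refine ⟨admissible_noInfo impatience, fun t => ?_⟩
  rcases Nat.eq_zero_or_pos t with rfl | ht
  · have hker : ∀ᵐ ω ∂(noInfo μ₀).law, ∀ᵐ ω' ∂condExpKernel (noInfo μ₀).law (hist Θ 0) ω,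
        stopFrom v (noInfo μ₀) 0 ω' = 0 ∧ ω' 0 = (μ₀, 0) := by
      -- An almost sure property holds almost surely under the conditional kernel as well, since
      -- composing the kernel with the law gives the law back.
      refine ae_of_ae_trim ((hist Θ).le 0) (Measure.ae_ae_of_ae_comp ?_)
      rw [condExpKernel_comp_trim]
      exact stopFrom_noInfo impatience
    filter_upwards [hker, (noInfo μ₀).initial] with ω hω hω0 _
    rw [expPayoff_of_stop_zero _ _ f _ hω, sum_favourableTieBreak_mul]
    refine le_antisymm (iSup_le fun I => iSup_le fun γ => iSup_le fun hI => ?_) ?_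
    · rw [cond_historyEvent_zero I hω0]
      exact h I γ (hI.admissible hω0)
    · have hcond := cond_historyEvent_zero (noInfo μ₀) hω0
      refine le_trans ?_ (le_iSup₂_of_le (noInfo μ₀) (favourableTieBreak v f)
        (le_iSup_of_le ⟨?_, ?_⟩ le_rfl))
      · rw [hcond]
        exact (designerPayoff_noInfo impatience f).ge
      · rw [measure_congr (historyEvent_zero_ae_eq_univ _ hω0), measure_univ]
        exact zero_lt_one
      · rw [hcond]
        exact admissible_noInfo impatience
  · filter_upwards [stopFrom_noInfo impatience] with ω hω hle
    rw [stopTime, hω.1] at hle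
    exact absurd (by exact_mod_cast hle) ht.not_ge

end NoInfo

end

/-! ### Sequential optimality of tight trees. -/

section

variable [Nonempty A] {v : A → Θ → ℕ → ℝ}

/-! ### Replacing the continuation at a node -/

namespace Tree

variable (T : Tree v μ₀)

/-- From time `1` on, the decision maker is kept indifferent between stopping and waiting. -/
def IsTight : Prop := ∀ t Q, IsLaw Q → (∀ z, Q z ≠ 0 → t < z.level) → Obedient t Q →
  ∀ i, Tight t (T.split t Q i)

variable {T}

lemma IsTight.node (hT : T.IsTight) {t : ℕ} (ht : 0 < t) (σ : ℕ → ℕ) : Tight t (T.node t σ) := by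
  obtain ⟨t, rfl⟩ := Nat.exists_eq_succ_of_ne_zero ht.ne'
  refine hT (t + 1) _ ((T.node_spec t σ).1.tail (t + 1)) (fun z hz => ?_)
    ((T.node_spec t σ).2.2.tail (Nat.le_succ t)) _
  by_contra h
  exact hz (if_neg h)

lemma le_level_of_lawAt {l : Leaf v} {t : ℕ} (ht : t ≤ l.2.level) {z : ExtPoint v}
    (hz : T.lawAt t l z ≠ 0) : t ≤ z.level := by
  rcases ht.lt_or_eq with h | h
  · exact (T.lt_level_of_lawAt h hz).le
  · rw [T.eq_of_lawAt h.ge hz]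
    exact ht

/-- The tree promises no more than the payoff from stopping now. While the decision maker waits this
is tightness of the node; at the moment of stopping it is an equality. -/
lemma IsTight.tsum_lawAt_mul_vStar_le (hT : T.IsTight) {l : Leaf v} {t : ℕ} (h0 : 0 < t)
    (ht : t ≤ l.2.level) : ∑' z, T.lawAt t l z * vStar v z.level z.belief ≤
      (∑' z, T.lawAt t l z) * vStar v t (T.path l t).1 := by
  rcases ht.lt_or_eq with h | h
  · obtain ⟨a, ha⟩ := hT.node h0 l.1
    have hlaw : T.lawAt t l = T.node t l.1 := if_pos h
    rw [← hlaw, slack_eq_sub (T.isLaw_lawAt t l) (fun z hz => T.lt_level_of_lawAt h hz)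
      (fun θ => (T.tsum_lawAt_mul_belief t l θ).symm) a, sub_nonpos] at ha
    exact ha.trans (mul_le_mul_of_nonneg_left (expUtil_le_vStar v t _ a)
      (tsum_nonneg (T.lawAt_nonneg t l)))
  · have hz : ∀ z, z ≠ l.2 → T.lawAt t l z = 0 := fun z hz => by
      by_contra hne
      exact hz (T.eq_of_lawAt h.ge hne)
    rw [tsum_eq_single l.2 fun z hzl => by rw [hz z hzl, zero_mul], tsum_eq_single l.2 hz,
      T.path_of_le h.ge, h]

lemma obedient_root_sub_lawAt {l : Leaf v} {t : ℕ} (ht : t ≤ l.2.level) :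
    Obedient t (T.root - T.lawAt t l) := by
  rcases ht.lt_or_eq with h | h
  · rw [lawAt, if_pos h]
    exact T.obedient_root_sub_node t l.1
  · intro t' ht' a
    rw [slack_sub t' a T.isLaw.summable (T.isLaw_lawAt t l).summable,
      slack_eq_zero (Q := T.lawAt t l) a fun z hz => by
      rw [T.eq_of_lawAt h.ge hz, ← h]
      exact ht', sub_zero]
    exact T.obedient t' (Nat.zero_le _) a

/-- The substitution keeps the barycenter, so before `t` the constraints change only through the
expected stopping payoff. This cannot fall: the alternative gives at least `v*` at the current
belief, while the tree gave at most that. From `t` on, the rest of the root law and the new part are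
obedient separately. -/
lemma IsTight.isFeasible_replace (hT : T.IsTight) {l : Leaf v} {t : ℕ} (h0 : 0 < t)
    (ht : t ≤ l.2.level) {Q : ExtPoint v → ℝ} (hQ : IsLaw Q) (hsupp : ∀ z, Q z ≠ 0 → t ≤ z.level)
    (hob : Obedient t Q) (hbary : ∀ θ, HasSum (fun z => Q z * z.belief θ) ((T.path l t).1 θ))
    (hv : vStar v t (T.path l t).1 ≤ ∑' z, Q z * vStar v z.level z.belief) :
    IsFeasible μ₀ (T.root - T.lawAt t l + (∑' z, T.lawAt t l z) • Q) := by
  have hN := T.isLaw_lawAt t l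
  have hπ : 0 ≤ ∑' z, T.lawAt t l z := tsum_nonneg (T.lawAt_nonneg t l)
  have hsub : IsLaw (T.root - T.lawAt t l) :=
    T.isLaw.mono (fun z => sub_nonneg.2 (T.lawAt_le_root t l z))
      fun z => sub_le_self _ (T.lawAt_nonneg t l z)
  refine ⟨hsub.add (hQ.smul hπ), fun z hz => ?_, fun t' _ a => ?_, fun θ => ?_⟩
  · by_contra hlev
    have hr : T.root z = 0 := by
      by_contra h
      exact hlev (T.support z h)
    have hn : T.lawAt t l z = 0 :=
      le_antisymm ((T.lawAt_le_root t l z).trans hr.le) (T.lawAt_nonneg t l z)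
    have hq : Q z = 0 := by
      by_contra h
      exact hlev (h0.trans_le (hsupp z h))
    exact hz (by simp [hr, hn, hq])
  · rw [slack_add t' a hsub.summable (hQ.smul hπ).summable, slack_smul]
    rcases le_or_gt t t' with h | h
    · exact add_nonneg (obedient_root_sub_lawAt ht t' h a) (mul_nonneg hπ (hob t' h a))
    -- For `t' < t` all the mass removed or added stops after `t'`, and both parts have the same
    -- mass and mean belief. The terms in `a` cancel, and the comparison of stopping payoffs
    -- remains.
    · rw [slack_sub t' a T.isLaw.summable hN.summable,
        slack_eq_sub hN (fun z hz => h.trans_le (le_level_of_lawAt ht hz))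
          (fun θ => (T.tsum_lawAt_mul_belief t l θ).symm) a,
        slack_eq_sub hQ (fun z hz => h.trans_le (hsupp z hz)) (c := 1) (μ := (T.path l t).1)
          (fun θ => by rw [(hbary θ).tsum_eq, one_mul]) a]
      have h1 := T.obedient t' (Nat.zero_le _) a
      have h2 := hT.tsum_lawAt_mul_vStar_le h0 ht
      have h3 := mul_le_mul_of_nonneg_left hv hπ
      linarith
  · have h1 := ((T.bary θ).sub (summable_mul_belief hN.summable θ).hasSum).add
      ((hbary θ).mul_left (∑' z, T.lawAt t l z))
    rw [← T.tsum_lawAt_mul_belief, sub_add_cancel] at h1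
    refine h1.congr_fun fun z => ?_
    simp only [Pi.add_apply, Pi.sub_apply, Pi.smul_apply, smul_eq_mul]
    ring

end Tree

section TightTree

variable (impatience : ∀ a θ t t', t' < t → v a θ t < v a θ t')
include impatience

open Classical in
lemma IsFeasible.exists_tight_tree {Q : ExtPoint v → ℝ} (hQ : IsFeasible μ₀ Q) :
    ∃ T : Tree v μ₀, T.root = Q ∧ T.IsTight := by
  let split : ℕ → (ExtPoint v → ℝ) → ℕ → ExtPoint v → ℝ := fun t Q' =>
    if h : IsLaw Q' ∧ (∀ z, Q' z ≠ 0 → t < z.level) ∧ Obedient t Q' then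
      (exists_tight_splits impatience h.1 h.2.1 h.2.2).choose else fun _ => 0
  have hsplit : ∀ t Q', IsLaw Q' → (∀ z, Q' z ≠ 0 → t < z.level) → Obedient t Q' →
      Splits t Q' (split t Q') ∧ ∀ i, Tight t (split t Q' i) := by
    intro t Q' h1 h2 h3
    have := (exists_tight_splits impatience h1 h2 h3).choose_spec
    rwa [← dif_pos (c := IsLaw Q' ∧ (∀ z, Q' z ≠ 0 → t < z.level) ∧ Obedient t Q')
      (t := fun h => (exists_tight_splits impatience h.1 h.2.1 h.2.2).choose)
      (e := fun _ _ => 0) ⟨h1, h2, h3⟩] at this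
  exact ⟨{ root := Q, isLaw := hQ.isLaw, support := hQ.support, obedient := hQ.obedient,
           bary := hQ.bary, split := split, splits := fun t Q' h1 h2 h3 => (hsplit t Q' h1 h2 h3).1 },
    rfl, fun t Q' h1 h2 h3 => (hsplit t Q' h1 h2 h3).2⟩

/-! ### Sequential optimality -/

omit impatience in
lemma integral_cond_historyEvent (I : InfoStructure μ₀) {t : ℕ} {ω : Path Θ}
    (hpos : 0 < I.law (historyEvent t ω)) (g : Belief Θ → ℝ) :
    ∫ ω', g (ω' t).1 ∂I.law[|historyEvent t ω] = g (ω t).1 := by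
  have := cond_isProbabilityMeasure hpos.ne'
  rw [integral_congr_ae (g := fun _ => g (ω t).1) (ae_cond
    ((hist Θ).le t _ (measurableSet_historyEvent t ω)) (Filter.Eventually.of_forall fun ω' h => by
      rw [h t le_rfl]))]
  simp

namespace Tree

variable {T : Tree v μ₀} {f : A → ℕ → ℝ}
  (hopt : ∀ Q : ExtPoint v → ℝ, IsFeasible μ₀ Q →
    (Summable fun z => Q z * indirectPayoff v f z.belief z.level) ∧
      ∑' z, Q z * indirectPayoff v f z.belief z.level ≤
        ∑' z, T.root z * indirectPayoff v f z.belief z.level)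
include hopt

/-- A better alternative, substituted at this history, would give a feasible law that beats the root
by the probability of the history times the gain. -/
lemma IsTight.expPayoff_alternative_le (hT : T.IsTight) {l : Leaf v} (hl : T.mass l ≠ 0) {t : ℕ}
    (h0 : 0 < t) (ht : t ≤ l.2.level) {I : InfoStructure μ₀} (γ : TieBreak v)
    (hI : AlternativeAt v t (T.path l) I) :
    expPayoff f (outcomeDist v I γ t (I.law[|historyEvent t (T.path l)])) ≤
      (((∑' z, T.lawAt t l z)⁻¹ *
        ∑' z, T.lawAt t l z * indirectPayoff v f z.belief z.level : ℝ) : EReal) := by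
  obtain ⟨Q, hQ, hsupp, hob, hbary, hv, hpay⟩ := exists_law_of_structure impatience I γ
    (measurableSet_historyEvent t (T.path l)) hI.1.ne' hI.2
  rw [integral_cond_historyEvent I hI.1 (vStar v t)] at hv
  have hfeas := hT.isFeasible_replace h0 ht hQ (fun z hz => (hsupp z hz).1) hob
    (fun θ => integral_cond_historyEvent I hI.1 (fun μ => μ θ) ▸ hbary θ) hv
  have hπ := T.tsum_lawAt_pos hl t
  obtain ⟨hs, hle⟩ := hopt _ hfeas
  set π := ∑' z, T.lawAt t l z
  have hroot := (hopt _ T.isFeasible_root).1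
  have hN := T.summable_lawAt_mul f hroot t l
  -- Solving the substitution for `Q` transfers summability from the feasible law obtained by
  -- replacement, so that none has to be assumed of the alternative.
  have heq : ∀ z, Q z * indirectPayoff v f z.belief z.level =
      π⁻¹ * ((T.root - T.lawAt t l + π • Q) z * indirectPayoff v f z.belief z.level -
        (T.root z * indirectPayoff v f z.belief z.level -
          T.lawAt t l z * indirectPayoff v f z.belief z.level)) := by
    intro z
    simp only [Pi.add_apply, Pi.sub_apply, Pi.smul_apply, smul_eq_mul]
    field_simp
    ring
  have hQs : Summable fun z => Q z * indirectPayoff v f z.belief z.level := by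
    simp only [heq]
    exact (hs.sub (hroot.sub hN)).mul_left _
  refine (hpay f hQs).trans (EReal.coe_le_coe_iff.2 ?_)
  simp only [heq]
  rw [tsum_mul_left, hs.tsum_sub (hroot.sub hN), hroot.tsum_sub hN]
  refine mul_le_mul_of_nonneg_left ?_ (inv_nonneg.2 hπ.le)
  linarith

lemma IsTight.sequentiallyOptimal (hT : T.IsTight)
    (hV : indirectPayoff v f μ₀ 0 ≤ ∑' z, T.root z * indirectPayoff v f z.belief z.level) :
    SequentiallyOptimal v f T.info (favourableTieBreak v f) := by
  have hroot := (hopt _ T.isFeasible_root).1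
  refine ⟨T.admissible impatience, fun t => T.ae_measure_iff.2 fun l hl hle => ?_⟩
  have ht : t ≤ l.2.level := by
    rw [stopTime, T.stopFrom_path impatience hl (Nat.zero_le _)] at hle
    exact_mod_cast hle
  rw [T.expPayoff_condExpKernel impatience f hroot t l hl ht]
  refine le_antisymm (iSup_le fun I => iSup_le fun γ => iSup_le fun hI => ?_) ?_
  -- At time `0` the root need not be tight, but there are no earlier constraints to protect, and
  -- the bound is the one under commitment.
  · rcases Nat.eq_zero_or_pos t with rfl | h0
    · rw [T.lawAt_zero hl, T.hasSum_root.tsum_eq, inv_one, one_mul,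
        cond_historyEvent_zero I (T.path_zero hl)]
      exact designerPayoff_le impatience hV hopt I γ (hI.admissible (T.path_zero hl))
    · exact hT.expPayoff_alternative_le impatience hopt hl h0 ht γ hI
  -- The tree is itself one of the alternatives, so the supremum is attained.
  · rw [← T.expPayoff_cond impatience f hroot hl ht]
    refine le_iSup₂_of_le T.info (favourableTieBreak v f) (le_iSup_of_le ⟨?_, ?_⟩ le_rfl)
    · exact T.historyEvent_pos hl t
    · refine ae_cond ((hist Θ).le t _ (measurableSet_historyEvent t _))
        (T.ae_measure_iff.2 fun l' hl' h => ?_)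
      rw [T.stopFrom_path impatience hl' (T.le_level_of_history ht h)]
      exact ENat.natCast_lt_top _

end Tree

end TightTree

end

end AttentionCapture

end

open AttentionCapture in
theorem proposition2 {Θ A : Type*} [Fintype Θ] [Fintype A] [Nonempty A]
    (v : A → Θ → ℕ → ℝ) (impatience : ∀ a θ t t', t' < t → v a θ t < v a θ t')
    (μ₀ : Belief Θ) (full_support : ∀ θ, 0 < μ₀ θ)
    (f : A → ℕ → ℝ) (compactness : CompactnessAssumption v μ₀ f) :
    (∃ (I₁ : InfoStructure μ₀) (γ₁ : TieBreak v) (I₂ : InfoStructure μ₀) (γ₂ : TieBreak v),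
      DesignerOptimal v f I₁ γ₁ ∧ SequentiallyOptimal v f I₂ γ₂ ∧
        jointDist v I₁ γ₁ = jointDist v I₂ γ₂) ∧
    ∃ V : ℝ,
      IsGreatest {x : EReal | ∃ (I : InfoStructure μ₀) (γ : TieBreak v),
        Admissible v I ∧ designerPayoff v f I γ = x} V ∧
      IsGreatest {x : EReal | ∃ (I : InfoStructure μ₀) (γ : TieBreak v),
        SequentiallyOptimal v f I γ ∧ designerPayoff v f I γ = x} V := by
  obtain ⟨I, γ, V, hseq, hpay, hle⟩ : ∃ (I : InfoStructure μ₀) (γ : TieBreak v) (V : ℝ),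
      SequentiallyOptimal v f I γ ∧ designerPayoff v f I γ = V ∧
        ∀ (I' : InfoStructure μ₀) (γ' : TieBreak v), Admissible v I' →
          designerPayoff v f I' γ' ≤ V := by
    -- Either no feasible law beats stopping at once, which includes the case that there is none, or
    -- an optimal feasible law does at least as well.
    have hopt : (∀ Q : ExtPoint v → ℝ, IsFeasible μ₀ Q →
        (Summable fun z => Q z * indirectPayoff v f z.belief z.level) ∧
          ∑' z, Q z * indirectPayoff v f z.belief z.level ≤ indirectPayoff v f μ₀ 0) ∨
        ∃ Q : ExtPoint v → ℝ, IsFeasible μ₀ Q ∧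
          indirectPayoff v f μ₀ 0 ≤ ∑' z, Q z * indirectPayoff v f z.belief z.level ∧
          ∀ Q' : ExtPoint v → ℝ, IsFeasible μ₀ Q' →
            (Summable fun z => Q' z * indirectPayoff v f z.belief z.level) ∧
              ∑' z, Q' z * indirectPayoff v f z.belief z.level ≤
                ∑' z, Q z * indirectPayoff v f z.belief z.level := by
      by_cases hne : ∃ Q : ExtPoint v → ℝ, IsFeasible μ₀ Q
      · obtain ⟨Q, hQ, hmax⟩ := exists_optimal_law impatience compactness hne
        rcases le_total (indirectPayoff v f μ₀ 0)
          (∑' z, Q z * indirectPayoff v f z.belief z.level) with h | h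
        · exact Or.inr ⟨Q, hQ, h, hmax⟩
        · exact Or.inl fun Q' hQ' => ⟨(hmax Q' hQ').1, (hmax Q' hQ').2.trans h⟩
      · exact Or.inl fun Q hQ => absurd ⟨Q, hQ⟩ hne
    rcases hopt with hmax | ⟨Q, hQ, hV, hmax⟩
    · have hle := designerPayoff_le impatience le_rfl hmax
      exact ⟨noInfo μ₀, favourableTieBreak v f, _, sequentiallyOptimal_noInfo impatience hle,
        designerPayoff_noInfo impatience f, hle⟩
    · obtain ⟨T, rfl, hT⟩ := hQ.exists_tight_tree impatience
      exact ⟨T.info, favourableTieBreak v f, _, hT.sequentiallyOptimal impatience hmax hV,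
        T.designerPayoff_info impatience f (hmax _ hQ).1, designerPayoff_le impatience hV hmax⟩
  -- A sequentially optimal pair that attains the commitment bound serves as both pairs, so equality
  -- of the joint distributions is trivial.
  refine ⟨⟨I, γ, I, γ, ⟨hseq.1, hpay ▸ hle⟩, hseq, rfl⟩, V, ⟨⟨I, γ, hseq.1, hpay⟩, ?_⟩,
    ⟨I, γ, hseq, hpay⟩, ?_⟩
  · rintro _ ⟨I', γ', hadm, rfl⟩
    exact hle I' γ' hadm
  · rintro _ ⟨I', γ', hseq', rfl⟩
    exact hle I' γ' hseq'.1
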